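/- Let $(M^N,g)$ be a complete smooth Riemannian manifold without boundary, with volume measure $\mathrm dv_g$ (also written $|\cdot|$ for the volume of sets) and with $\mathcal H_g^{N-1}$ the $(N-1)$-dimensional Hausdorff measure of the Riemannian distance. Let $A,\Omega\subseteq M$ be open sets such that $\partial A$ is a non-empty, compact, smooth hypersurface, $\mathcal H_g^{N-1}(\partial A\cap\partial\Omega)=0$, and $\overline\Omega$ is compact with smooth (possibly empty) boundary. Let $W\colon\mathbb R\to[0,+\infty)$ be continuous, and let $\alpha<\beta$ be real numbers with $W(\alpha)=W(\beta)=0$. Define $v_0\colon M\to\mathbb R$ by $v_0=\alpha$ on $A$ and $v_0=\beta$ on $M\setminus A$. For $\varepsilon>0$ and a Lipschitz function $u$ on $M$ put $$E_\varepsilon(u)=\frac{\varepsilon}{2}\int_\Omega|\nabla u|^2\,\mathrm dv_g+\frac1\varepsilon\int_\Omega W(u)\,\mathrm dv_g ,$$ and let $$\mathcal P_g(A,\Omega)=\sup\Big\{\int_\Omega\chi_A\,\mathrm{div}_g X\,\mathrm dv_g : X \text{ a smooth vector field with compact support in }\Omega,\ \sup_{p}|X_p|_g\le 1\Big\}.$$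 Then there is a family $(v_\varepsilon)_{\varepsilon>0}$ of Lipschitz continuous functions on $M$ with $\alpha\le v_\varepsilon\le\beta$ for every $\varepsilon>0$, such that $\int_M|v_\varepsilon-v_0|\,\mathrm dv_g\to0$ as $\varepsilon\to0^+$ (in particular $v_\varepsilon\to v_0$ in $L^1(\Omega)$), and 1. $\displaystyle\int_\Omega v_\varepsilon\,\mathrm dv_g=\int_\Omega v_0\,\mathrm dv_g=\alpha\,|A\cap\Omega|+\beta\,|\Omega\setminus A|$ for every $\varepsilon>0$; 2. $\displaystyle\limsup_{\varepsilon\to0^+}E_\varepsilon(v_\varepsilon)\le\mathcal P_g(A,\Omega)\,\int_\alpha^\beta\sqrt{2W(s)}\,\mathrm ds$. -/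

import Mathlib

open Set Filter Topology MeasureTheory Bundle Manifold
open scoped ContDiff ENNReal NNReal Matrix

namespace RiemannianModica

noncomputable section

/-- The model space `ℝ^N`. -/
abbrev Model (N : ℕ) : Type := EuclideanSpace ℝ (Fin N)

section Volume

variable {N : ℕ} {M : Type*} [TopologicalSpace M] [ChartedSpace (Model N) M]
  [RiemannianBundle (fun x : M => TangentSpace (𝓡 N) x)]

/-- The coordinate vector field `∂ᵢ` of the chart around `c`, at the point with coordinates `y`. -/
def coordVec (c : M) (y : Model N) (i : Fin N) :
    TangentSpace (𝓡 N) ((extChartAt (𝓡 N) c).symm y) :=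
  mfderiv 𝓘(ℝ, Model N) (𝓡 N) (extChartAt (𝓡 N) c).symm y
    (EuclideanSpace.single i (1 : ℝ) : Model N)

/-- The matrix `(g_ij)` of the metric in the chart around `c`, at the point with coordinates `y`. -/
def gram (c : M) (y : Model N) : Matrix (Fin N) (Fin N) ℝ :=
  Matrix.of fun i j => inner ℝ (coordVec c y i) (coordVec c y j)

/-- The volume density `√(det g_ij)` in the chart around `c`. -/
def density (c : M) (y : Model N) : ℝ := √(gram c y).det

/-- The Riemannian volume of the domain of the chart around `c`: the image under the inverse
chart of `√(det g_ij) dy`. -/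
def chartVolume [MeasurableSpace M] (c : M) : Measure M :=
  Measure.map (extChartAt (𝓡 N) c).symm
    ((volume.restrict (extChartAt (𝓡 N) c).target).withDensity
      fun y => ENNReal.ofReal (density c y))

variable (N M) in
/-- A smooth partition of unity subordinate to the domains of the charts. -/
def chartPartition [T2Space M] [SigmaCompactSpace M] [IsManifold (𝓡 N) ∞ M] :
    SmoothPartitionOfUnity M (𝓡 N) M univ :=
  (SmoothPartitionOfUnity.exists_isSubordinate_chartAt_source (𝓡 N) M).choose

variable (N M) in
/-- The Riemannian volume measure `dv_g`, glued from the charts by a partition of unity `ρ`: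
`∫ f dv_g = ∑_c ∫ (ρ_c f) √(det g_ij) dy`, the `c`-th term being computed in the chart around
`c`. It does not depend on the choice of `ρ`. -/
def vol [T2Space M] [SigmaCompactSpace M] [IsManifold (𝓡 N) ∞ M] [MeasurableSpace M] :
    Measure M :=
  Measure.sum fun c : M =>
    (chartVolume (N := N) c).withDensity fun x => ENNReal.ofReal (chartPartition N M c x)

/-- The Riemannian divergence of a vector field, in coordinates
`div_g X = (√G)⁻¹ ∑ᵢ ∂ᵢ (√G Xⁱ)` with `√G = √(det g_ij)`; at `p` it is computed in the chart
around `p` (the formula is invariant under changes of chart). -/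
def divergence (X : ∀ x : M, TangentSpace (𝓡 N) x) (p : M) : ℝ :=
  (density p (extChartAt (𝓡 N) p p))⁻¹ *
    ∑ i : Fin N,
      fderiv ℝ
        (fun y : Model N =>
          density p y *
            (show Model N from
              mfderiv (𝓡 N) 𝓘(ℝ, Model N) (extChartAt (𝓡 N) p)
                ((extChartAt (𝓡 N) p).symm y) (X ((extChartAt (𝓡 N) p).symm y))) i)
        (extChartAt (𝓡 N) p p) (EuclideanSpace.single i (1 : ℝ))

/-- Smooth vector fields `X` with compact support contained in `U` and `‖X‖_∞ ≤ 1`. -/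
structure IsTestField [IsManifold (𝓡 N) ∞ M] (U : Set M) (X : ∀ x : M, TangentSpace (𝓡 N) x) : Prop where
  smooth : ContMDiff (𝓡 N) (𝓡 N).tangent ∞
    (fun x => (⟨x, X x⟩ : TangentBundle (𝓡 N) M))
  compact_support : IsCompact (closure {x | X x ≠ 0})
  support_subset : closure {x | X x ≠ 0} ⊆ U
  norm_le_one : ∀ x, ‖X x‖ ≤ 1

variable (N) in
/-- The perimeter `P_g(A, U) ∈ [0, ∞]` of `A` in the open set `U`:
the supremum of `∫_U χ_A div_g X dv_g` over the test fields `X` of `U`. (The supremum is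
nonnegative, because of `X = 0`.) -/
def perimeter [T2Space M] [SigmaCompactSpace M] [IsManifold (𝓡 N) ∞ M] [MeasurableSpace M]
    (A U : Set M) : ℝ≥0∞ :=
  ⨆ (X : ∀ x : M, TangentSpace (𝓡 N) x) (_ : IsTestField U X),
    ENNReal.ofReal (∫ x in U, A.indicator (fun x => divergence X x) x ∂(vol N M))

/-- The norm `|∇u|_g` of the gradient at `x`, i.e. the norm of `du_x` with respect to `g`. -/
def gradNorm (u : M → ℝ) (x : M) : ℝ := ‖mfderiv (𝓡 N) 𝓘(ℝ, ℝ) u x‖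

variable (N) in
/-- The energy `E_ε(u) = ε/2 ∫_Ω |∇u|² dv_g + 1/ε ∫_Ω W(u) dv_g ∈ [0, ∞]` on `Ω`. -/
def energy [T2Space M] [SigmaCompactSpace M] [IsManifold (𝓡 N) ∞ M] [MeasurableSpace M]
    (W : ℝ → ℝ) (Ω : Set M) (ε : ℝ) (u : M → ℝ) : ℝ≥0∞ :=
  ENNReal.ofReal (ε / 2) * ∫⁻ x in Ω, ENNReal.ofReal (gradNorm (N := N) u x ^ 2) ∂(vol N M) +
    ENNReal.ofReal (1 / ε) * ∫⁻ x in Ω, ENNReal.ofReal (W (u x)) ∂(vol N M)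

end Volume

/-- `S` is a smooth (embedded, possibly empty) hypersurface: near each of its points it is the
zero set of a smooth function whose differential does not vanish there. -/
def IsSmoothHypersurface (N : ℕ) {M : Type*} [TopologicalSpace M] [ChartedSpace (Model N) M]
    (S : Set M) : Prop :=
  ∀ p ∈ S, ∃ U : Set M, IsOpen U ∧ p ∈ U ∧ ∃ f : M → ℝ,
    ContMDiffOn (𝓡 N) 𝓘(ℝ, ℝ) ∞ f U ∧ mfderiv (𝓡 N) 𝓘(ℝ, ℝ) f p ≠ 0 ∧
      S ∩ U = {x ∈ U | f x = 0}

open Classical in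
/-- The two-valued function equal to `α` on `A` and to `β` off `A`. -/
def twoValued {M : Type*} (A : Set M) (α β : ℝ) (x : M) : ℝ := if x ∈ A then α else β

end

end RiemannianModica

/-! The competitors have the form `Q ((d + s) / ε)`. Here `d` is a smooth function with `A = {d <
0}` up to a null set and with gradient of norm almost one near its zero set, `Q` is a nearly optimal
one-dimensional transition from `α` to `β` in a finite time `T`, and `s ∈ [0, T ε]` is a shift which
restores the prescribed mass exactly, by the intermediate value theorem (`exists_shift`).

Neither the distance function nor the coarea formula is used. The set `A` is first replaced by the
interior of its closure, which differs from `A` by a null set and lies locally on one side of its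
boundary (`exists_sides`). Local defining functions, normalized to unit gradient at one point, are
glued by a partition of unity (`exists_defining`). The gluing works because the differentials of two
defining functions of the same side are nonnegative multiples of each other at the boundary
(`exists_diff_eq_mul`).

If `k` dominates `Q' ^ 2 / 2 + W (Q)`, the energy is at most a factor near one times `D * ∫ k`,
where `D` bounds the density on `Ω` of the image of the volume under `d`. The profile can be chosen
with `∫ k` as close as desired to the integral of `√(2 W)` (`exists_profile`), so everything rests
on `D` being close to the perimeter. Take a test field `X` of `Ω` along which `d` grows with speed
almost one on the layer `|d| ≤ τ`. The integral of `k(d) dd(X)` equals that of `ψ div X`, where `ψ`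
is the tail of `k` evaluated at `d`. It differs from `(∫ k)` times the indicator of `{d < 0}` only
on the thin layer, so the integral is at most `∫ k` times the perimeter plus a small error
(`integral_layer_le`).

Such a field cannot have the required speed up to the boundary of `Ω`. Near the common part of the
two boundaries the `(N-1)`-dimensional null hypothesis enters instead: in coordinates where `d` is
monotone in one variable, a layer is controlled by the Lebesgue measure of its projection to the
other variables, and this projection is Lipschitz and maps null sets to null sets
(`exists_layer_estimate`). `exists_layer_data` combines both bounds, `exists_recovery` yields
competitors up to any tolerance, and `exists_diagonal` selects one for each `ε`. -/

namespace RiemannianModica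

noncomputable section

set_option linter.unusedSectionVars false

/-! ### Differentials of real functions and the norm of the gradient. -/

section Differential

variable {N : ℕ} {M : Type*} [TopologicalSpace M] [ChartedSpace (Model N) M]

/-- The differential of a real function, as a linear form. -/
def diff (u : M → ℝ) (x : M) : TangentSpace (𝓡 N) x →ₗ[ℝ] ℝ where
  toFun v := (mfderiv (𝓡 N) 𝓘(ℝ, ℝ) u x v : ℝ)
  map_add' v w := (mfderiv (𝓡 N) 𝓘(ℝ, ℝ) u x).map_add v w
  map_smul' a v := (mfderiv (𝓡 N) 𝓘(ℝ, ℝ) u x).map_smul a v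

variable [RiemannianBundle (fun x : M => TangentSpace (𝓡 N) x)]

/-- Upper bounds on the gradient are proved through this test on vectors, so neither a gradient
vector nor the inverse metric is ever needed. -/
theorem gradNorm_le_iff {u : M → ℝ} {x : M} {C : ℝ} (hC : 0 ≤ C) :
    gradNorm (N := N) u x ≤ C ↔ ∀ v : TangentSpace (𝓡 N) x, |diff u x v| ≤ C * ‖v‖ := by
  unfold gradNorm
  rw [ContinuousLinearMap.opNorm_le_iff hC]
  simp_rw [norm_tangentSpace_vectorSpace]
  rfl

theorem gradNorm_nonneg (u : M → ℝ) (x : M) : 0 ≤ gradNorm (N := N) u x := by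
  unfold gradNorm
  exact ContinuousLinearMap.opNorm_nonneg _

theorem abs_diff_le (u : M → ℝ) (x : M) (v : TangentSpace (𝓡 N) x) :
    |diff u x v| ≤ gradNorm (N := N) u x * ‖v‖ :=
  (gradNorm_le_iff (gradNorm_nonneg u x)).1 le_rfl v

end Differential

/-! ### Charts, coordinate fields and metric coefficients. -/

section Coordinates

variable {N : ℕ} {M : Type*} [TopologicalSpace M] [ChartedSpace (Model N) M]
  [IsManifold (𝓡 N) ∞ M]

theorem isOpen_chart_target {N : ℕ} {M : Type*} [TopologicalSpace M] [ChartedSpace (Model N) M]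
    (c : M) : IsOpen (extChartAt (𝓡 N) c).target :=
  isOpen_extChartAt_target c

theorem contMDiffOn_chart_symm (c : M) :
    ContMDiffOn 𝓘(ℝ, Model N) (𝓡 N) ∞ (extChartAt (𝓡 N) c).symm (extChartAt (𝓡 N) c).target :=
  contMDiffOn_extChartAt_symm c

theorem contMDiffAt_chart {c x : M} (hx : x ∈ (extChartAt (𝓡 N) c).source) :
    ContMDiffAt (𝓡 N) 𝓘(ℝ, Model N) ∞ (extChartAt (𝓡 N) c) x :=
  contMDiffAt_extChartAt' (by simpa using hx)

theorem contMDiffAt_chart_symm {c : M} {y : Model N} (hy : y ∈ (extChartAt (𝓡 N) c).target) :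
    ContMDiffAt 𝓘(ℝ, Model N) (𝓡 N) ∞ (extChartAt (𝓡 N) c).symm y :=
  (contMDiffOn_chart_symm c).contMDiffAt ((isOpen_chart_target c).mem_nhds hy)

theorem mfderiv_chart_comp_symm {c : M} {y : Model N} (hy : y ∈ (extChartAt (𝓡 N) c).target) :
    (mfderiv (𝓡 N) 𝓘(ℝ, Model N) (extChartAt (𝓡 N) c) ((extChartAt (𝓡 N) c).symm y)).comp
      (mfderiv 𝓘(ℝ, Model N) (𝓡 N) (extChartAt (𝓡 N) c).symm y) =
    ContinuousLinearMap.id ℝ _ := by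
  have : IsManifold (𝓡 N) 1 M := .of_le (n := ∞) (by simp)
  have := mfderiv_extChartAt_comp_mfderivWithin_extChartAt_symm (I := 𝓡 N) hy
  simpa [mfderivWithin_univ] using this

theorem mfderiv_chart_symm_comp {c : M} {y : Model N} (hy : y ∈ (extChartAt (𝓡 N) c).target) :
    (mfderiv 𝓘(ℝ, Model N) (𝓡 N) (extChartAt (𝓡 N) c).symm y).comp
      (mfderiv (𝓡 N) 𝓘(ℝ, Model N) (extChartAt (𝓡 N) c) ((extChartAt (𝓡 N) c).symm y)) =
    ContinuousLinearMap.id ℝ _ := by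
  have : IsManifold (𝓡 N) 1 M := .of_le (n := ∞) (by simp)
  have := mfderivWithin_extChartAt_symm_comp_mfderiv_extChartAt (I := 𝓡 N) hy
  simpa [mfderivWithin_univ] using this

/-- The components of the vector field `X` in the chart around `c`. -/
def comps (c : M) (X : ∀ x : M, TangentSpace (𝓡 N) x) (y : Model N) : Model N :=
  mfderiv (𝓡 N) 𝓘(ℝ, Model N) (extChartAt (𝓡 N) c)
    ((extChartAt (𝓡 N) c).symm y) (X ((extChartAt (𝓡 N) c).symm y))

theorem mfderiv_chart_symm_comps {c : M} {y : Model N} (hy : y ∈ (extChartAt (𝓡 N) c).target)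
    (X : ∀ x : M, TangentSpace (𝓡 N) x) :
    mfderiv 𝓘(ℝ, Model N) (𝓡 N) (extChartAt (𝓡 N) c).symm y (comps c X y) =
      X ((extChartAt (𝓡 N) c).symm y) :=
  congrArg (fun L => L (X ((extChartAt (𝓡 N) c).symm y))) (mfderiv_chart_symm_comp hy)

theorem diff_chart_symm {c : M} {y : Model N} (hy : y ∈ (extChartAt (𝓡 N) c).target)
    {u : M → ℝ} (hu : MDifferentiableAt (𝓡 N) 𝓘(ℝ, ℝ) u ((extChartAt (𝓡 N) c).symm y))
    (w : Model N) :
    diff u ((extChartAt (𝓡 N) c).symm y)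
      (mfderiv 𝓘(ℝ, Model N) (𝓡 N) (extChartAt (𝓡 N) c).symm y w) =
    fderiv ℝ (u ∘ (extChartAt (𝓡 N) c).symm) y w := by
  have h := mfderiv_comp y hu ((contMDiffAt_chart_symm hy).mdifferentiableAt (by simp))
  rw [mfderiv_eq_fderiv] at h
  change _ = (_ : TangentSpace 𝓘(ℝ, Model N) y →L[ℝ] _) w
  rw [h]
  rfl

theorem diff_comps {c : M} {y : Model N} (hy : y ∈ (extChartAt (𝓡 N) c).target)
    {u : M → ℝ} (hu : MDifferentiableAt (𝓡 N) 𝓘(ℝ, ℝ) u ((extChartAt (𝓡 N) c).symm y))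
    (X : ∀ x : M, TangentSpace (𝓡 N) x) :
    diff u ((extChartAt (𝓡 N) c).symm y) (X ((extChartAt (𝓡 N) c).symm y)) =
    fderiv ℝ (u ∘ (extChartAt (𝓡 N) c).symm) y (comps c X y) := by
  rw [← diff_chart_symm hy hu, mfderiv_chart_symm_comps hy]

/-- The components are the fibre part of the tangent map of the chart composed with the section `X`,
and each of these maps is smooth. -/
theorem contDiffOn_comps {c : M} {X : ∀ x : M, TangentSpace (𝓡 N) x} {s : Set M}
    (hX : ContMDiffOn (𝓡 N) (𝓡 N).tangent ∞ (fun x => (⟨x, X x⟩ : TangentBundle (𝓡 N) M)) s) :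
    ContDiffOn ℝ ∞ (comps c X)
      ((extChartAt (𝓡 N) c).target ∩ (extChartAt (𝓡 N) c).symm ⁻¹' s) := by
  rw [← contMDiffOn_iff_contDiffOn]
  have h1 : ContMDiffOn (𝓡 N).tangent 𝓘(ℝ, Model N).tangent ∞
      (tangentMapWithin (𝓡 N) 𝓘(ℝ, Model N) (extChartAt (𝓡 N) c) (extChartAt (𝓡 N) c).source)
      (π (Model N) (TangentSpace (𝓡 N)) ⁻¹' (extChartAt (𝓡 N) c).source) :=
    ContMDiffOn.contMDiffOn_tangentMapWithin (n := ∞)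
      (fun x hx => (contMDiffAt_chart hx).contMDiffWithinAt) (by simp)
      (isOpen_extChartAt_source c).uniqueMDiffOn
  have h2 : ContMDiffOn 𝓘(ℝ, Model N) (𝓡 N).tangent ∞
      ((fun x => (⟨x, X x⟩ : TangentBundle (𝓡 N) M)) ∘ (extChartAt (𝓡 N) c).symm)
      ((extChartAt (𝓡 N) c).target ∩ (extChartAt (𝓡 N) c).symm ⁻¹' s) :=
    hX.comp ((contMDiffOn_chart_symm c).mono inter_subset_left) fun y hy => hy.2
  have h3 := (contMDiff_snd_tangentBundle_modelSpace (Model N) 𝓘(ℝ, Model N) (n := ∞)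
    ).comp_contMDiffOn (h1.comp h2 fun y hy => (extChartAt (𝓡 N) c).map_target hy.1)
  refine h3.congr fun y hy => ?_
  have h4 := mfderivWithin_of_isOpen (f := extChartAt (𝓡 N) c) (I := 𝓡 N) (I' := 𝓘(ℝ, Model N))
    (isOpen_extChartAt_source c) ((extChartAt (𝓡 N) c).map_target hy.1)
  exact (congrArg (fun L => L (X ((extChartAt (𝓡 N) c).symm y))) h4).symm

theorem contMDiffOn_coordVec (c : M) (i : Fin N) :
    ContMDiffOn 𝓘(ℝ, Model N) (𝓡 N).tangent ∞
      (fun y => (⟨(extChartAt (𝓡 N) c).symm y, coordVec c y i⟩ : TangentBundle (𝓡 N) M))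
      (extChartAt (𝓡 N) c).target := by
  have h1 := ContMDiffOn.contMDiffOn_tangentMapWithin (n := ∞) (m := ∞)
      (contMDiffOn_chart_symm (N := N) c) (by simp) (isOpen_chart_target c).uniqueMDiffOn
  have h2 : ContMDiff 𝓘(ℝ, Model N) 𝓘(ℝ, Model N).tangent ∞
      (fun y => (⟨y, EuclideanSpace.single i (1 : ℝ)⟩ : TangentBundle 𝓘(ℝ, Model N) (Model N))) :=
    contMDiff_vectorSpace_iff_contDiff.2 contDiff_const
  refine (h1.comp h2.contMDiffOn fun y hy => hy).congr fun y hy => ?_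
  simp only [Function.comp_def, tangentMapWithin, coordVec]
  rw [mfderivWithin_of_isOpen (isOpen_chart_target c) hy]

section Metric

variable [RiemannianBundle (fun x : M => TangentSpace (𝓡 N) x)]

variable [IsContMDiffRiemannianBundle (𝓡 N) ∞ (Model N) (fun x : M => TangentSpace (𝓡 N) x)]

theorem contDiffOn_gram (c : M) (i j : Fin N) :
    ContDiffOn ℝ ∞ (fun y => gram c y i j) (extChartAt (𝓡 N) c).target := by
  rw [← contMDiffOn_iff_contDiffOn]
  exact (contMDiffOn_coordVec c i).inner_bundle (contMDiffOn_coordVec c j)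

/-- The derivative of the inverse chart has a left inverse, so the coordinate vectors are linearly
independent. -/
theorem gram_posDef {c : M} {y : Model N} (hy : y ∈ (extChartAt (𝓡 N) c).target) :
    (gram c y).PosDef := by
  have h : gram c y = Matrix.gram ℝ (coordVec c y) := rfl
  rw [h]
  refine Matrix.posDef_gram_iff_linearIndependent.2 ?_
  have hli : LinearIndependent ℝ (fun i : Fin N => (EuclideanSpace.single i (1 : ℝ) : Model N)) := by
    have e : (fun i : Fin N => (EuclideanSpace.single i (1 : ℝ) : Model N)) =
        ⇑(EuclideanSpace.basisFun (Fin N) ℝ).toBasis := by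
      ext i
      simp
    rw [e]
    exact (EuclideanSpace.basisFun (Fin N) ℝ).toBasis.linearIndependent
  refine hli.map' (mfderiv 𝓘(ℝ, Model N) (𝓡 N) (extChartAt (𝓡 N) c).symm y).toLinearMap ?_
  refine LinearMap.ker_eq_bot.2 (Function.LeftInverse.injective (g := mfderiv (𝓡 N) 𝓘(ℝ, Model N)
    (extChartAt (𝓡 N) c) ((extChartAt (𝓡 N) c).symm y)) fun v => ?_)
  exact congrArg (fun L => L v) (mfderiv_chart_comp_symm hy)

theorem density_pos {c : M} {y : Model N} (hy : y ∈ (extChartAt (𝓡 N) c).target) :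
    0 < density c y :=
  Real.sqrt_pos.2 (gram_posDef hy).det_pos

theorem contDiffOn_density (c : M) :
    ContDiffOn ℝ ∞ (density c) (extChartAt (𝓡 N) c).target := by
  unfold density
  refine ContDiffOn.sqrt ?_ fun y hy => (gram_posDef hy).det_pos.ne'
  simp only [Matrix.det_apply]
  refine ContDiffOn.sum fun σ _ => ?_
  refine ContDiffOn.const_smul _ ?_
  refine contDiffOn_prod fun i _ => contDiffOn_gram c _ _

end Metric

end Coordinates


/-! ### Chart independence and local finiteness of the volume. -/

section Volume

variable {N : ℕ} {M : Type*} [TopologicalSpace M] [ChartedSpace (Model N) M]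
  [IsManifold (𝓡 N) ∞ M] [RiemannianBundle (fun x : M => TangentSpace (𝓡 N) x)]

/-- The scalar product of the tangent space at `x` as a bilinear form on the model space. -/
def metricForm (x : M) : LinearMap.BilinForm ℝ (Model N) :=
  (innerₗ (TangentSpace (𝓡 N) x) : TangentSpace (𝓡 N) x →ₗ[ℝ] TangentSpace (𝓡 N) x →ₗ[ℝ] ℝ)

/-- The metric read in the chart around `c`. -/
def chartForm (c : M) (y : Model N) : LinearMap.BilinForm ℝ (Model N) :=
  LinearMap.BilinForm.comp (metricForm ((extChartAt (𝓡 N) c).symm y))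
    (mfderiv 𝓘(ℝ, Model N) (𝓡 N) (extChartAt (𝓡 N) c).symm y : Model N →L[ℝ] Model N).toLinearMap
    (mfderiv 𝓘(ℝ, Model N) (𝓡 N) (extChartAt (𝓡 N) c).symm y : Model N →L[ℝ] Model N).toLinearMap

/-- As the matrix of a bilinear form, the Gram matrix transforms under a change of chart by
`toMatrix_comp`. -/
theorem gram_eq_toMatrix (c : M) (y : Model N) :
    gram c y = LinearMap.BilinForm.toMatrix (EuclideanSpace.basisFun (Fin N) ℝ).toBasis (chartForm c y) := by
  refine Matrix.ext fun i j => ?_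
  rw [LinearMap.BilinForm.toMatrix_apply]
  simp only [OrthonormalBasis.coe_toBasis, EuclideanSpace.basisFun_apply]
  rfl

/-- The change of coordinates between two charts. -/
def transition (c c' : M) (y : Model N) : Model N :=
  extChartAt (𝓡 N) c' ((extChartAt (𝓡 N) c).symm y)

theorem hasFDerivAt_transition {c c' : M} {y : Model N} (hy : y ∈ (extChartAt (𝓡 N) c).target)
    (hy' : (extChartAt (𝓡 N) c).symm y ∈ (extChartAt (𝓡 N) c').source) :
    HasFDerivAt (transition c c') (fderiv ℝ (transition c c') y) y := by
  have : ContMDiffAt 𝓘(ℝ, Model N) 𝓘(ℝ, Model N) ∞ (transition c c') y :=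
    (contMDiffAt_chart hy').comp y (contMDiffAt_chart_symm hy)
  exact (this.contDiffAt.differentiableAt (by simp)).hasFDerivAt

theorem chartForm_transition {c c' : M} {y : Model N} (hy : y ∈ (extChartAt (𝓡 N) c).target)
    (hy' : (extChartAt (𝓡 N) c).symm y ∈ (extChartAt (𝓡 N) c').source) :
    chartForm c y = LinearMap.BilinForm.comp (chartForm c' (transition c c' y))
      (fderiv ℝ (transition c c') y).toLinearMap (fderiv ℝ (transition c c') y).toLinearMap := by
  have hT : transition c c' y ∈ (extChartAt (𝓡 N) c').target := (extChartAt (𝓡 N) c').map_source hy'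
  have hx : (extChartAt (𝓡 N) c').symm (transition c c' y) = (extChartAt (𝓡 N) c).symm y :=
    (extChartAt (𝓡 N) c').left_inv hy'
  -- Chain rule for the identity "inverse chart of `c'` after the transition = inverse chart of
  -- `c`", valid near `y`.
  have hD : ∀ v : Model N, (mfderiv 𝓘(ℝ, Model N) (𝓡 N) (extChartAt (𝓡 N) c').symm
      (transition c c' y) (fderiv ℝ (transition c c') y v) : Model N) =
      (mfderiv 𝓘(ℝ, Model N) (𝓡 N) (extChartAt (𝓡 N) c).symm y v : Model N) := by
    intro v
    have h1 := mfderiv_comp y ((contMDiffAt_chart_symm hT).mdifferentiableAt (by simp))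
      (hasFDerivAt_transition hy hy').differentiableAt.mdifferentiableAt
    have h2 : ((extChartAt (𝓡 N) c').symm ∘ transition c c') =ᶠ[𝓝 y]
        (extChartAt (𝓡 N) c).symm := by
      have : (extChartAt (𝓡 N) c).symm ⁻¹' (extChartAt (𝓡 N) c').source ∈ 𝓝 y :=
        (contMDiffAt_chart_symm hy).continuousAt.preimage_mem_nhds
          ((isOpen_extChartAt_source c').mem_nhds hy')
      filter_upwards [this] with z hz
      exact (extChartAt (𝓡 N) c').left_inv hz
    rw [mfderiv_eq_fderiv] at h1
    have h3 := h2.mfderiv_eq (I := 𝓘(ℝ, Model N)) (I' := 𝓡 N)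
    exact (DFunLike.congr_fun h1 v).symm.trans (DFunLike.congr_fun h3 v)
  refine LinearMap.ext fun v => LinearMap.ext fun w => ?_
  -- The base point is substituted with the vectors seen in the fixed space `Model N`, as the
  -- tangent spaces at the two expressions of the point are formally different types.
  have key : ∀ x x' : M, x = x' → ∀ a b a' b' : Model N, a = a' → b = b' →
      metricForm x a b = metricForm x' a' b' := by
    rintro x _ rfl a b _ _ rfl rfl; rfl
  exact key _ _ hx.symm _ _ _ _ (hD v).symm (hD w).symm

theorem density_transition {c c' : M} {y : Model N} (hy : y ∈ (extChartAt (𝓡 N) c).target)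
    (hy' : (extChartAt (𝓡 N) c).symm y ∈ (extChartAt (𝓡 N) c').source) :
    density c y = |(fderiv ℝ (transition c c') y).det| * density c' (transition c c' y) := by
  have h : (gram c y).det = (fderiv ℝ (transition c c') y).det ^ 2 *
      (gram c' (transition c c' y)).det := by
    rw [gram_eq_toMatrix, chartForm_transition hy hy', gram_eq_toMatrix,
      LinearMap.BilinForm.toMatrix_comp (EuclideanSpace.basisFun (Fin N) ℝ).toBasis
        (EuclideanSpace.basisFun (Fin N) ℝ).toBasis]
    simp only [Matrix.det_mul, Matrix.det_transpose, LinearMap.det_toMatrix]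
    rw [ContinuousLinearMap.det]
    ring
  rw [density, h, Real.sqrt_mul (sq_nonneg _), Real.sqrt_sq_eq_abs, density]

variable [MeasurableSpace M] [BorelSpace M]

theorem aemeasurable_chart_symm (c : M) : AEMeasurable (extChartAt (𝓡 N) c).symm
    (volume.restrict (extChartAt (𝓡 N) c).target) :=
  (contMDiffOn_chart_symm c).continuousOn.aemeasurable (isOpen_chart_target c).measurableSet

theorem chartVolume_apply (c : M) {s : Set M} (hs : MeasurableSet s) :
    chartVolume (N := N) c s = ∫⁻ y in (extChartAt (𝓡 N) c).symm ⁻¹' s ∩ (extChartAt (𝓡 N) c).target,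
      ENNReal.ofReal (density c y) := by
  rw [chartVolume, Measure.map_apply_of_aemeasurable
    ((aemeasurable_chart_symm c).mono_ac (withDensity_absolutelyContinuous _ _)) hs,
    withDensity_apply', Measure.restrict_restrict' (isOpen_chart_target c).measurableSet]

theorem chartVolume_compl_source (c : M) :
    chartVolume (N := N) c (extChartAt (𝓡 N) c).sourceᶜ = 0 := by
  rw [chartVolume_apply c (isOpen_extChartAt_source c).measurableSet.compl]
  have : (extChartAt (𝓡 N) c).symm ⁻¹' (extChartAt (𝓡 N) c).sourceᶜ ∩
      (extChartAt (𝓡 N) c).target = ∅ := by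
    ext y
    simp only [mem_inter_iff, mem_preimage, mem_compl_iff, mem_empty_iff_false, iff_false]
    exact fun h => h.1 ((extChartAt (𝓡 N) c).map_target h.2)
  rw [this, setLIntegral_empty]

theorem measurableSet_symm_preimage_inter (c : M) {s : Set M} (hs : MeasurableSet s) :
    MeasurableSet ((extChartAt (𝓡 N) c).symm ⁻¹' s ∩ (extChartAt (𝓡 N) c).target) := by
  have ht := (isOpen_chart_target (N := N) c).measurableSet
  have h := (continuousOn_iff_continuous_domRestrict.1
    (contMDiffOn_chart_symm (N := N) c).continuousOn).measurable hs
  have := ht.subtype_image h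
  convert this using 1
  ext y
  simp [and_comm]

/-- Change of variables for the transition map: its Jacobian is exactly the ratio of the two
densities, by `density_transition`. -/
theorem chartVolume_eq_of_subset {c c' : M} {s : Set M} (hs : MeasurableSet s)
    (hc : s ⊆ (extChartAt (𝓡 N) c).source) (hc' : s ⊆ (extChartAt (𝓡 N) c').source) :
    chartVolume (N := N) c s = chartVolume (N := N) c' s := by
  rw [chartVolume_apply c hs, chartVolume_apply c' hs]
  set D := (extChartAt (𝓡 N) c).symm ⁻¹' s ∩ (extChartAt (𝓡 N) c).target with hD
  have him : (extChartAt (𝓡 N) c').symm ⁻¹' s ∩ (extChartAt (𝓡 N) c').target =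
      transition c c' '' D := by
    ext z
    constructor
    · rintro ⟨hz, hz'⟩
      refine ⟨extChartAt (𝓡 N) c ((extChartAt (𝓡 N) c').symm z), ⟨?_, ?_⟩, ?_⟩
      · rw [mem_preimage, (extChartAt (𝓡 N) c).left_inv (hc hz)]
        exact hz
      · exact (extChartAt (𝓡 N) c).map_source (hc hz)
      · rw [transition, (extChartAt (𝓡 N) c).left_inv (hc hz), (extChartAt (𝓡 N) c').right_inv hz']
    · rintro ⟨y, ⟨hy, hy'⟩, rfl⟩
      refine ⟨?_, (extChartAt (𝓡 N) c').map_source (hc' hy)⟩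
      rw [mem_preimage, transition, (extChartAt (𝓡 N) c').left_inv (hc' hy)]
      exact hy
  have hinj : InjOn (transition c c') D := by
    rintro y ⟨hy, hy'⟩ z ⟨hz, hz'⟩ h
    exact (extChartAt (𝓡 N) c).symm.injOn hy' hz'
      ((extChartAt (𝓡 N) c').injOn (hc' hy) (hc' hz) h)
  rw [him, lintegral_image_eq_lintegral_abs_det_fderiv_mul volume
    (measurableSet_symm_preimage_inter c hs)
    (fun y hy => (hasFDerivAt_transition hy.2 (hc' hy.1)).hasFDerivWithinAt) hinj]
  refine setLIntegral_congr_fun (measurableSet_symm_preimage_inter c hs) fun y hy => ?_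
  rw [density_transition hy.2 (hc' hy.1), ENNReal.ofReal_mul (abs_nonneg _)]

variable [T2Space M] [SigmaCompactSpace M]

theorem tsum_ofReal_chartPartition (x : M) :
    ∑' c, ENNReal.ofReal (chartPartition N M c x) = 1 := by
  have h1 := (chartPartition N M).sum_eq_one (mem_univ x)
  have hfin : (Function.support fun c => chartPartition N M c x).Finite :=
    (chartPartition N M).locallyFinite.point_finite x
  rw [finsum_eq_sum _ hfin] at h1
  rw [tsum_eq_sum (s := hfin.toFinset), ← ENNReal.ofReal_sum_of_nonneg, h1, ENNReal.ofReal_one]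
  · exact fun c _ => (chartPartition N M).nonneg c x
  · intro c hc
    simp only [Finite.mem_toFinset, Function.mem_support, not_not] at hc
    simp [hc]

theorem countable_chartPartition :
    {c : M | (Function.support (chartPartition N M c)).Nonempty}.Countable :=
  countable_univ_iff.1 (((chartPartition N M).locallyFinite.comp_injective
    Subtype.val_injective).countable_univ fun c => c.2)

theorem chartPartition_eq_zero {c x : M} (hx : x ∉ (extChartAt (𝓡 N) c).source) :
    chartPartition N M c x = 0 := by
  have h := (SmoothPartitionOfUnity.exists_isSubordinate_chartAt_source (𝓡 N) M).choose_spec c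
  by_contra h0
  exact hx (by simpa using h (subset_tsupport _ h0))

/-- Each term of the defining sum can be moved to the chart around `c`, since the chart volumes
agree on overlaps; there the weights add up to one. -/
theorem vol_apply_of_subset (c : M) {s : Set M} (hs : MeasurableSet s)
    (hc : s ⊆ (extChartAt (𝓡 N) c).source) : vol N M s = chartVolume (N := N) c s := by
  have hm : ∀ c' : M, Measurable fun x => ENNReal.ofReal (chartPartition N M c' x) := fun c' =>
    (chartPartition N M c').contMDiff.continuous.measurable.ennreal_ofReal
  have h1 : ∀ c' : M, ((chartVolume (N := N) c').withDensity
      fun x => ENNReal.ofReal (chartPartition N M c' x)) s =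
      ∫⁻ x in s, ENNReal.ofReal (chartPartition N M c' x) ∂(chartVolume (N := N) c) := by
    intro c'
    have hsub : ∀ c₁ : M, ∫⁻ x in s, ENNReal.ofReal (chartPartition N M c' x)
        ∂(chartVolume (N := N) c₁) = ∫⁻ x in s ∩ (extChartAt (𝓡 N) c').source,
        ENNReal.ofReal (chartPartition N M c' x) ∂(chartVolume (N := N) c₁) := by
      intro c₁
      rw [← lintegral_indicator hs,
        ← lintegral_indicator (hs.inter (isOpen_extChartAt_source c').measurableSet)]
      congr 1
      ext x
      by_cases hx : x ∈ (extChartAt (𝓡 N) c').source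
      · by_cases hxs : x ∈ s
        · rw [indicator_of_mem hxs, indicator_of_mem (mem_inter hxs hx)]
        · rw [indicator_of_notMem hxs, indicator_of_notMem fun h => hxs h.1]
      · simp only [indicator, chartPartition_eq_zero hx, ENNReal.ofReal_zero, ite_self]
    rw [withDensity_apply _ hs, hsub c', hsub c]
    congr 1
    refine Measure.ext fun t ht => ?_
    have hst := hs.inter (isOpen_extChartAt_source (I := 𝓡 N) c').measurableSet
    rw [Measure.restrict_apply ht, Measure.restrict_apply ht]
    exact chartVolume_eq_of_subset (ht.inter hst) (fun x hx => hx.2.2) (fun x hx => hc hx.2.1)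
  rw [vol, Measure.sum_apply _ hs]
  simp_rw [h1]
  have hz : (Function.support fun c' : M => ∫⁻ x in s, ENNReal.ofReal (chartPartition N M c' x)
      ∂(chartVolume (N := N) c)) ⊆ {c : M | (Function.support (chartPartition N M c)).Nonempty} := by
    intro c' hc'
    by_contra hne
    rw [mem_ofPred_eq, not_nonempty_iff_eq_empty, Function.support_eq_empty_iff] at hne
    exact hc' (by simp [hne])
  -- The sum over all points of `M` is cut down to a countable index set, as required to exchange
  -- sum and integral.
  rw [← tsum_subtype_eq_of_support_subset hz]
  have := (countable_chartPartition (N := N) (M := M)).to_subtype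
  rw [← lintegral_tsum fun c' => (hm _).aemeasurable]
  have h2 : ∀ x : M, ∑' c' : {c : M | (Function.support (chartPartition N M c)).Nonempty},
      ENNReal.ofReal (chartPartition N M c' x) = 1 := by
    intro x
    rw [← tsum_ofReal_chartPartition (N := N) x]
    refine tsum_subtype_eq_of_support_subset (f := fun c' : M =>
      ENNReal.ofReal (chartPartition N M c' x)) fun c' hc' => ⟨x, fun h0 => hc' (by simp [h0])⟩
  simp_rw [h2]
  simp

theorem vol_restrict_source (c : M) :
    (vol N M).restrict (extChartAt (𝓡 N) c).source = chartVolume (N := N) c := by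
  refine Measure.ext fun s hs => ?_
  have ho := (isOpen_extChartAt_source (I := 𝓡 N) c).measurableSet
  rw [Measure.restrict_apply hs, vol_apply_of_subset c (hs.inter ho) inter_subset_right,
    ← measure_inter_add_sdiff (μ := chartVolume (N := N) c) s ho]
  have h0 : chartVolume (N := N) c (s \ (extChartAt (𝓡 N) c).source) = 0 :=
    measure_mono_null (fun x hx => hx.2) (chartVolume_compl_source c)
  rw [h0, add_zero]

variable [IsContMDiffRiemannianBundle (𝓡 N) ∞ (Model N) (fun x : M => TangentSpace (𝓡 N) x)]

theorem aemeasurable_density (c : M) : AEMeasurable (fun y => ENNReal.ofReal (density c y))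
    (volume.restrict (extChartAt (𝓡 N) c).target) :=
  ((contDiffOn_density c).continuousOn.aemeasurable
    (isOpen_chart_target c).measurableSet).ennreal_ofReal

theorem lintegral_source (c : M) {g : M → ℝ≥0∞} (hg : Measurable g) :
    ∫⁻ x in (extChartAt (𝓡 N) c).source, g x ∂(vol N M) =
      ∫⁻ y in (extChartAt (𝓡 N) c).target,
        ENNReal.ofReal (density c y) * g ((extChartAt (𝓡 N) c).symm y) := by
  rw [vol_restrict_source, chartVolume, lintegral_map' hg.aemeasurable
    ((aemeasurable_chart_symm c).mono_ac (withDensity_absolutelyContinuous _ _)),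
    lintegral_withDensity_eq_lintegral_mul₀ (aemeasurable_density c)
      (g := fun y => g ((extChartAt (𝓡 N) c).symm y))
      (hg.comp_aemeasurable (aemeasurable_chart_symm c))]
  rfl

theorem integral_source (c : M) {g : M → ℝ} (hg : Measurable g) :
    ∫ x in (extChartAt (𝓡 N) c).source, g x ∂(vol N M) =
      ∫ y in (extChartAt (𝓡 N) c).target, density c y * g ((extChartAt (𝓡 N) c).symm y) := by
  rw [vol_restrict_source, chartVolume, integral_map
    ((aemeasurable_chart_symm c).mono_ac (withDensity_absolutelyContinuous _ _))
    hg.aestronglyMeasurable,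
    integral_withDensity_eq_integral_toReal_smul₀ (aemeasurable_density c)
      (ae_of_all _ fun _ => ENNReal.ofReal_lt_top)]
  refine setIntegral_congr_fun (isOpen_chart_target c).measurableSet fun y hy => ?_
  simp [ENNReal.toReal_ofReal (density_pos hy).le]

instance : IsLocallyFiniteMeasure (vol N M) := by
  refine ⟨fun x => ?_⟩
  have hx := mem_extChartAt_target (I := 𝓡 N) x
  obtain ⟨r, hr, hball⟩ := Metric.nhds_basis_closedBall.mem_iff.1
    ((isOpen_chart_target x).mem_nhds hx)
  refine ⟨(extChartAt (𝓡 N) x).source ∩ extChartAt (𝓡 N) x ⁻¹'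
    Metric.ball (extChartAt (𝓡 N) x x) r, ?_, ?_⟩
  · exact inter_mem (extChartAt_source_mem_nhds x)
      ((continuousAt_extChartAt x).preimage_mem_nhds (Metric.ball_mem_nhds _ hr))
  · have ho : IsOpen ((extChartAt (𝓡 N) x).source ∩ extChartAt (𝓡 N) x ⁻¹'
        Metric.ball (extChartAt (𝓡 N) x x) r) :=
      (continuousOn_extChartAt x).isOpen_inter_preimage (isOpen_extChartAt_source x)
        Metric.isOpen_ball
    rw [vol_apply_of_subset x ho.measurableSet inter_subset_left, chartVolume_apply x ho.measurableSet]
    obtain ⟨C, hC⟩ := (isCompact_closedBall (extChartAt (𝓡 N) x x) r).exists_bound_of_continuousOn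
      ((contDiffOn_density x).continuousOn.mono hball)
    calc _ ≤ ∫⁻ y in Metric.closedBall (extChartAt (𝓡 N) x x) r, ENNReal.ofReal (density x y) := by
          refine lintegral_mono_set fun y hy => ?_
          have := hy.1.2
          rw [mem_preimage, (extChartAt (𝓡 N) x).right_inv hy.2] at this
          exact Metric.ball_subset_closedBall this
      _ ≤ ∫⁻ y in Metric.closedBall (extChartAt (𝓡 N) x x) r, ENNReal.ofReal C := by
          refine setLIntegral_mono measurable_const fun y hy => ENNReal.ofReal_le_ofReal ?_
          exact (le_abs_self _).trans (hC y hy)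
      _ < ⊤ := by
          rw [setLIntegral_const]
          exact ENNReal.mul_lt_top ENNReal.ofReal_lt_top measure_closedBall_lt_top

end Volume


/-! ### Calculus rules for differentials. -/

section Differential

variable {N : ℕ} {M : Type*} [TopologicalSpace M] [ChartedSpace (Model N) M]

theorem diff_congr {u w : M → ℝ} {x : M} (h : u =ᶠ[𝓝 x] w) (v : TangentSpace (𝓡 N) x) :
    diff u x v = diff w x v :=
  DFunLike.congr_fun (h.mfderiv_eq (I := 𝓡 N) (I' := 𝓘(ℝ, ℝ))) v

theorem diff_const (a : ℝ) (x : M) (v : TangentSpace (𝓡 N) x) :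
    diff (fun _ : M => a) x v = 0 :=
  DFunLike.congr_fun (mfderiv_const (I := 𝓡 N) (I' := 𝓘(ℝ, ℝ)) (c := a) (x := x)) v

theorem diff_mul {u w : M → ℝ} {x : M} (hu : MDifferentiableAt (𝓡 N) 𝓘(ℝ, ℝ) u x)
    (hw : MDifferentiableAt (𝓡 N) 𝓘(ℝ, ℝ) w x) (v : TangentSpace (𝓡 N) x) :
    diff (fun x => u x * w x) x v = u x * diff w x v + w x * diff u x v :=
  DFunLike.congr_fun (hu.hasMFDerivAt.mul hw.hasMFDerivAt).mfderiv v

theorem diff_add {u w : M → ℝ} {x : M} (hu : MDifferentiableAt (𝓡 N) 𝓘(ℝ, ℝ) u x)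
    (hw : MDifferentiableAt (𝓡 N) 𝓘(ℝ, ℝ) w x) (v : TangentSpace (𝓡 N) x) :
    diff (fun x => u x + w x) x v = diff u x v + diff w x v :=
  DFunLike.congr_fun (hu.hasMFDerivAt.add hw.hasMFDerivAt).mfderiv v

theorem mdifferentiableAt_sum {ι : Type*} (t : Finset ι) {u : ι → M → ℝ} {x : M}
    (hu : ∀ i ∈ t, MDifferentiableAt (𝓡 N) 𝓘(ℝ, ℝ) (u i) x) :
    MDifferentiableAt (𝓡 N) 𝓘(ℝ, ℝ) (fun x => ∑ i ∈ t, u i x) x := by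
  classical
  induction t using Finset.induction_on with
  | empty => simpa using mdifferentiableAt_const
  | insert a t ha ih =>
    simp only [Finset.sum_insert ha]
    exact (hu a (Finset.mem_insert_self _ _)).add
      (ih fun i hi => hu i (Finset.mem_insert_of_mem hi))

theorem diff_sum {ι : Type*} (t : Finset ι) {u : ι → M → ℝ} {x : M}
    (hu : ∀ i ∈ t, MDifferentiableAt (𝓡 N) 𝓘(ℝ, ℝ) (u i) x) (v : TangentSpace (𝓡 N) x) :
    diff (fun x => ∑ i ∈ t, u i x) x v = ∑ i ∈ t, diff (u i) x v := by
  classical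
  induction t using Finset.induction_on with
  | empty => simpa using diff_const 0 x v
  | insert a t ha ih =>
    simp only [Finset.sum_insert ha]
    rw [diff_add (hu a (Finset.mem_insert_self _ _))
      (mdifferentiableAt_sum t fun i hi => hu i (Finset.mem_insert_of_mem hi)),
      ih fun i hi => hu i (Finset.mem_insert_of_mem hi)]

theorem diff_comp {h : ℝ → ℝ} {h' : ℝ} {u : M → ℝ} {x : M} (hh : HasDerivAt h h' (u x))
    (hu : MDifferentiableAt (𝓡 N) 𝓘(ℝ, ℝ) u x) (v : TangentSpace (𝓡 N) x) :
    diff (fun x => h (u x)) x v = h' * diff u x v := by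
  have h1 := DFunLike.congr_fun
    (mfderiv_comp x hh.differentiableAt.mdifferentiableAt hu) v
  rw [mfderiv_eq_fderiv, hh.hasFDerivAt.fderiv] at h1
  refine h1.trans ?_
  change diff u x v * h' = _
  ring

theorem diff_const_mul (a : ℝ) {u : M → ℝ} {x : M} (hu : MDifferentiableAt (𝓡 N) 𝓘(ℝ, ℝ) u x)
    (v : TangentSpace (𝓡 N) x) : diff (fun x => a * u x) x v = a * diff u x v :=
  diff_comp (h := fun t => a * t) (by simpa using (hasDerivAt_id (u x)).const_mul a) hu v

variable [IsManifold (𝓡 N) ∞ M]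

theorem continuousOn_diff_apply {u : M → ℝ} {U : Set M} (hU : IsOpen U)
    (hu : ContMDiffOn (𝓡 N) 𝓘(ℝ, ℝ) 1 u U) {X : ∀ x : M, TangentSpace (𝓡 N) x}
    (hX : ContinuousOn (fun x => (⟨x, X x⟩ : TangentBundle (𝓡 N) M)) U) :
    ContinuousOn (fun x => diff u x (X x)) U := by
  have : IsManifold (𝓡 N) 1 M := .of_le (n := ∞) (by simp)
  have h1 := hu.continuousOn_tangentMapWithin le_rfl hU.uniqueMDiffOn
  have h2 := (contMDiff_snd_tangentBundle_modelSpace ℝ 𝓘(ℝ, ℝ) (n := ∞)).continuous.comp_continuousOn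
    (h1.comp hX fun x hx => hx)
  refine h2.congr fun x hx => ?_
  have h4 := mfderivWithin_of_isOpen (f := u) (I := 𝓡 N) (I' := 𝓘(ℝ, ℝ)) hU hx
  exact (DFunLike.congr_fun h4 (X x)).symm

theorem continuous_diff_apply {u : M → ℝ} (hu : ContMDiff (𝓡 N) 𝓘(ℝ, ℝ) 1 u)
    {X : ∀ x : M, TangentSpace (𝓡 N) x}
    (hX : Continuous (fun x => (⟨x, X x⟩ : TangentBundle (𝓡 N) M))) :
    Continuous (fun x => diff u x (X x)) :=
  continuousOn_univ.1 (continuousOn_diff_apply isOpen_univ hu.contMDiffOn hX.continuousOn)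

end Differential

/-- Applied to integrands that make sense only on a chart domain but are cut off inside it. -/
theorem continuous_of_eq_zero_off {X Y : Type*} [TopologicalSpace X] [TopologicalSpace Y] [Zero Y]
    {f : X → Y} {U K : Set X} (hU : IsOpen U) (hK : IsClosed K) (hKU : K ⊆ U)
    (hf : ContinuousOn f U) (h0 : ∀ x, x ∉ K → f x = 0) : Continuous f := by
  rw [continuous_iff_continuousAt]
  intro x
  by_cases hx : x ∈ U
  · exact hf.continuousAt (hU.mem_nhds hx)
  · have : f =ᶠ[𝓝 x] fun _ => 0 := by
      filter_upwards [hK.isOpen_compl.mem_nhds fun h => hx (hKU h)] with y hy using h0 y hy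
    exact continuousAt_const.congr this.symm

/-! ### Integration by parts in Euclidean space. -/

section Euclidean

variable {N : ℕ}

/-- The extension of `ψ` by zero is differentiable on the whole space because `ψ` vanishes on `U`
off the compact set `K`; one integration by parts per coordinate then suffices. The field `V` is
needed only on the support of this extension. -/
theorem integral_mul_div_eq_neg {U K : Set (Model N)} (hU : IsOpen U) (hK : IsCompact K)
    (hKU : K ⊆ U) {ψ : Model N → ℝ} (hψ : ContDiffOn ℝ 1 ψ U) (hψK : ∀ y ∈ U, y ∉ K → ψ y = 0)
    {V : Model N → Model N} (hV : ContDiffOn ℝ 1 V U) :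
    ∫ y in U, ψ y * ∑ i, fderiv ℝ (fun z => V z i) y (EuclideanSpace.single i 1) =
      -∫ y in U, fderiv ℝ ψ y (V y) := by
  classical
  set g : Model N → ℝ := U.indicator ψ with hg
  have hgK : ∀ y, y ∉ K → g y = 0 := by
    intro y hy
    by_cases hyU : y ∈ U
    · rw [hg, indicator_of_mem hyU, hψK y hyU hy]
    · rw [hg, indicator_of_notMem hyU]
  have hgU : ∀ y ∈ U, g =ᶠ[𝓝 y] ψ := fun y hy => by
    filter_upwards [hU.mem_nhds hy] with z hz using indicator_of_mem hz _
  have hg0 : ∀ y, y ∉ K → g =ᶠ[𝓝 y] fun _ => 0 := fun y hy => by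
    filter_upwards [hK.isClosed.isOpen_compl.mem_nhds hy] with z hz using hgK z hz
  have hgdiff : ∀ y, DifferentiableAt ℝ g y := by
    intro y
    by_cases hyU : y ∈ U
    · exact ((hψ.differentiableOn (by simp)).differentiableAt (hU.mem_nhds hyU)).congr_of_eventuallyEq
        (hgU y hyU)
    · exact (differentiableAt_const 0).congr_of_eventuallyEq (hg0 y fun h => hyU (hKU h))
  have hVdiff : ∀ i, ∀ y ∈ U, DifferentiableAt ℝ (fun z => V z i) y := fun i y hy =>
    ((contDiffOn_euclidean.1 hV i).differentiableOn (by simp)).differentiableAt (hU.mem_nhds hy)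
  have hgc : Continuous g := continuous_iff_continuousAt.2 fun y => (hgdiff y).continuousAt
  have hgsupp : tsupport g ⊆ K := closure_minimal
    (fun y hy => by_contra fun h => hy (hgK y h)) hK.isClosed
  have hfd : ContinuousOn (fderiv ℝ ψ) U := hψ.continuousOn_fderiv_of_isOpen hU le_rfl
  have hgfd : ∀ y ∈ U, fderiv ℝ g y = fderiv ℝ ψ y := fun y hy => (hgU y hy).fderiv_eq
  have hgfd0 : ∀ y, y ∉ K → fderiv ℝ g y = 0 := fun y hy => by
    rw [(hg0 y hy).fderiv_eq]; simp
  have hint : ∀ f : Model N → ℝ, ContinuousOn f U → (∀ y, y ∉ K → f y = 0) → Integrable f :=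
    fun f hf h0 => (continuous_of_eq_zero_off hU hK.isClosed hKU hf h0
      ).integrable_of_hasCompactSupport (HasCompactSupport.intro hK fun y hy => h0 y hy)
  have hVc : ∀ i, ContinuousOn (fun z => V z i) U := fun i =>
    (contDiffOn_euclidean.1 hV i).continuousOn
  have hgfdc : ContinuousOn (fderiv ℝ g) U := hfd.congr hgfd
  have i1 : ∀ i : Fin N, Integrable fun y => fderiv ℝ g y (EuclideanSpace.single i 1) * V y i :=
    fun i => hint _ ((hgfdc.clm_apply continuousOn_const).mul (hVc i))
      fun y hy => by simp [hgfd0 y hy]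
  have i2 : ∀ i : Fin N, Integrable fun y =>
      g y * fderiv ℝ (fun z => V z i) y (EuclideanSpace.single i 1) := fun i =>
    hint _ (hgc.continuousOn.mul (((contDiffOn_euclidean.1 hV i).continuousOn_fderiv_of_isOpen hU
      le_rfl).clm_apply continuousOn_const)) fun y hy => by simp [hgK y hy]
  have i3 : ∀ i : Fin N, Integrable fun y => g y * V y i := fun i =>
    hint _ (hgc.continuousOn.mul (hVc i)) fun y hy => by simp [hgK y hy]
  have key : ∀ i : Fin N, ∫ y, g y * fderiv ℝ (fun z => V z i) y (EuclideanSpace.single i 1) =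
      -∫ y, fderiv ℝ g y (EuclideanSpace.single i 1) * V y i := fun i =>
    integral_mul_fderiv_eq_neg_fderiv_mul_of_integrable (i1 i) (i2 i) (i3 i) (fun y _ => hgdiff y)
      fun y hy => hVdiff i y (hKU (hgsupp hy))
  have hL : ∫ y in U, ψ y * ∑ i, fderiv ℝ (fun z => V z i) y (EuclideanSpace.single i 1) =
      ∫ y, ∑ i, g y * fderiv ℝ (fun z => V z i) y (EuclideanSpace.single i 1) := by
    rw [← integral_indicator hU.measurableSet]
    congr 1
    ext y
    by_cases hy : y ∈ U
    · rw [indicator_of_mem hy, hg, indicator_of_mem hy, Finset.mul_sum]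
    · rw [indicator_of_notMem hy, hg, indicator_of_notMem hy]; simp
  have hR : ∫ y in U, fderiv ℝ ψ y (V y) =
      ∫ y, ∑ i, fderiv ℝ g y (EuclideanSpace.single i 1) * V y i := by
    rw [← integral_indicator hU.measurableSet]
    congr 1
    ext y
    have hsum : fderiv ℝ g y (V y) = ∑ i, fderiv ℝ g y (EuclideanSpace.single i 1) * V y i := by
      conv_lhs => rw [← (EuclideanSpace.basisFun (Fin N) ℝ).sum_repr (V y)]
      simp [map_sum, mul_comm]
    by_cases hy : y ∈ U
    · rw [indicator_of_mem hy, ← hsum, hgfd y hy]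
    · rw [indicator_of_notMem hy, ← hsum, hgfd0 y fun h => hy (hKU h)]; simp
  rw [hL, hR, integral_finsetSum _ fun i _ => i2 i, integral_finsetSum _ fun i _ => i1 i,
    ← Finset.sum_neg_distrib]
  exact Finset.sum_congr rfl fun i _ => key i

end Euclidean


/-! ### The divergence theorem. -/

section Divergence

variable {N : ℕ} {M : Type*} [TopologicalSpace M] [ChartedSpace (Model N) M]
  [IsManifold (𝓡 N) ∞ M] [RiemannianBundle (fun x : M => TangentSpace (𝓡 N) x)]

/-- The divergence of `X` computed in the chart around `c`, at the point with coordinates `y`. -/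
def divAt (c : M) (X : ∀ x : M, TangentSpace (𝓡 N) x) (y : Model N) : ℝ :=
  (density c y)⁻¹ * ∑ i : Fin N,
    fderiv ℝ (fun z => (density c z • comps c X z) i) y (EuclideanSpace.single i (1 : ℝ))

theorem divAt_eq_zero {c : M} {X : ∀ x : M, TangentSpace (𝓡 N) x} {x : M}
    (hx : x ∈ (extChartAt (𝓡 N) c).source) (h0 : ∀ᶠ z in 𝓝 x, X z = 0) :
    divAt c X (extChartAt (𝓡 N) c x) = 0 := by
  have hy := (extChartAt (𝓡 N) c).map_source hx
  have h1 : ∀ᶠ z in 𝓝 (extChartAt (𝓡 N) c x), comps c X z = 0 := by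
    have hc := (contMDiffAt_chart_symm hy).continuousAt
    rw [ContinuousAt, (extChartAt (𝓡 N) c).left_inv hx] at hc
    filter_upwards [hc.eventually h0] with z hz
    rw [comps, hz]
    exact map_zero _
  have h2 : ∀ i : Fin N, (fun z => (density c z • comps c X z) i) =ᶠ[𝓝 (extChartAt (𝓡 N) c x)]
      fun _ => (0 : ℝ) := fun i => by
    filter_upwards [h1] with z hz
    simp [hz]
  have h3 : ∀ i : Fin N, fderiv ℝ (fun z => (density c z • comps c X z) i)
      (extChartAt (𝓡 N) c x) = 0 := fun i => by
    rw [(h2 i).fderiv_eq]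
    simp
  rw [divAt]
  simp only [h3]
  simp

variable [IsContMDiffRiemannianBundle (𝓡 N) ∞ (Model N) (fun x : M => TangentSpace (𝓡 N) x)]

section Smooth

variable {X : ∀ x : M, TangentSpace (𝓡 N) x}
  (hX : ContMDiff (𝓡 N) (𝓡 N).tangent ∞ (fun x => (⟨x, X x⟩ : TangentBundle (𝓡 N) M)))

include hX

theorem contDiffOn_flux (c : M) : ContDiffOn ℝ ∞ (fun z => density c z • comps c X z)
    (extChartAt (𝓡 N) c).target := by
  have h := contDiffOn_comps (c := c) (s := univ) hX.contMDiffOn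
  rw [preimage_univ, inter_univ] at h
  exact (contDiffOn_density c).smul h

theorem continuousOn_divAt (c : M) : ContinuousOn (divAt c X) (extChartAt (𝓡 N) c).target := by
  refine ((contDiffOn_density c).continuousOn.inv₀ fun y hy => (density_pos hy).ne').mul ?_
  refine continuousOn_finsetSum _ fun i _ => ?_
  exact ((contDiffOn_euclidean.1 (contDiffOn_flux hX c) i).continuousOn_fderiv_of_isOpen
    (isOpen_chart_target c) (by simp)).clm_apply continuousOn_const

theorem continuousOn_divAt_chart (c : M) :
    ContinuousOn (fun x => divAt c X (extChartAt (𝓡 N) c x)) (extChartAt (𝓡 N) c).source :=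
  (continuousOn_divAt hX c).comp (continuousOn_extChartAt c) fun _ hx =>
    (extChartAt (𝓡 N) c).map_source hx

variable [MeasurableSpace M] [BorelSpace M] [T2Space M] [SigmaCompactSpace M]

/-- In coordinates the density of the volume cancels the inverse density in the divergence, which
leaves the Euclidean formula for the flux. The right-hand side does not mention the chart, and this
yields the invariance of the divergence below. -/
theorem integral_mul_divAt (c : M) {K : Set M} (hK : IsCompact K)
    (hKc : K ⊆ (extChartAt (𝓡 N) c).source) {ψ : M → ℝ} (hψ : ContMDiff (𝓡 N) 𝓘(ℝ, ℝ) 1 ψ)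
    (hψK : ∀ x, x ∉ K → ψ x = 0) :
    ∫ x, ψ x * divAt c X (extChartAt (𝓡 N) c x) ∂(vol N M) = -∫ x, diff ψ x (X x) ∂(vol N M) := by
  have ho := isOpen_extChartAt_source (I := 𝓡 N) c
  have hd0 : ∀ x, x ∉ K → diff ψ x (X x) = 0 := fun x hx => by
    rw [diff_congr (w := fun _ => 0), diff_const]
    filter_upwards [hK.isClosed.isOpen_compl.mem_nhds hx] with z hz using hψK z hz
  have hf0 : ∀ x, x ∉ K → ψ x * divAt c X (extChartAt (𝓡 N) c x) = 0 := fun x hx => by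
    rw [hψK x hx, zero_mul]
  have hfc : Continuous fun x => ψ x * divAt c X (extChartAt (𝓡 N) c x) :=
    continuous_of_eq_zero_off ho hK.isClosed hKc
      (hψ.continuous.continuousOn.mul (continuousOn_divAt_chart hX c)) hf0
  have hdc : Continuous fun x => diff ψ x (X x) := continuous_diff_apply hψ hX.continuous
  rw [← setIntegral_eq_integral_of_forall_compl_eq_zero (s := (extChartAt (𝓡 N) c).source)
      fun x hx => hf0 x fun h => hx (hKc h),
    ← setIntegral_eq_integral_of_forall_compl_eq_zero (s := (extChartAt (𝓡 N) c).source)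
      fun x hx => hd0 x fun h => hx (hKc h),
    integral_source c hfc.measurable, integral_source c hdc.measurable]
  have hψc : ContDiffOn ℝ 1 (ψ ∘ (extChartAt (𝓡 N) c).symm) (extChartAt (𝓡 N) c).target := by
    rw [← contMDiffOn_iff_contDiffOn]
    exact hψ.comp_contMDiffOn ((contMDiffOn_chart_symm c).of_le (by simp))
  have key := integral_mul_div_eq_neg (isOpen_chart_target c)
    (hK.image_of_continuousOn ((continuousOn_extChartAt c).mono hKc))
    (by rintro _ ⟨x, hx, rfl⟩; exact (extChartAt (𝓡 N) c).map_source (hKc hx)) hψc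
    (fun y hy hyK => hψK _ fun h => hyK ⟨_, h, (extChartAt (𝓡 N) c).right_inv hy⟩)
    ((contDiffOn_flux hX c).of_le (by simp))
  have hm := (isOpen_chart_target (N := N) c).measurableSet
  rw [setIntegral_congr_fun hm (g := fun y => (ψ ∘ (extChartAt (𝓡 N) c).symm) y * ∑ i : Fin N,
      fderiv ℝ (fun z => (density c z • comps c X z) i) y (EuclideanSpace.single i (1 : ℝ))), key]
  · congr 1
    refine setIntegral_congr_fun hm fun y hy => ?_
    have hs : MDifferentiableAt (𝓡 N) 𝓘(ℝ, ℝ) ψ ((extChartAt (𝓡 N) c).symm y) :=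
      hψ.mdifferentiableAt (by simp)
    simp only [diff_comps hy hs, map_smul, smul_eq_mul]
  · intro y hy
    have := (density_pos hy).ne'
    simp only [divAt, (extChartAt (𝓡 N) c).right_inv hy, Function.comp_apply]
    field_simp

end Smooth

variable [MeasurableSpace M] [BorelSpace M] [T2Space M] [SigmaCompactSpace M]

/-- The density is positive. This upgrades an almost-everywhere identity of continuous functions to
a pointwise one. -/
instance : (vol N M).IsOpenPosMeasure := by
  refine ⟨fun U hU ⟨x, hx⟩ h0 => ?_⟩
  have hs : IsOpen (U ∩ (extChartAt (𝓡 N) x).source) := hU.inter (isOpen_extChartAt_source x)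
  have h1 := measure_mono_null (inter_subset_left (t := (extChartAt (𝓡 N) x).source)) h0
  rw [vol_apply_of_subset x hs.measurableSet inter_subset_right,
    chartVolume_apply x hs.measurableSet] at h1
  have hD : IsOpen ((extChartAt (𝓡 N) x).symm ⁻¹' (U ∩ (extChartAt (𝓡 N) x).source) ∩
      (extChartAt (𝓡 N) x).target) := by
    rw [inter_comm]
    exact (contMDiffOn_chart_symm x).continuousOn.isOpen_inter_preimage (isOpen_chart_target x) hs
  have hne : extChartAt (𝓡 N) x x ∈ (extChartAt (𝓡 N) x).symm ⁻¹'
      (U ∩ (extChartAt (𝓡 N) x).source) ∩ (extChartAt (𝓡 N) x).target := by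
    refine ⟨?_, mem_extChartAt_target x⟩
    rw [mem_preimage, extChartAt_to_inv]
    exact ⟨hx, mem_extChartAt_source x⟩
  rw [lintegral_eq_zero_iff' ((aemeasurable_density x).mono_measure
    (Measure.restrict_mono inter_subset_right le_rfl))] at h1
  have h2 : ∀ᵐ y ∂(volume.restrict ((extChartAt (𝓡 N) x).symm ⁻¹'
      (U ∩ (extChartAt (𝓡 N) x).source) ∩ (extChartAt (𝓡 N) x).target)), False := by
    filter_upwards [h1, ae_restrict_mem hD.measurableSet] with y hy hyD
    have := density_pos hyD.2
    simp only [Pi.zero_apply, ENNReal.ofReal_eq_zero] at hy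
    linarith
  rw [ae_iff] at h2
  simp only [not_false_eq_true] at h2
  rw [show {a : Model N | True} = univ from rfl, Measure.restrict_apply_univ] at h2
  exact (hD.measure_pos volume ⟨_, hne⟩).ne' h2

section Smooth

variable {X : ∀ x : M, TangentSpace (𝓡 N) x}
  (hX : ContMDiff (𝓡 N) (𝓡 N).tangent ∞ (fun x => (⟨x, X x⟩ : TangentBundle (𝓡 N) M)))

include hX

/-- A weak argument replaces the differentiation of the transition map. Against every test function
supported in the overlap both sides have the same integral, by `integral_mul_divAt`, and both are
continuous. -/
theorem divAt_eq_divAt {c c' x : M} (hc : x ∈ (extChartAt (𝓡 N) c).source)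
    (hc' : x ∈ (extChartAt (𝓡 N) c').source) :
    divAt c X (extChartAt (𝓡 N) c x) = divAt c' X (extChartAt (𝓡 N) c' x) := by
  set O := (extChartAt (𝓡 N) c).source ∩ (extChartAt (𝓡 N) c').source with hO
  have hOo : IsOpen O := (isOpen_extChartAt_source c).inter (isOpen_extChartAt_source c')
  set f : M → ℝ := fun x => divAt c X (extChartAt (𝓡 N) c x) - divAt c' X (extChartAt (𝓡 N) c' x)
    with hf
  have hfc : ContinuousOn f O :=
    ((continuousOn_divAt_chart hX c).mono inter_subset_left).sub
      ((continuousOn_divAt_chart hX c').mono inter_subset_right)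
  have : LocallyCompactSpace M := ChartedSpace.locallyCompactSpace (Model N) M
  have hae : ∀ᵐ x ∂(vol N M), x ∈ O → f x = 0 := by
    refine hOo.ae_eq_zero_of_integral_contMDiff_smul_eq_zero (𝓡 N)
      (hfc.locallyIntegrableOn hOo.measurableSet) fun g hg hgc hgO => ?_
    have hg0 : ∀ x, x ∉ tsupport g → g x = 0 := fun x hx => image_eq_zero_of_notMem_tsupport hx
    have hi : ∀ c₁ : M, tsupport g ⊆ (extChartAt (𝓡 N) c₁).source →
        Integrable (fun x => g x * divAt c₁ X (extChartAt (𝓡 N) c₁ x)) (vol N M) := by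
      intro c₁ hc₁
      have h0 : ∀ x, x ∉ tsupport g → g x * divAt c₁ X (extChartAt (𝓡 N) c₁ x) = 0 :=
        fun x hx => by rw [hg0 x hx, zero_mul]
      exact (continuous_of_eq_zero_off (isOpen_extChartAt_source c₁) (isClosed_tsupport g) hc₁
        (hg.continuous.continuousOn.mul (continuousOn_divAt_chart hX c₁)) h0
        ).integrable_of_hasCompactSupport (HasCompactSupport.intro hgc h0)
    have h1 := hgO.trans inter_subset_left
    have h2 := hgO.trans inter_subset_right
    simp only [hf, smul_eq_mul, mul_sub]
    rw [integral_sub (hi c h1) (hi c' h2), integral_mul_divAt hX c hgc h1 (hg.of_le (by simp)) hg0,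
      integral_mul_divAt hX c' hgc h2 (hg.of_le (by simp)) hg0, sub_self]
  have h0 : x ∈ O → f x = 0 := by
    intro hx
    by_contra hne
    have hV : IsOpen (O ∩ f ⁻¹' {0}ᶜ) := hfc.isOpen_inter_preimage hOo isOpen_compl_singleton
    refine (hV.measure_pos (vol N M) ⟨x, hx, hne⟩).ne' ?_
    refine measure_mono_null (fun z hz => ?_) (ae_iff.1 hae)
    exact fun h => hz.2 (h hz.1)
  exact sub_eq_zero.1 (h0 ⟨hc, hc'⟩)

theorem divergence_eq_divAt_chart {c x : M} (hc : x ∈ (extChartAt (𝓡 N) c).source) :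
    divergence X x = divAt c X (extChartAt (𝓡 N) c x) :=
  divAt_eq_divAt hX (mem_extChartAt_source x) hc

theorem continuous_divergence : Continuous (divergence X) := by
  rw [continuous_iff_continuousAt]
  intro x
  have h := (continuousOn_divAt_chart hX x).continuousAt (extChartAt_source_mem_nhds (I := 𝓡 N) x)
  refine h.congr ?_
  filter_upwards [extChartAt_source_mem_nhds (I := 𝓡 N) x] with z hz
  exact (divergence_eq_divAt_chart hX hz).symm

omit hX in
theorem divergence_eq_zero {x : M} (hx : x ∉ closure {x | X x ≠ 0}) : divergence X x = 0 := by
  refine divAt_eq_zero (mem_extChartAt_source x) ?_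
  filter_upwards [isClosed_closure.isOpen_compl.mem_nhds hx] with z hz
  by_contra h
  exact hz (subset_closure h)

/-- The functions `ρ c * ψ` are each supported in one chart, where `integral_mul_divAt` applies, and
only finitely many of them are nonzero. -/
theorem integral_mul_divergence_of_hasCompactSupport {ψ : M → ℝ}
    (hψ : ContMDiff (𝓡 N) 𝓘(ℝ, ℝ) 1 ψ) (hψc : HasCompactSupport ψ) :
    ∫ x, ψ x * divergence X x ∂(vol N M) = -∫ x, diff ψ x (X x) ∂(vol N M) := by
  set ρ := chartPartition N M
  have hfin := ρ.locallyFinite.finite_nonempty_inter_compact hψc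
  set t := hfin.toFinset
  have hρ : ∀ c, ContMDiff (𝓡 N) 𝓘(ℝ, ℝ) 1 (ρ c) := fun c => (ρ c).contMDiff.of_le (by simp)
  have hsum : ∀ x, ψ x = ∑ c ∈ t, ρ c x * ψ x := by
    intro x
    by_cases hx : ψ x = 0
    · simp [hx]
    · rw [← Finset.sum_mul]
      have h1 := ρ.sum_eq_one (mem_univ x)
      rw [finsum_eq_sum_of_support_subset (s := t)] at h1
      · rw [h1, one_mul]
      · intro c hc
        simp only [t, Finite.coe_toFinset]
        exact ⟨x, hc, subset_tsupport _ hx⟩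
  have hsub : ∀ c, tsupport (ρ c) ⊆ (extChartAt (𝓡 N) c).source := fun c => by
    have h := (SmoothPartitionOfUnity.exists_isSubordinate_chartAt_source (𝓡 N) M).choose_spec c
    rw [extChartAt_source]
    exact h
  have hη : ∀ c, ContMDiff (𝓡 N) 𝓘(ℝ, ℝ) 1 fun x => ρ c x * ψ x := fun c => (hρ c).mul hψ
  have hη0 : ∀ c x, x ∉ tsupport (ρ c) ∩ tsupport ψ → ρ c x * ψ x = 0 := by
    intro c x hx
    rw [mem_inter_iff, not_and_or] at hx
    rcases hx with hx | hx <;> simp [image_eq_zero_of_notMem_tsupport hx]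
  have hKc : ∀ c, IsCompact (tsupport (ρ c) ∩ tsupport ψ) := fun c =>
    hψc.inter_left (isClosed_tsupport _)
  have hloc : ∀ c, ∫ x, ρ c x * ψ x * divergence X x ∂(vol N M) =
      -∫ x, diff (fun x => ρ c x * ψ x) x (X x) ∂(vol N M) := by
    intro c
    rw [← integral_mul_divAt hX c (hKc c) (inter_subset_left.trans (hsub c)) (hη c) (hη0 c)]
    congr 1
    ext x
    by_cases hx : x ∈ (extChartAt (𝓡 N) c).source
    · rw [divergence_eq_divAt_chart hX hx]
    · rw [hη0 c x fun h => hx (hsub c h.1), zero_mul, zero_mul]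
  have hint : ∀ f : M → ℝ, Continuous f → ∀ c, (∀ x, x ∉ tsupport (ρ c) ∩ tsupport ψ → f x = 0) →
      Integrable f (vol N M) := fun f hf c h0 =>
    hf.integrable_of_hasCompactSupport (HasCompactSupport.intro (hKc c) h0)
  have h1 : ∀ x, diff ψ x (X x) = ∑ c ∈ t, diff (fun x => ρ c x * ψ x) x (X x) := by
    intro x
    rw [← diff_sum t fun c _ => (hη c).mdifferentiableAt (by simp)]
    exact diff_congr (Eventually.of_forall hsum) _
  have h2 : ∀ x, ψ x * divergence X x = ∑ c ∈ t, ρ c x * ψ x * divergence X x := by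
    intro x
    rw [← Finset.sum_mul, ← hsum x]
  simp_rw [h1, h2]
  rw [integral_finsetSum, integral_finsetSum, ← Finset.sum_neg_distrib]
  · exact Finset.sum_congr rfl fun c _ => hloc c
  · intro c _
    refine hint _ (continuous_diff_apply (hη c) hX.continuous) c fun x hx => ?_
    rw [diff_congr (w := fun _ => 0), diff_const]
    filter_upwards [((isClosed_tsupport _).inter (isClosed_tsupport _)).isOpen_compl.mem_nhds hx]
      with z hz using hη0 c z hz
  · intro c _
    refine hint _ ((hη c).continuous.mul (continuous_divergence hX)) c fun x hx => ?_
    rw [hη0 c x hx, zero_mul]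

/-- The divergence theorem for a compactly supported field. -/
theorem integral_mul_divergence (hXc : IsCompact (closure {x | X x ≠ 0})) {ψ : M → ℝ}
    (hψ : ContMDiff (𝓡 N) 𝓘(ℝ, ℝ) 1 ψ) :
    ∫ x, ψ x * divergence X x ∂(vol N M) = -∫ x, diff ψ x (X x) ∂(vol N M) := by
  have : LocallyCompactSpace M := ChartedSpace.locallyCompactSpace (Model N) M
  -- A cut-off equal to one near the support of `X` makes `ψ` compactly supported without changing
  -- either integrand.
  obtain ⟨K', hK', hKK'⟩ := exists_compact_superset hXc
  obtain ⟨χ, hχ1, hχ0, -⟩ := exists_contMDiffMap_one_nhds_of_subset_interior (n := (⊤ : ℕ∞)) (𝓡 N)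
    hXc.isClosed hKK'
  have hχ : ContMDiff (𝓡 N) 𝓘(ℝ, ℝ) 1 χ := χ.contMDiff.of_le (by simp)
  have h := integral_mul_divergence_of_hasCompactSupport hX (hχ.mul hψ)
    (HasCompactSupport.intro hK' fun x hx => by simp [hχ0 x hx])
  convert h using 2
  · ext x
    by_cases hx : x ∈ closure {x | X x ≠ 0}
    · have := (hχ1.filter_mono (nhds_le_nhdsSet hx)).self_of_nhds
      simp [this]
    · simp [divergence_eq_zero hx]
  · congr 1
    ext x
    by_cases hx : x ∈ closure {x | X x ≠ 0}
    · refine diff_congr ?_ _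
      filter_upwards [hχ1.filter_mono (nhds_le_nhdsSet hx)] with z hz
      simp [hz]
    · have : X x = 0 := by_contra fun h => hx (subset_closure h)
      simp [this]

end Smooth

end Divergence


/-! ### Upper semicontinuity of the gradient norm. -/

section Gradient

variable {N : ℕ} {M : Type*} [TopologicalSpace M] [ChartedSpace (Model N) M]

/-- The coordinates of a tangent vector at `x` in the chart around `c`. -/
def coords (c x : M) : TangentSpace (𝓡 N) x →ₗ[ℝ] Model N where
  toFun v := (mfderiv (𝓡 N) 𝓘(ℝ, Model N) (extChartAt (𝓡 N) c) x v : Model N)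
  map_add' v w := (mfderiv (𝓡 N) 𝓘(ℝ, Model N) (extChartAt (𝓡 N) c) x).map_add v w
  map_smul' a v := (mfderiv (𝓡 N) 𝓘(ℝ, Model N) (extChartAt (𝓡 N) c) x).map_smul a v

variable [IsManifold (𝓡 N) ∞ M]

theorem diff_eq_fderiv {c x : M} (hx : x ∈ (extChartAt (𝓡 N) c).source) {u : M → ℝ}
    (hu : MDifferentiableAt (𝓡 N) 𝓘(ℝ, ℝ) u x) (v : TangentSpace (𝓡 N) x) :
    diff u x v = fderiv ℝ (u ∘ (extChartAt (𝓡 N) c).symm) (extChartAt (𝓡 N) c x)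
      (coords c x v) := by
  obtain ⟨y, hy, rfl⟩ : ∃ y ∈ (extChartAt (𝓡 N) c).target, (extChartAt (𝓡 N) c).symm y = x :=
    ⟨_, (extChartAt (𝓡 N) c).map_source hx, (extChartAt (𝓡 N) c).left_inv hx⟩
  rw [(extChartAt (𝓡 N) c).right_inv hy, ← diff_chart_symm hy hu]
  congr 1
  exact (DFunLike.congr_fun (mfderiv_chart_symm_comp hy) v).symm

theorem continuousLinearMapAt_eq_coords {c x : M} (hx : x ∈ (extChartAt (𝓡 N) c).source)
    (v : TangentSpace (𝓡 N) x) :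
    (trivializationAt (Model N) (TangentSpace (𝓡 N)) c).continuousLinearMapAt ℝ x v =
      coords c x v := by
  have : IsManifold (𝓡 N) 1 M := .of_le (n := ∞) (by simp)
  exact DFunLike.congr_fun (TangentBundle.continuousLinearMapAt_trivializationAt
    (by simpa using hx)) v

theorem contDiffAt_comp_chart_symm {c x : M} (hx : x ∈ (extChartAt (𝓡 N) c).source) {u : M → ℝ}
    {n : ℕ∞} (hu : ContMDiffAt (𝓡 N) 𝓘(ℝ, ℝ) n u x) :
    ContDiffAt ℝ n (u ∘ (extChartAt (𝓡 N) c).symm) (extChartAt (𝓡 N) c x) := by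
  have hy := (extChartAt (𝓡 N) c).map_source hx
  rw [← (extChartAt (𝓡 N) c).left_inv hx] at hu
  exact (hu.comp _ ((contMDiffAt_chart_symm hy).of_le (by exact_mod_cast le_top))).contDiffAt

theorem exists_local_field {p : M} (v : TangentSpace (𝓡 N) p) :
    ∃ s ∈ 𝓝 p, ∃ X : ∀ x : M, TangentSpace (𝓡 N) x, X p = v ∧
      ContMDiffOn (𝓡 N) (𝓡 N).tangent ∞ (fun x => (⟨x, X x⟩ : TangentBundle (𝓡 N) M)) s := by
  obtain ⟨s, hs, h⟩ := FiberBundle.exists_contMDiffOn_extend (k := ∞) (𝓡 N) (Model N) v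
  exact ⟨s, hs, _, FiberBundle.extend_apply_self (Model N) v, h⟩

variable [RiemannianBundle (fun x : M => TangentSpace (𝓡 N) x)]
  [IsContMDiffRiemannianBundle (𝓡 N) ∞ (Model N) (fun x : M => TangentSpace (𝓡 N) x)]

theorem isContinuousRiemannianBundle :
    IsContinuousRiemannianBundle (Model N) (fun x : M => TangentSpace (𝓡 N) x) := by
  obtain ⟨g, hg, h⟩ := IsContMDiffRiemannianBundle.exists_contMDiff (IB := 𝓡 N) (n := ∞)
    (F := Model N) (E := fun x : M => TangentSpace (𝓡 N) x)
  exact ⟨g, hg.continuous, h⟩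

theorem continuousOn_norm_field {X : ∀ x : M, TangentSpace (𝓡 N) x} {s : Set M}
    (hX : ContMDiffOn (𝓡 N) (𝓡 N).tangent ∞ (fun x => (⟨x, X x⟩ : TangentBundle (𝓡 N) M)) s) :
    ContinuousOn (fun x => ‖X x‖) s := by
  have h := (hX.inner_bundle hX).continuousOn
  refine h.sqrt.congr fun x _ => ?_
  exact norm_eq_sqrt_real_inner (X x)

/-- A vector at `z` is compared with the vector at `x` having the same coordinates: by continuity of
the metric its norm grows by a factor near one at most, and the derivative of `u` in coordinates is
continuous. -/
theorem eventually_gradNorm_lt {u : M → ℝ} {x : M} (hu : ContMDiffAt (𝓡 N) 𝓘(ℝ, ℝ) 1 u x) {b : ℝ}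
    (hb : gradNorm (N := N) u x < b) : ∀ᶠ z in 𝓝 x, gradNorm (N := N) u z < b := by
  have := isContinuousRiemannianBundle (N := N) (M := M)
  have hg0 : 0 ≤ gradNorm (N := N) u x := gradNorm_nonneg u x
  obtain ⟨C, hC, hCx⟩ := eventually_norm_trivializationAt_lt (Model N)
    (fun x : M => TangentSpace (𝓡 N) x) x
  -- Room for two losses: `r` for the transport of the vector from `z` to `x`, and `δ` for the
  -- variation of the coordinate derivative, `C` converting the norm of the vector into that of its
  -- coordinates.
  obtain ⟨δ, hδ, r, hr, hδr⟩ : ∃ δ > 0, ∃ r > 1, r * gradNorm (N := N) u x + δ * C < b := by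
    have h1 : Tendsto (fun t : ℝ => (1 + t) * gradNorm (N := N) u x + t * C) (𝓝[>] 0)
        (𝓝 ((1 + 0) * gradNorm (N := N) u x + 0 * C)) :=
      tendsto_nhdsWithin_of_tendsto_nhds (Continuous.tendsto (by fun_prop) 0)
    have h2 := (h1.eventually_lt_const (by simpa using hb)).and self_mem_nhdsWithin
    obtain ⟨t, ht, ht0⟩ := h2.exists
    exact ⟨t, ht0, 1 + t, by simpa using ht0, ht⟩
  have hxs := mem_extChartAt_source (I := 𝓡 N) x
  have hcd := contDiffAt_comp_chart_symm (n := 1) hxs hu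
  have hfd : ContinuousAt (fun z => fderiv ℝ (u ∘ (extChartAt (𝓡 N) x).symm)
      (extChartAt (𝓡 N) x z)) x :=
    ContinuousAt.comp (g := fderiv ℝ (u ∘ (extChartAt (𝓡 N) x).symm))
      (hcd.fderiv_right (m := 0) (by simp)).continuousAt (continuousAt_extChartAt x)
  have hdiff : ∀ᶠ z in 𝓝 x, MDifferentiableAt (𝓡 N) 𝓘(ℝ, ℝ) u z := by
    have h1 : IsManifold (𝓡 N) 1 M := .of_le (n := ∞) (by simp)
    filter_upwards [(contMDiffAt_iff_contMDiffAt_nhds (by simp)).1 hu] with z hz using hz.mdifferentiableAt (by simp)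
  filter_upwards [hCx, hdiff, extChartAt_source_mem_nhds (I := 𝓡 N) x,
    hfd.eventually (Metric.ball_mem_nhds _ hδ),
    eventually_norm_symmL_trivializationAt_self_comp_lt (Model N)
      (fun x : M => TangentSpace (𝓡 N) x) x hr] with z hz1 hz2 hz3 hz4 hz5
  refine lt_of_le_of_lt ((gradNorm_le_iff (by positivity)).2 fun v => ?_) hδr
  set w := coords x z v with hw
  have hwC : ‖w‖ ≤ C * ‖v‖ := by
    rw [hw, ← continuousLinearMapAt_eq_coords hz3]
    exact (ContinuousLinearMap.le_opNorm _ v).trans (by gcongr)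
  set e := trivializationAt (Model N) (TangentSpace (𝓡 N)) x with he
  set v' : TangentSpace (𝓡 N) x := e.symmL ℝ x w with hv'
  have hv'r : ‖v'‖ ≤ r * ‖v‖ := by
    rw [hv', hw, ← continuousLinearMapAt_eq_coords hz3]
    exact (ContinuousLinearMap.le_opNorm ((e.symmL ℝ x).comp (e.continuousLinearMapAt ℝ z)) v).trans
      (by gcongr)
  have hcv' : coords x x v' = w := by
    rw [← continuousLinearMapAt_eq_coords hxs, hv']
    exact e.continuousLinearMapAt_symmL (FiberBundle.mem_baseSet_trivializationAt' x) w
  have h1 := diff_eq_fderiv hz3 hz2 v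
  have h2 := diff_eq_fderiv hxs (hu.mdifferentiableAt (by simp)) v'
  rw [hcv'] at h2
  rw [dist_eq_norm] at hz4
  have h3 : diff u z v = diff u x v' + (fderiv ℝ (u ∘ (extChartAt (𝓡 N) x).symm)
      (extChartAt (𝓡 N) x z) - fderiv ℝ (u ∘ (extChartAt (𝓡 N) x).symm)
      (extChartAt (𝓡 N) x x)) w := by
    rw [h1, h2, sub_apply]; ring
  rw [h3]
  refine (abs_add_le _ _).trans ?_
  have h4 := abs_diff_le u x v'
  have h5 := ContinuousLinearMap.le_opNorm (fderiv ℝ (u ∘ (extChartAt (𝓡 N) x).symm)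
      (extChartAt (𝓡 N) x z) - fderiv ℝ (u ∘ (extChartAt (𝓡 N) x).symm)
      (extChartAt (𝓡 N) x x)) w
  rw [Real.norm_eq_abs] at h5
  calc _ ≤ gradNorm (N := N) u x * (r * ‖v‖) + δ * (C * ‖v‖) := by
        refine add_le_add (h4.trans (by gcongr)) (h5.trans ?_)
        exact mul_le_mul hz4.le hwC (norm_nonneg _) hδ.le
    _ = _ := by ring

end Gradient

/-! ### Lipschitz bounds from gradient bounds. -/

section Lipschitz

variable {N : ℕ} {M : Type*} [EMetricSpace M] [ChartedSpace (Model N) M]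
  [RiemannianBundle (fun x : M => TangentSpace (𝓡 N) x)] [IsRiemannianManifold (𝓡 N) M]

theorem enorm_sub_le_mul_pathELength {u : M → ℝ} (hu : ContMDiff (𝓡 N) 𝓘(ℝ, ℝ) 1 u) {K : ℝ≥0}
    (hK : ∀ x, gradNorm (N := N) u x ≤ K) {γ : ℝ → M}
    (hγ : ContMDiffOn 𝓘(ℝ, ℝ) (𝓡 N) 1 γ (Icc 0 1)) :
    ‖u (γ 1) - u (γ 0)‖ₑ ≤ K * pathELength (𝓡 N) γ 0 1 := by
  have hc : ContDiffOn ℝ 1 (u ∘ γ) (Icc 0 1) := by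
    rw [← contMDiffOn_iff_contDiffOn]
    exact hu.comp_contMDiffOn hγ
  calc ‖u (γ 1) - u (γ 0)‖ₑ
      ≤ ∫⁻ t in Icc (0 : ℝ) 1, ‖derivWithin (u ∘ γ) (Icc 0 1) t‖ₑ :=
        enorm_sub_le_lintegral_derivWithin_Icc_of_contDiffOn_Icc hc zero_le_one
    _ ≤ ∫⁻ t in Icc (0 : ℝ) 1, K * ‖mfderivWithin 𝓘(ℝ, ℝ) (𝓡 N) γ (Icc 0 1) t 1‖ₑ := by
        refine setLIntegral_mono' measurableSet_Icc fun t ht => ?_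
        have h1 : mfderivWithin 𝓘(ℝ, ℝ) 𝓘(ℝ, ℝ) (u ∘ γ) (Icc 0 1) t =
            (mfderiv (𝓡 N) 𝓘(ℝ, ℝ) u (γ t)).comp
              (mfderivWithin 𝓘(ℝ, ℝ) (𝓡 N) γ (Icc 0 1) t) := by
          refine mfderiv_comp_mfderivWithin t (hu.mdifferentiableAt (by simp))
            (hγ.mdifferentiableOn (by simp) t ht) ?_
          rw [uniqueMDiffWithinAt_iff_uniqueDiffWithinAt]
          exact uniqueDiffOn_Icc zero_lt_one t ht
        rw [mfderivWithin_eq_fderivWithin] at h1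
        have h2 : derivWithin (u ∘ γ) (Icc 0 1) t =
            diff u (γ t) (mfderivWithin 𝓘(ℝ, ℝ) (𝓡 N) γ (Icc 0 1) t 1) := by
          rw [← fderivWithin_derivWithin]
          exact DFunLike.congr_fun h1 (1 : ℝ)
        have h3 := (abs_diff_le u (γ t) (mfderivWithin 𝓘(ℝ, ℝ) (𝓡 N) γ (Icc 0 1) t 1)).trans
          (mul_le_mul_of_nonneg_right (hK _) (norm_nonneg _))
        rw [h2, ← ofReal_norm, ← ofReal_norm, Real.norm_eq_abs,
          ← ENNReal.ofReal_coe_nnreal]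
        exact (ENNReal.ofReal_le_ofReal h3).trans_eq (ENNReal.ofReal_mul K.coe_nonneg)
    _ = K * pathELength (𝓡 N) γ 0 1 := by
        rw [lintegral_const_mul' _ _ ENNReal.coe_ne_top,
          pathELength_eq_lintegral_mfderivWithin_Icc]

/-- The distance is the infimum of lengths of paths, and along a path `u` varies by at most `K`
times the length. The manifold may be disconnected: at infinite distance the bound is trivial,
provided `K ≠ 0`. -/
theorem lipschitzWith_of_gradNorm_le {u : M → ℝ} (hu : ContMDiff (𝓡 N) 𝓘(ℝ, ℝ) 1 u) {K : ℝ≥0}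
    (hK0 : K ≠ 0) (hK : ∀ x, gradNorm (N := N) u x ≤ K) : LipschitzWith K u := by
  intro x y
  rw [IsRiemannianManifold.out (I := 𝓡 N) x y, edist_comm, edist_eq_enorm_sub]
  rcases eq_or_ne (riemannianEDist (𝓡 N) x y) ⊤ with htop | htop
  · rw [htop, ENNReal.mul_top (by simpa using hK0)]
    exact le_top
  refine ENNReal.le_of_forall_pos_le_add fun δ hδ _ => ?_
  obtain ⟨γ, rfl, rfl, hγ, hlt⟩ := exists_lt_of_riemannianEDist_lt (I := 𝓡 N)
    (ENNReal.lt_add_right htop (b := δ / K) (by simp [hδ.ne']))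
  refine (enorm_sub_le_mul_pathELength hu hK hγ).trans ?_
  calc (K : ℝ≥0∞) * pathELength (𝓡 N) γ 0 1 ≤ K * (riemannianEDist (𝓡 N) (γ 0) (γ 1) + δ / K) := by
        gcongr
    _ = _ := by
        rw [mul_add, ENNReal.mul_div_cancel (by simpa using hK0) ENNReal.coe_ne_top]

end Lipschitz


/-! ### Layers of a function which is monotone in one coordinate. -/

section Slices

variable {n : ℕ}

/-- The coordinates of `y` other than the `i`-th. -/
def dropCoord (i : Fin (n + 1)) (y : Model (n + 1)) : Fin n → ℝ := fun j => y (i.succAbove j)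

/-- The point with `i`-th coordinate `t` and other coordinates `z`. -/
def insCoord (i : Fin (n + 1)) (z : Fin n → ℝ) (t : ℝ) : Model (n + 1) :=
  WithLp.toLp 2 (i.insertNth t z)

theorem continuous_dropCoord (i : Fin (n + 1)) : Continuous (dropCoord i) := by
  unfold dropCoord
  fun_prop

theorem dropCoord_insCoord (i : Fin (n + 1)) (z : Fin n → ℝ) (t : ℝ) :
    dropCoord i (insCoord i z t) = z := by
  ext j
  simp [dropCoord, insCoord]

theorem hasDerivAt_insCoord (i : Fin (n + 1)) (z : Fin n → ℝ) (t : ℝ) :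
    HasDerivAt (insCoord i z) (EuclideanSpace.single i 1) t := by
  have h : insCoord i z = fun t => insCoord i z 0 + t • EuclideanSpace.single i (1 : ℝ) := by
    ext t j
    refine Fin.succAboveCases i ?_ (fun j => ?_) j <;> simp [insCoord]
  rw [h]
  simpa using ((hasDerivAt_id t).smul_const (EuclideanSpace.single i (1 : ℝ))).const_add
    (insCoord i z 0)

theorem insCoord_convex (i : Fin (n + 1)) (z : Fin n → ℝ) {B : Set (Model (n + 1))}
    (hB : Convex ℝ B) {a b t : ℝ} (ha : insCoord i z a ∈ B) (hb : insCoord i z b ∈ B)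
    (ht : t ∈ Icc a b) : insCoord i z t ∈ B := by
  have hseg : t ∈ segment ℝ a b := by rwa [segment_eq_Icc (ht.1.trans ht.2)]
  obtain ⟨u, v, hu, hv, huv, rfl⟩ := hseg
  have : insCoord i z (u • a + v • b) = u • insCoord i z a + v • insCoord i z b := by
    ext j
    refine Fin.succAboveCases i ?_ (fun j => ?_) j
    · simp [insCoord]
    · simp [insCoord, ← add_mul, huv]
  rw [this]
  exact hB ha hb hu hv huv

theorem lintegral_eq_lintegral_insCoord (i : Fin (n + 1)) {g : Model (n + 1) → ℝ≥0∞}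
    (hg : Measurable g) : ∫⁻ y, g y = ∫⁻ z : Fin n → ℝ, ∫⁻ t : ℝ, g (insCoord i z t) := by
  have h1 := (PiLp.volume_preserving_toLp (Fin (n + 1))).lintegral_comp hg
  have h2 := (volume_preserving_piFinSuccAbove (fun _ : Fin (n + 1) => ℝ) i).symm.lintegral_comp
    (f := fun y => g (WithLp.toLp 2 y)) (by fun_prop)
  rw [← h1, ← h2, Measure.volume_eq_prod, lintegral_prod_symm']
  · rfl
  · fun_prop

/-- By convexity the line meets `B` in an interval, on which `F` is injective by Rolle's theorem.
The claim is the substitution `s = F`, whose derivative is at least `c` in absolute value. -/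
theorem setLIntegral_slice_le {B : Set (Model (n + 1))} (hB : Convex ℝ B) (hBo : IsOpen B)
    {F : Model (n + 1) → ℝ} (hF : ∀ y ∈ B, DifferentiableAt ℝ F y) (i : Fin (n + 1)) {c : ℝ}
    (hc : 0 < c) (hFc : ∀ y ∈ B, c ≤ |fderiv ℝ F y (EuclideanSpace.single i 1)|)
    (z : Fin n → ℝ) (k : ℝ → ℝ≥0∞) :
    ∫⁻ t in {t | insCoord i z t ∈ B}, k (F (insCoord i z t)) ≤
      ENNReal.ofReal c⁻¹ * ∫⁻ s, k s := by
  set S := {t | insCoord i z t ∈ B} with hS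
  have hcont : Continuous (insCoord i z) :=
    continuous_iff_continuousAt.2 fun t => (hasDerivAt_insCoord i z t).continuousAt
  have hSm : MeasurableSet S := (hBo.preimage hcont).measurableSet
  set f' : ℝ → ℝ := fun t => fderiv ℝ F (insCoord i z t) (EuclideanSpace.single i 1)
  have hd : ∀ t ∈ S, HasDerivAt (fun t => F (insCoord i z t)) (f' t) t := fun t ht =>
    (hF _ ht).hasFDerivAt.comp_hasDerivAt t (hasDerivAt_insCoord i z t)
  have hinj : InjOn (fun t => F (insCoord i z t)) S := by
    have key : ∀ a ∈ S, ∀ b ∈ S, a < b → F (insCoord i z a) = F (insCoord i z b) → False := by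
      intro a ha b hb hab h
      have hsub : ∀ t ∈ Icc a b, t ∈ S := fun t ht => insCoord_convex i z hB ha hb ht
      obtain ⟨t, ht, ht0⟩ := exists_hasDerivAt_eq_zero hab
        (fun t ht => (hd t (hsub t ht)).continuousAt.continuousWithinAt) h
        (fun t ht => hd t (hsub t (Ioo_subset_Icc_self ht)))
      have := hFc _ (hsub t (Ioo_subset_Icc_self ht))
      rw [show fderiv ℝ F (insCoord i z t) (EuclideanSpace.single i 1) = 0 from ht0, abs_zero] at this
      linarith
    intro a ha b hb h
    rcases lt_trichotomy a b with hab | hab | hab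
    · exact (key a ha b hb hab h).elim
    · exact hab
    · exact (key b hb a ha hab h.symm).elim
  calc ∫⁻ t in S, k (F (insCoord i z t))
      ≤ ∫⁻ t in S, ENNReal.ofReal c⁻¹ * (ENNReal.ofReal |f' t| * k (F (insCoord i z t))) := by
        refine setLIntegral_mono' hSm fun t ht => ?_
        rw [← mul_assoc, ← ENNReal.ofReal_mul (inv_nonneg.2 hc.le)]
        refine le_mul_of_one_le_left zero_le (ENNReal.one_le_ofReal.2 ?_)
        rw [inv_mul_eq_div, one_le_div hc]
        exact hFc _ ht
    _ = ENNReal.ofReal c⁻¹ * ∫⁻ t in S, ENNReal.ofReal |f' t| * k (F (insCoord i z t)) :=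
        lintegral_const_mul' _ _ ENNReal.ofReal_ne_top
    _ = ENNReal.ofReal c⁻¹ * ∫⁻ s in (fun t => F (insCoord i z t)) '' S, k s := by
        rw [lintegral_image_eq_lintegral_abs_deriv_mul hSm
          (fun t ht => (hd t ht).hasDerivWithinAt) hinj]
    _ ≤ _ := by
        gcongr
        exact Measure.restrict_le_self

/-- Tonelli, with the slice bound on each line over `V`. This takes the place of the coarea formula.
-/
theorem setLIntegral_layer_le {B : Set (Model (n + 1))} (hB : Convex ℝ B) (hBo : IsOpen B)
    {F : Model (n + 1) → ℝ} (hF : ∀ y ∈ B, DifferentiableAt ℝ F y) (i : Fin (n + 1)) {c : ℝ}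
    (hc : 0 < c) (hFc : ∀ y ∈ B, c ≤ |fderiv ℝ F y (EuclideanSpace.single i 1)|)
    {V : Set (Fin n → ℝ)} (hV : MeasurableSet V) {k : ℝ → ℝ≥0∞} (hk : Measurable k) :
    ∫⁻ y in B ∩ dropCoord i ⁻¹' V, k (F y) ≤ ENNReal.ofReal c⁻¹ * volume V * ∫⁻ s, k s := by
  classical
  have hm : MeasurableSet (B ∩ dropCoord i ⁻¹' V) :=
    hBo.measurableSet.inter ((continuous_dropCoord i).measurable hV)
  -- `F` is controlled only on `B`; its extension by zero is measurable on the whole space.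
  set Fb : Model (n + 1) → ℝ := B.piecewise F 0 with hFb
  have hFbm : Measurable Fb := ContinuousOn.measurable_piecewise
    (fun y hy => (hF y hy).continuousAt.continuousWithinAt) continuousOn_const hBo.measurableSet
  have hkF : Measurable fun y => k (Fb y) := hk.comp hFbm
  have h1 : ∫⁻ y in B ∩ dropCoord i ⁻¹' V, k (F y) =
      ∫⁻ y, (B ∩ dropCoord i ⁻¹' V).indicator (fun y => k (Fb y)) y := by
    rw [lintegral_indicator hm]
    refine setLIntegral_congr_fun hm fun y hy => ?_
    simp [hFb, hy.1]
  rw [h1, lintegral_eq_lintegral_insCoord i (hkF.indicator hm)]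
  have hcont : ∀ z, Continuous (insCoord i z) := fun z =>
    continuous_iff_continuousAt.2 fun t => (hasDerivAt_insCoord i z t).continuousAt
  calc _ ≤ ∫⁻ z : Fin n → ℝ, V.indicator (fun _ => ENNReal.ofReal c⁻¹ * ∫⁻ s, k s) z := by
        refine lintegral_mono fun z => ?_
        by_cases hz : z ∈ V
        · rw [indicator_of_mem hz]
          refine le_trans (le_of_eq ?_) (setLIntegral_slice_le hB hBo hF i hc hFc z k)
          have hSm : MeasurableSet {t | insCoord i z t ∈ B} :=
            (hBo.preimage (hcont z)).measurableSet
          rw [← lintegral_indicator hSm]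
          refine lintegral_congr fun t => ?_
          by_cases ht : insCoord i z t ∈ B
          · have hmem : insCoord i z t ∈ B ∩ dropCoord i ⁻¹' V :=
              ⟨ht, by simpa [dropCoord_insCoord] using hz⟩
            rw [indicator_of_mem (show t ∈ {t | insCoord i z t ∈ B} from ht),
              indicator_of_mem hmem]
            simp [hFb, ht]
          · have hmem : insCoord i z t ∉ B ∩ dropCoord i ⁻¹' V := fun h => ht h.1
            rw [indicator_of_notMem (show t ∉ {t | insCoord i z t ∈ B} from ht),
              indicator_of_notMem hmem]
        · rw [indicator_of_notMem hz]
          refine le_of_eq ?_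
          rw [lintegral_eq_zero_iff']
          · refine Eventually.of_forall fun t => indicator_of_notMem (fun h => hz ?_) _
            simpa [dropCoord_insCoord] using h.2
          · exact ((hkF.indicator hm).comp (hcont z).measurable).aemeasurable
    _ = _ := by
        rw [lintegral_indicator hV, setLIntegral_const]
        ring

end Slices


/-! ### Gradient bounds on compact sets. -/

section GradientBound

variable {N : ℕ} {M : Type*} [TopologicalSpace M] [ChartedSpace (Model N) M]
  [IsManifold (𝓡 N) ∞ M] [RiemannianBundle (fun x : M => TangentSpace (𝓡 N) x)]
  [IsContMDiffRiemannianBundle (𝓡 N) ∞ (Model N) (fun x : M => TangentSpace (𝓡 N) x)]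

theorem gradNorm_eq_zero_of_eventually_const {u : M → ℝ} {x : M} {a : ℝ}
    (h : ∀ᶠ z in 𝓝 x, u z = a) : gradNorm (N := N) u x = 0 := by
  refine le_antisymm ((gradNorm_le_iff le_rfl).2 fun v => ?_) (gradNorm_nonneg u x)
  rw [diff_congr (w := fun _ => a) h, diff_const]
  simp

theorem exists_gradNorm_le {u : M → ℝ} (hu : ContMDiff (𝓡 N) 𝓘(ℝ, ℝ) 1 u) {K : Set M}
    (hK : IsCompact K) : ∃ C : ℝ, ∀ x ∈ K, gradNorm (N := N) u x ≤ C := by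
  refine hK.induction_on (p := fun s => ∃ C : ℝ, ∀ x ∈ s, gradNorm (N := N) u x ≤ C)
    ⟨0, by simp⟩ (fun s t hst ⟨C, hC⟩ => ⟨C, fun x hx => hC x (hst hx)⟩) ?_ ?_
  · rintro s t ⟨C, hC⟩ ⟨D, hD⟩
    refine ⟨max C D, fun x hx => ?_⟩
    rcases hx with hx | hx
    · exact (hC x hx).trans (le_max_left _ _)
    · exact (hD x hx).trans (le_max_right _ _)
  · intro x _
    have h := eventually_gradNorm_lt (hu.contMDiffAt (x := x)) (lt_add_one (gradNorm (N := N) u x))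
    exact ⟨_, mem_nhdsWithin_of_mem_nhds h, gradNorm (N := N) u x + 1, fun z hz => le_of_lt hz⟩

theorem exists_gradNorm_le_of_const_off {u : M → ℝ} (hu : ContMDiff (𝓡 N) 𝓘(ℝ, ℝ) 1 u) {K : Set M}
    (hK : IsCompact K) (h0 : ∀ x, x ∉ K → ∃ a, ∀ᶠ z in 𝓝 x, u z = a) :
    ∃ C : ℝ≥0, C ≠ 0 ∧ ∀ x, gradNorm (N := N) u x ≤ C := by
  obtain ⟨C, hC⟩ := exists_gradNorm_le hu hK
  refine ⟨Real.toNNReal (max C 1), ?_, fun x => ?_⟩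
  · simp
  · rw [Real.coe_toNNReal _ (le_max_of_le_right zero_le_one)]
    by_cases hx : x ∈ K
    · exact (hC x hx).trans (le_max_left _ _)
    · obtain ⟨a, ha⟩ := h0 x hx
      rw [gradNorm_eq_zero_of_eventually_const ha]
      positivity

end GradientBound

/-! ### Volume of layers near a regular point. -/

section Layer

variable {n : ℕ} {M : Type*} [EMetricSpace M] [ChartedSpace (Model (n + 1)) M]
  [IsManifold (𝓡 (n + 1)) ∞ M] [RiemannianBundle (fun x : M => TangentSpace (𝓡 (n + 1)) x)]
  [IsContMDiffRiemannianBundle (𝓡 (n + 1)) ∞ (Model (n + 1))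
    (fun x : M => TangentSpace (𝓡 (n + 1)) x)]

/-- Near any point, the coordinates other than the `i`-th extend to a globally Lipschitz map. -/
theorem exists_lipschitz_dropCoord [SigmaCompactSpace M] [IsRiemannianManifold (𝓡 (n + 1)) M]
    (p : M) (i : Fin (n + 1)) {K₀ : Set M}
    (hK₀ : IsCompact K₀) (hK₀p : K₀ ⊆ (extChartAt (𝓡 (n + 1)) p).source) :
    ∃ (L : ℝ≥0) (Q : M → Fin n → ℝ), LipschitzWith L Q ∧
      ∀ x ∈ K₀, Q x = dropCoord i (extChartAt (𝓡 (n + 1)) p x) := by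
  have : LocallyCompactSpace M := ChartedSpace.locallyCompactSpace (Model (n + 1)) M
  obtain ⟨K₁, hK₁, hK₀₁, hK₁p⟩ := exists_compact_between hK₀
    (isOpen_extChartAt_source (I := 𝓡 (n + 1)) p) hK₀p
  -- Multiplied by a cut-off, the coordinates become functions of class `C^1` on all of `M` which
  -- are locally constant off a compact set, so their gradients are bounded.
  obtain ⟨χ, hχ1, hχ0, -⟩ := exists_contMDiffMap_one_nhds_of_subset_interior (n := (⊤ : ℕ∞))
    (𝓡 (n + 1)) hK₀.isClosed hK₀₁
  have hcomp : ∀ j : Fin (n + 1), ∃ L : ℝ≥0, LipschitzWith L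
      fun x => χ x * extChartAt (𝓡 (n + 1)) p x j := by
    intro j
    have h0 : ∀ x, x ∉ K₁ → ∃ a, ∀ᶠ z in 𝓝 x, χ z * extChartAt (𝓡 (n + 1)) p z j = a := by
      intro x hx
      refine ⟨0, ?_⟩
      filter_upwards [hK₁.isClosed.isOpen_compl.mem_nhds hx] with z hz
      rw [hχ0 z hz, zero_mul]
    have hs : ContMDiff (𝓡 (n + 1)) 𝓘(ℝ, ℝ) 1 fun x => χ x * extChartAt (𝓡 (n + 1)) p x j := by
      intro x
      by_cases hx : x ∈ (extChartAt (𝓡 (n + 1)) p).source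
      · have h1 : ContMDiffAt (𝓡 (n + 1)) 𝓘(ℝ, ℝ) 1 (fun x => extChartAt (𝓡 (n + 1)) p x j) x := by
          have hl : ContDiff ℝ 1 fun y : Model (n + 1) => y j := by fun_prop
          exact hl.contMDiff.contMDiffAt.comp x ((contMDiffAt_chart hx).of_le (by simp))
        exact (χ.contMDiff.contMDiffAt.of_le (by simp)).mul h1
      · obtain ⟨a, ha⟩ := h0 x fun h => hx (hK₁p h)
        exact contMDiffAt_const.congr_of_eventuallyEq ha
    obtain ⟨L, hL0, hL⟩ := exists_gradNorm_le_of_const_off hs hK₁ h0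
    exact ⟨L, lipschitzWith_of_gradNorm_le hs hL0 hL⟩
  choose L hL using hcomp
  refine ⟨∑ j, L j, fun x j => χ x * extChartAt (𝓡 (n + 1)) p x (i.succAbove j), ?_, ?_⟩
  · intro x y
    rw [edist_pi_le_iff]
    intro j
    refine (hL (i.succAbove j) x y).trans ?_
    gcongr
    exact Finset.single_le_sum (f := L) (fun _ _ => zero_le) (Finset.mem_univ _)
  · intro x hx
    have := (hχ1.filter_mono (nhds_le_nhdsSet hx)).self_of_nhds
    ext j
    simp [this, dropCoord]

variable [SigmaCompactSpace M] [MeasurableSpace M] [BorelSpace M]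

/-- Near `p` some partial derivative of `f` stays away from zero, so the part of a layer lying over
a set `V` of values of the other `n` coordinates costs at most a constant times the measure of `V`.
An `n`-dimensional null set has null projection to these coordinates, hence is covered by the
preimage of an open `V` of small measure. -/
theorem exists_layer_estimate_succ [IsRiemannianManifold (𝓡 (n + 1)) M] {p : M} {f : M → ℝ}
    {U₀ : Set M} (hU₀ : IsOpen U₀)
    (hp : p ∈ U₀) (hf : ContMDiffOn (𝓡 (n + 1)) 𝓘(ℝ, ℝ) 1 f U₀)
    {v : TangentSpace (𝓡 (n + 1)) p} (hv : diff f p v ≠ 0) :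
    ∃ U ⊆ U₀, IsOpen U ∧ p ∈ U ∧ (∃ C : ℝ≥0, ∀ k : ℝ → ℝ≥0∞, Measurable k →
        ∫⁻ x in U, k (f x) ∂(vol (n + 1) M) ≤ C * ∫⁻ s, k s) ∧
      ∀ S : Set M, μH[(n : ℝ)] S = 0 → ∀ η : ℝ≥0, η ≠ 0 → ∃ O : Set M, IsOpen O ∧ S ∩ U ⊆ O ∧
        ∀ k : ℝ → ℝ≥0∞, Measurable k → ∫⁻ x in O, k (f x) ∂(vol (n + 1) M) ≤ η * ∫⁻ s, k s := by
  classical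
  set φ := extChartAt (𝓡 (n + 1)) p with hφ
  set F : Model (n + 1) → ℝ := f ∘ φ.symm with hF
  have hps : p ∈ φ.source := mem_extChartAt_source p
  have hpt : φ p ∈ φ.target := mem_extChartAt_target p
  have hfp : ContMDiffAt (𝓡 (n + 1)) 𝓘(ℝ, ℝ) 1 f p := hf.contMDiffAt (hU₀.mem_nhds hp)
  set T : Set (Model (n + 1)) := φ.target ∩ φ.symm ⁻¹' U₀ with hT
  have hTo : IsOpen T := (contMDiffOn_chart_symm p).continuousOn.isOpen_inter_preimage
    (isOpen_chart_target p) hU₀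
  have hFs : ContDiffOn ℝ 1 F T := by
    rw [← contMDiffOn_iff_contDiffOn]
    exact hf.comp (((contMDiffOn_chart_symm p).of_le (by simp)).mono inter_subset_left)
      fun y hy => hy.2
  have hpT : φ p ∈ T := ⟨hpt, by rw [mem_preimage, φ.left_inv hps]; exact hp⟩
  obtain ⟨i, hi⟩ : ∃ i, fderiv ℝ F (φ p) (EuclideanSpace.single i 1) ≠ 0 := by
    by_contra! h
    refine hv ?_
    rw [diff_eq_fderiv hps (hfp.mdifferentiableAt (by simp))]
    have : fderiv ℝ F (φ p) = 0 := by
      ext w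
      have hw : w = ∑ i, w i • EuclideanSpace.single i (1 : ℝ) := by
        conv_lhs => rw [← (EuclideanSpace.basisFun (Fin (n + 1)) ℝ).sum_repr w]
        simp
      rw [hw, map_sum]
      simp [h]
    change fderiv ℝ F (φ p) _ = 0
    rw [this]
    simp
  -- Half of the value at `p`, which remains a lower bound on a small ball.
  set c := |fderiv ℝ F (φ p) (EuclideanSpace.single i 1)| / 2 with hc
  have hc0 : 0 < c := by positivity
  have hcont : ContinuousOn (fun y => |fderiv ℝ F y (EuclideanSpace.single i 1)|) T :=
    ((hFs.continuousOn_fderiv_of_isOpen hTo le_rfl).clm_apply continuousOn_const).abs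
  have hev : ∀ᶠ y in 𝓝 (φ p), c < |fderiv ℝ F y (EuclideanSpace.single i 1)| :=
    (hcont.continuousAt (hTo.mem_nhds hpT)).eventually_const_lt
      (by rw [hc]; linarith [abs_pos.2 hi])
  obtain ⟨r, hr, hball⟩ := Metric.nhds_basis_closedBall.mem_iff.1
    (inter_mem (hTo.mem_nhds hpT) hev)
  set B := Metric.ball (φ p) r with hB
  have hBT : B ⊆ T := fun y hy => (hball (Metric.ball_subset_closedBall hy)).1
  obtain ⟨D, hD⟩ := (isCompact_closedBall (φ p) r).exists_bound_of_continuousOn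
    ((contDiffOn_density p).continuousOn.mono fun y hy => (hball hy).1.1)
  have hFd : ∀ y ∈ B, DifferentiableAt ℝ F y := fun y hy =>
    (hFs.differentiableOn (by simp)).differentiableAt (hTo.mem_nhds (hBT hy))
  have hlay := fun V hV k hk => setLIntegral_layer_le (V := V) (k := k) (convex_ball (φ p) r)
    Metric.isOpen_ball hFd i hc0 (fun y hy => (hball (Metric.ball_subset_closedBall hy)).2.le) hV hk
  set U := φ.source ∩ φ ⁻¹' B with hU
  have hUo : IsOpen U := (continuousOn_extChartAt p).isOpen_inter_preimage
    (isOpen_extChartAt_source p) Metric.isOpen_ball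
  have hUU₀ : U ⊆ U₀ := fun x hx => by
    have := (hBT hx.2).2
    rwa [mem_preimage, φ.left_inv hx.1] at this
  set D' : ℝ≥0 := Real.toNNReal D * Real.toNNReal c⁻¹ with hD'
  have key : ∀ V : Set (Fin n → ℝ), MeasurableSet V → ∀ O : Set M, MeasurableSet O → O ⊆ U →
      (∀ x ∈ O, dropCoord i (φ x) ∈ V) → ∀ k : ℝ → ℝ≥0∞, Measurable k →
      ∫⁻ x in O, k (f x) ∂(vol (n + 1) M) ≤ D' * volume V * ∫⁻ s, k s := by
    intro V hV O hO hOU hOV k hk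
    set fb : M → ℝ := U₀.piecewise f 0 with hfb
    have hfbm : Measurable fb := ContinuousOn.measurable_piecewise hf.continuousOn
      continuousOn_const hU₀.measurableSet
    have hg : Measurable (O.indicator fun x => k (fb x)) := (hk.comp hfbm).indicator hO
    have h1 : ∫⁻ x in O, k (f x) ∂(vol (n + 1) M) =
        ∫⁻ x in φ.source, O.indicator (fun x => k (fb x)) x ∂(vol (n + 1) M) := by
      rw [lintegral_indicator hO, Measure.restrict_restrict hO,
        inter_eq_left.2 (hOU.trans inter_subset_left)]
      refine setLIntegral_congr_fun hO fun x hx => ?_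
      simp [hfb, hUU₀ (hOU hx)]
    rw [h1, lintegral_source p hg]
    have hm : MeasurableSet (B ∩ dropCoord i ⁻¹' V) :=
      Metric.isOpen_ball.measurableSet.inter ((continuous_dropCoord i).measurable hV)
    calc _ ≤ ∫⁻ y in φ.target, (B ∩ dropCoord i ⁻¹' V).indicator
          (fun y => ENNReal.ofReal D * k (F y)) y := by
          refine setLIntegral_mono' (isOpen_chart_target p).measurableSet fun y hy => ?_
          by_cases hyO : φ.symm y ∈ O
          · have hyB : y ∈ B := by
              have := (hOU hyO).2
              rwa [mem_preimage, φ.right_inv hy] at this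
            have hyV : dropCoord i y ∈ V := by
              have := hOV _ hyO
              rwa [φ.right_inv hy] at this
            have hmem : y ∈ B ∩ dropCoord i ⁻¹' V := ⟨hyB, hyV⟩
            rw [indicator_of_mem hyO, indicator_of_mem hmem]
            have : fb (φ.symm y) = F y := by simp [hfb, hUU₀ (hOU hyO), hF]
            rw [this]
            gcongr
            exact (le_abs_self _).trans (hD y (Metric.ball_subset_closedBall hyB))
          · rw [indicator_of_notMem hyO, mul_zero]
            exact zero_le
      _ ≤ ∫⁻ y, (B ∩ dropCoord i ⁻¹' V).indicator (fun y => ENNReal.ofReal D * k (F y)) y :=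
          lintegral_mono' Measure.restrict_le_self le_rfl
      _ = ENNReal.ofReal D * ∫⁻ y in B ∩ dropCoord i ⁻¹' V, k (F y) := by
          rw [lintegral_indicator hm, lintegral_const_mul' _ _ ENNReal.ofReal_ne_top]
      _ ≤ ENNReal.ofReal D * (ENNReal.ofReal c⁻¹ * volume V * ∫⁻ s, k s) := by
          gcongr
          exact hlay V hV k hk
      _ = _ := by
          rw [hD', ENNReal.coe_mul, ENNReal.ofReal, ENNReal.ofReal]
          ring
  refine ⟨U, hUU₀, hUo, ⟨hps, Metric.mem_ball_self hr⟩, ?_, ?_⟩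
  · set V₀ := dropCoord i '' Metric.closedBall (φ p) r with hV₀
    have hV₀c : IsCompact V₀ := (isCompact_closedBall _ _).image (continuous_dropCoord i)
    refine ⟨D' * (volume V₀).toNNReal, fun k hk => ?_⟩
    rw [ENNReal.coe_mul, ENNReal.coe_toNNReal hV₀c.measure_lt_top.ne]
    exact key V₀ hV₀c.measurableSet U hUo.measurableSet subset_rfl
      (fun x hx => ⟨_, Metric.ball_subset_closedBall hx.2, rfl⟩) k hk
  · intro S hS η hη
    have hK₀ : IsCompact (φ.symm '' Metric.closedBall (φ p) r) :=
      (isCompact_closedBall _ _).image_of_continuousOn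
        ((contMDiffOn_chart_symm p).continuousOn.mono fun y hy => (hball hy).1.1)
    obtain ⟨L, Q, hQ, hQK⟩ := exists_lipschitz_dropCoord p i hK₀
      (by rintro _ ⟨y, hy, rfl⟩; exact φ.map_target (hball hy).1.1)
    have hQU : ∀ x ∈ U, Q x = dropCoord i (φ x) := fun x hx =>
      hQK x ⟨φ x, Metric.ball_subset_closedBall hx.2, φ.left_inv hx.1⟩
    have hnull : volume (Q '' S) = 0 := by
      have h1 := hQ.hausdorffMeasure_image_le (d := (n : ℝ)) (by positivity) S
      rw [hS, mul_zero] at h1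
      -- With the sup metric of `Fin n → ℝ`, the `n`-dimensional Hausdorff measure is Lebesgue
      -- measure.
      have h2 := hausdorffMeasure_pi_real (ι := Fin n)
      rw [Fintype.card_fin] at h2
      rw [← h2]
      exact le_antisymm h1 zero_le
    -- `D' + 1` instead of `D'` avoids a division by zero.
    obtain ⟨V, hSV, hVo, hV⟩ := (Q '' S).exists_isOpen_lt_of_lt (μ := volume)
      ((η : ℝ≥0∞) / (D' + 1)) (by
        rw [hnull]
        exact ENNReal.div_pos (by simpa using hη) (by finiteness))
    have hOo : IsOpen (U ∩ Q ⁻¹' V) := hUo.inter (hVo.preimage hQ.continuous)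
    refine ⟨U ∩ Q ⁻¹' V, hOo, fun x hx => ⟨hx.2, hSV ⟨x, hx.1, rfl⟩⟩, fun k hk => ?_⟩
    refine (key V hVo.measurableSet _ hOo.measurableSet inter_subset_left
      (fun x hx => by rw [← hQU x hx.1]; exact hx.2) k hk).trans ?_
    gcongr
    calc (D' : ℝ≥0∞) * volume V ≤ (D' + 1) * (η / (D' + 1)) := by
          gcongr
          exact le_self_add
      _ = η := ENNReal.mul_div_cancel (by simp) (by finiteness)

end Layer


section LayerGeneral

variable {N : ℕ} {M : Type*} [EMetricSpace M] [SigmaCompactSpace M] [ChartedSpace (Model N) M]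
  [IsManifold (𝓡 N) ∞ M] [RiemannianBundle (fun x : M => TangentSpace (𝓡 N) x)]
  [IsContMDiffRiemannianBundle (𝓡 N) ∞ (Model N) (fun x : M => TangentSpace (𝓡 N) x)]
  [IsRiemannianManifold (𝓡 N) M] [MeasurableSpace M] [BorelSpace M]

/-- Near a point where `df ≠ 0`, the measure `k(f) dv_g` is bounded by the integral of `k`, with
an arbitrarily small constant near any `(N-1)`-dimensional null set. -/
theorem exists_layer_estimate {p : M} {f : M → ℝ} {U₀ : Set M} (hU₀ : IsOpen U₀)
    (hp : p ∈ U₀) (hf : ContMDiffOn (𝓡 N) 𝓘(ℝ, ℝ) 1 f U₀)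
    {v : TangentSpace (𝓡 N) p} (hv : diff f p v ≠ 0) :
    ∃ U ⊆ U₀, IsOpen U ∧ p ∈ U ∧ (∃ C : ℝ≥0, ∀ k : ℝ → ℝ≥0∞, Measurable k →
        ∫⁻ x in U, k (f x) ∂(vol N M) ≤ C * ∫⁻ s, k s) ∧
      ∀ S : Set M, μH[(N : ℝ) - 1] S = 0 → ∀ η : ℝ≥0, η ≠ 0 → ∃ O : Set M, IsOpen O ∧ S ∩ U ⊆ O ∧
        ∀ k : ℝ → ℝ≥0∞, Measurable k → ∫⁻ x in O, k (f x) ∂(vol N M) ≤ η * ∫⁻ s, k s := by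
  cases N with
  | zero =>
    -- In dimension zero no differential is nonzero.
    refine (hv ?_).elim
    have : v = 0 := Subsingleton.elim (α := Model 0) v 0
    rw [this, map_zero]
  | succ n =>
    rw [Nat.cast_succ, add_sub_cancel_right]
    exact exists_layer_estimate_succ hU₀ hp hf hv

end LayerGeneral

/-! ### One-sidedness of regularized smooth boundaries. -/

section Straighten

variable {E : Type*} [NormedAddCommGroup E] [NormedSpace ℝ E]

/-- `F - ℓ` has zero derivative at `y`. When `ℓ w = 1`, applying `ℓ` to this map gives `F`, so the
inverse function theorem provides coordinates in which `F` is linear. -/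
theorem hasStrictFDerivAt_straighten {F : E → ℝ} {ℓ : E →L[ℝ] ℝ} {y : E}
    (hF : HasStrictFDerivAt F ℓ y) (w : E) :
    HasStrictFDerivAt (fun y => y + (F y - ℓ y) • w)
      ((ContinuousLinearEquiv.refl ℝ E : E ≃L[ℝ] E) : E →L[ℝ] E) y := by
  have h := (hasStrictFDerivAt_id y).add ((hF.sub ℓ.hasStrictFDerivAt).smul_const w)
  refine h.congr_fderiv ?_
  ext z
  simp

end Straighten

section Sides

variable {N : ℕ} {M : Type*} [TopologicalSpace M] [ChartedSpace (Model N) M]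
  [IsManifold (𝓡 N) ∞ M]

/-- A function with nonzero differential at `p` is linear in suitable continuous coordinates. -/
theorem exists_straightening {p : M} {f : M → ℝ} {U₀ : Set M} (hU₀ : IsOpen U₀)
    (hp : p ∈ U₀) (hf : ContMDiffOn (𝓡 N) 𝓘(ℝ, ℝ) ∞ f U₀)
    {v : TangentSpace (𝓡 N) p} (hv : diff f p v ≠ 0) :
    ∃ (Θ : OpenPartialHomeomorph M (Model N)) (ℓ : Model N →L[ℝ] ℝ) (w : Model N),
      p ∈ Θ.source ∧ Θ.source ⊆ U₀ ∧ ℓ w = 1 ∧ ∀ x ∈ Θ.source, ℓ (Θ x) = f x := by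
  set φ := chartAt (Model N) p with hφ
  set F : Model N → ℝ := f ∘ (extChartAt (𝓡 N) p).symm with hF
  have hps : p ∈ (extChartAt (𝓡 N) p).source := mem_extChartAt_source p
  have hfp : ContMDiffAt (𝓡 N) 𝓘(ℝ, ℝ) 1 f p :=
    (hf.contMDiffAt (hU₀.mem_nhds hp)).of_le (by exact_mod_cast le_top)
  have hFd : ContDiffAt ℝ 1 F (φ p) := by
    simpa [hF, hφ] using contDiffAt_comp_chart_symm (n := 1) hps hfp
  obtain ⟨u, hu⟩ : ∃ u, fderiv ℝ F (φ p) u ≠ 0 := by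
    refine ⟨coords p p v, ?_⟩
    rw [diff_eq_fderiv hps (hfp.mdifferentiableAt (by simp))] at hv
    simpa [hF, hφ] using hv
  set ℓ := fderiv ℝ F (φ p) with hℓ
  set w : Model N := (ℓ u)⁻¹ • u with hw
  have hℓw : ℓ w = 1 := by simp [hw, hu]
  set Ψ : Model N → Model N := fun y => y + (F y - ℓ y) • w with hΨ
  have hΨd : HasStrictFDerivAt Ψ ((ContinuousLinearEquiv.refl ℝ (Model N) :
      Model N ≃L[ℝ] Model N) : Model N →L[ℝ] Model N) (φ p) :=
    hasStrictFDerivAt_straighten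
    (hFd.hasStrictFDerivAt (by simp)) w
  set e := hΨd.toOpenPartialHomeomorph Ψ with he
  refine ⟨(φ.trans e).restrOpen U₀ hU₀, ℓ, w, ⟨⟨mem_chart_source _ p, ?_⟩, hp⟩, ?_, hℓw, ?_⟩
  · exact hΨd.mem_toOpenPartialHomeomorph_source
  · exact fun x hx => hx.2
  · intro x hx
    have hx1 : x ∈ φ.source := hx.1.1
    have h1 : ((φ.trans e).restrOpen U₀ hU₀) x = Ψ (φ x) := rfl
    have h2 : F (φ x) = f x := congrArg f (φ.left_inv hx1)
    rw [h1, hΨ]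
    simp [hℓw, h2]

/-- In straightened coordinates a hyperplane cuts a ball into two convex halves and is adherent to
both. -/
theorem exists_halves {p : M} {f : M → ℝ} {U₀ : Set M} (hU₀ : IsOpen U₀)
    (hp : p ∈ U₀) (hf : ContMDiffOn (𝓡 N) 𝓘(ℝ, ℝ) ∞ f U₀)
    {v : TangentSpace (𝓡 N) p} (hv : diff f p v ≠ 0) :
    ∃ U ⊆ U₀, IsOpen U ∧ p ∈ U ∧ IsPreconnected (U ∩ {x | f x < 0}) ∧
      IsPreconnected (U ∩ {x | 0 < f x}) ∧
      ∀ x ∈ U, f x = 0 → x ∈ closure (U ∩ {x | f x < 0}) ∧ x ∈ closure (U ∩ {x | 0 < f x}) := by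
  obtain ⟨Θ, ℓ, w, hpΘ, hΘ, hℓw, hΘf⟩ := exists_straightening hU₀ hp hf hv
  obtain ⟨r, hr, hball⟩ := Metric.nhds_basis_ball.mem_iff.1
    (Θ.open_target.mem_nhds (Θ.map_source hpΘ))
  set B := Metric.ball (Θ p) r with hB
  have hUo : IsOpen (Θ.source ∩ Θ ⁻¹' B) := Θ.isOpen_inter_preimage Metric.isOpen_ball
  have himage : ∀ I : Set ℝ, (Θ.source ∩ Θ ⁻¹' B) ∩ {x | f x ∈ I} =
      Θ.symm '' (B ∩ ℓ ⁻¹' I) := by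
    intro I
    ext x
    constructor
    · rintro ⟨⟨hx, hxB⟩, hxI⟩
      exact ⟨Θ x, ⟨hxB, by rw [mem_preimage, hΘf x hx]; exact hxI⟩, Θ.left_inv hx⟩
    · rintro ⟨y, ⟨hyB, hyI⟩, rfl⟩
      have hy := hball hyB
      refine ⟨⟨Θ.map_target hy, ?_⟩, ?_⟩
      · rwa [mem_preimage, Θ.right_inv hy]
      · change f _ ∈ I
        rwa [← hΘf _ (Θ.map_target hy), Θ.right_inv hy]
  have hpre : ∀ I : Set ℝ, Convex ℝ I →
      IsPreconnected ((Θ.source ∩ Θ ⁻¹' B) ∩ {x | f x ∈ I}) := by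
    intro I hI
    rw [himage]
    have hc : Convex ℝ (B ∩ ℓ ⁻¹' I) := (convex_ball _ _).inter (hI.linear_preimage ℓ.toLinearMap)
    exact hc.isPreconnected.image _ (Θ.continuousOn_symm.mono fun y hy => hball hy.1)
  have hlim : ∀ (I : Set ℝ) (s : ℝ), (∀ t : ℝ, 0 < t → t * s ∈ I) →
      ∀ x ∈ Θ.source ∩ Θ ⁻¹' B, f x = 0 →
        x ∈ closure ((Θ.source ∩ Θ ⁻¹' B) ∩ {x | f x ∈ I}) := by
    intro I s hs x hx hx0
    rw [himage]
    have hpath : Tendsto (fun t : ℝ => Θ x + (t * s) • w) (𝓝[>] 0) (𝓝 (Θ x)) := by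
      have : Continuous fun t : ℝ => Θ x + (t * s) • w := by fun_prop
      simpa using (this.tendsto 0).mono_left nhdsWithin_le_nhds
    have hsymm := (Θ.continuousAt_symm (Θ.map_source hx.1)).tendsto.comp hpath
    rw [Θ.left_inv hx.1] at hsymm
    refine mem_closure_of_tendsto hsymm ?_
    filter_upwards [hpath (Metric.isOpen_ball.mem_nhds hx.2), self_mem_nhdsWithin] with t ht ht0
    refine ⟨_, ⟨ht, ?_⟩, rfl⟩
    simp [hΘf x hx.1, hx0, hℓw]
    exact hs t ht0
  refine ⟨Θ.source ∩ Θ ⁻¹' B, fun x hx => hΘ hx.1, hUo, ⟨hpΘ, Metric.mem_ball_self hr⟩,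
    hpre (Iio 0) (convex_Iio 0), hpre (Ioi 0) (convex_Ioi 0), fun x hx hx0 =>
    ⟨hlim (Iio 0) (-1) (fun t ht => ?_) x hx hx0, hlim (Ioi 0) 1 (fun t ht => ?_) x hx hx0⟩⟩
  · simpa using ht
  · simpa using ht

theorem diff_neg {f : M → ℝ} {p : M} (v : TangentSpace (𝓡 N) p) :
    diff (fun x => -f x) p v = -diff f p v := by
  change mfderiv _ _ (-f) p v = _
  rw [mfderiv_neg]
  rfl

theorem frontier_interior_closure_subset {X : Type*} [TopologicalSpace X] {A : Set X}
    (hA : IsOpen A) : frontier (interior (closure A)) ⊆ frontier A := by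
  intro x hx
  rw [isOpen_interior.frontier_eq] at hx
  rw [hA.frontier_eq]
  exact ⟨closure_minimal interior_subset isClosed_closure hx.1,
    fun h => hx.2 (interior_maximal subset_closure hA h)⟩

/-- The regularization of an open set with smooth boundary lies locally on one side of its
boundary. -/
theorem exists_sides {A : Set M} (hA : IsOpen A) (hS : IsSmoothHypersurface N (frontier A))
    {p : M} (hp : p ∈ frontier (interior (closure A))) :
    ∃ U : Set M, IsOpen U ∧ p ∈ U ∧ ∃ f : M → ℝ, ContMDiffOn (𝓡 N) 𝓘(ℝ, ℝ) ∞ f U ∧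
      (∃ v, diff (N := N) f p v ≠ 0) ∧ ∀ x ∈ U, (x ∈ interior (closure A) ↔ f x < 0) ∧
        (x ∈ frontier (interior (closure A)) ↔ f x = 0) := by
  obtain ⟨U₀, hU₀, hpU₀, f, hf, hfp, hfU⟩ := hS p (frontier_interior_closure_subset hA hp)
  obtain ⟨v, hv⟩ : ∃ v, diff (N := N) f p v ≠ 0 := by
    by_contra! h
    exact hfp (ContinuousLinearMap.ext h)
  have hfr : ∀ x ∈ U₀, x ∈ frontier A ↔ f x = 0 := fun x hx => by
    have := Set.ext_iff.1 hfU x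
    simpa [hx] using this
  obtain ⟨U, hUU₀, hU, hpU, hneg, hpos, hcl⟩ := exists_halves hU₀ hpU₀ hf hv
  -- A connected set that misses the boundary of `A` lies in `A` or in its exterior.
  have hdich : ∀ s : Set M, IsPreconnected s → s ⊆ U → (∀ x ∈ s, f x ≠ 0) →
      s ⊆ A ∨ s ⊆ (closure A)ᶜ := by
    intro s hs hsU hs0
    refine hs.subset_or_subset hA isClosed_closure.isOpen_compl
      (disjoint_compl_right.mono_left subset_closure) fun x hx => ?_
    by_contra h
    rw [mem_union, not_or, mem_compl_iff, not_not] at h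
    refine hs0 x hx ((hfr x (hUU₀ (hsU hx))).1 ?_)
    rw [hA.frontier_eq]
    exact ⟨h.2, h.1⟩
  have hA' : A ⊆ interior (closure A) := interior_maximal subset_closure hA
  -- Stated for a general `g` in order to be applied to `f` or to `-f`, depending on which half lies
  -- in `A`.
  have key : ∀ g : M → ℝ, (∀ x ∈ U, g x = 0 ↔ f x = 0) → U ∩ {x | g x < 0} ⊆ A →
      U ∩ {x | 0 < g x} ⊆ (closure A)ᶜ → (∀ x ∈ U, g x = 0 → x ∈ closure (U ∩ {x | g x < 0}) ∧
        x ∈ closure (U ∩ {x | 0 < g x})) → ∀ x ∈ U, (x ∈ interior (closure A) ↔ g x < 0) ∧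
        (x ∈ frontier (interior (closure A)) ↔ g x = 0) := by
    intro g hgf hn hpo hc x hx
    rcases lt_trichotomy (g x) 0 with h | h | h
    · have : x ∈ interior (closure A) := hA' (hn ⟨hx, h⟩)
      rw [isOpen_interior.frontier_eq]
      simp [this, h, h.ne]
    · have h1 : x ∉ interior (closure A) := by
        intro hxi
        obtain ⟨z, hz, hz'⟩ := mem_closure_iff.1 (hc x hx h).2 _ isOpen_interior hxi
        exact hpo hz' (interior_subset hz)
      have h2 : x ∈ closure (interior (closure A)) :=
        closure_mono (hn.trans hA') (hc x hx h).1
      rw [isOpen_interior.frontier_eq]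
      simp [h1, h, h2]
    · have h0 : x ∉ interior (closure A) := fun hx' => hpo ⟨hx, h⟩ (interior_subset hx')
      have h1 : x ∉ frontier (interior (closure A)) := fun hx' => h.ne'
        ((hgf x hx).2 ((hfr x (hUU₀ hx)).1 (frontier_interior_closure_subset hA hx')))
      simp [h0, h1, h.le, h.ne']
  have hzero : ∀ x ∈ U, f x = 0 → x ∈ closure A ∧ x ∉ A := fun x hx h => by
    have := (hfr x (hUU₀ hx)).2 h
    rwa [hA.frontier_eq] at this
  -- If both halves lie in `A`, then `p` is interior to the closure of `A`: such points are removed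
  -- by the regularization. If both lie in the exterior, then `p` is not in the closure of `A`.
  rcases hdich _ hneg inter_subset_left (fun x hx => hx.2.ne) with hn | hn <;>
    rcases hdich _ hpos inter_subset_left (fun x hx => hx.2.ne') with hpo | hpo
  · refine absurd ?_ (fun h : p ∈ interior (closure A) => (isOpen_interior.frontier_eq.subset hp).2 h)
    refine interior_maximal (fun x hx => ?_) hU hpU
    rcases lt_trichotomy (f x) 0 with h | h | h
    · exact subset_closure (hn ⟨hx, h⟩)
    · exact (hzero x hx h).1
    · exact subset_closure (hpo ⟨hx, h⟩)
  · exact ⟨U, hU, hpU, f, hf.mono hUU₀, ⟨v, hv⟩, key f (fun x _ => Iff.rfl) hn hpo hcl⟩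
  · refine ⟨U, hU, hpU, fun x => -f x, (hf.mono hUU₀).neg, ⟨v, ?_⟩, ?_⟩
    · rw [diff_neg]
      exact neg_ne_zero.2 hv
    · refine key _ (fun x _ => neg_eq_zero) ?_ ?_ ?_
      · simpa using hpo
      · simpa using hn
      · intro x hx h
        simpa [and_comm] using hcl x hx (neg_eq_zero.1 h)
  · have hpA : p ∈ closure A := (frontier_interior_closure_subset hA hp).1
    obtain ⟨z, hzU, hzA⟩ := mem_closure_iff.1 hpA U hU hpU
    rcases lt_trichotomy (f z) 0 with h | h | h
    · exact (hn ⟨hzU, h⟩ (subset_closure hzA)).elim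
    · exact ((hzero z hzU h).2 hzA).elim
    · exact (hpo ⟨hzU, h⟩ (subset_closure hzA)).elim

end Sides


/-! ### Lower semicontinuity of the gradient norm. -/

section GradientLower

variable {N : ℕ} {M : Type*} [TopologicalSpace M] [ChartedSpace (Model N) M]
  [IsManifold (𝓡 N) ∞ M] [RiemannianBundle (fun x : M => TangentSpace (𝓡 N) x)]

theorem exists_lt_diff {u : M → ℝ} {x : M} {b : ℝ} (hb0 : 0 ≤ b) (hb : b < gradNorm (N := N) u x) :
    ∃ v : TangentSpace (𝓡 N) x, ‖v‖ < 1 ∧ b < diff u x v := by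
  by_contra! h
  refine hb.not_ge ((gradNorm_le_iff hb0).2 fun v => ?_)
  have key : ∀ w : TangentSpace (𝓡 N) x, diff u x w ≤ b * ‖w‖ := by
    intro w
    refine le_of_forall_pos_lt_add fun e he => ?_
    -- Slightly more than the norm of `w`, so that `c⁻¹ • w` has norm below one even when `w = 0`;
    -- the total loss `b * (e / (b + 1))` is below `e`.
    set c := ‖w‖ + e / (b + 1) with hc
    have hec : 0 < e / (b + 1) := by positivity
    have hc0 : 0 < c := by positivity
    have h1 := h (c⁻¹ • w) (by
      rw [norm_smul, norm_inv, Real.norm_of_nonneg hc0.le, inv_mul_eq_div, div_lt_one hc0, hc]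
      linarith)
    rw [map_smul, smul_eq_mul, inv_mul_eq_div, div_le_iff₀ hc0] at h1
    refine h1.trans_lt ?_
    have h2 : b * (e / (b + 1)) < e := by
      rw [mul_div_assoc', div_lt_iff₀ (by positivity)]
      nlinarith
    rw [hc]
    linarith
  rw [abs_le]
  constructor
  · have := key (-v)
    rw [map_neg, norm_neg] at this
    linarith
  · exact key v

theorem gradNorm_const_mul {u : M → ℝ} {x : M} (hu : MDifferentiableAt (𝓡 N) 𝓘(ℝ, ℝ) u x) {a : ℝ}
    (ha : 0 < a) : gradNorm (N := N) (fun z => a * u z) x = a * gradNorm (N := N) u x := by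
  refine le_antisymm ((gradNorm_le_iff (mul_nonneg ha.le (gradNorm_nonneg u x))).2 fun v => ?_) ?_
  · rw [diff_const_mul a hu, abs_mul, abs_of_pos ha, mul_assoc]
    gcongr
    exact abs_diff_le u x v
  · rw [mul_comm, ← le_div_iff₀ ha]
    refine (gradNorm_le_iff (div_nonneg (gradNorm_nonneg _ x) ha.le)).2 fun v => ?_
    have := abs_diff_le (fun z => a * u z) x v
    rw [diff_const_mul a hu, abs_mul, abs_of_pos ha] at this
    rw [div_mul_eq_mul_div, le_div_iff₀ ha]
    linarith

variable [IsContMDiffRiemannianBundle (𝓡 N) ∞ (Model N) (fun x : M => TangentSpace (𝓡 N) x)]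

theorem exists_field_lt_diff {u : M → ℝ} {x : M} {U : Set M} (hU : IsOpen U) (hx : x ∈ U)
    (hu : ContMDiffOn (𝓡 N) 𝓘(ℝ, ℝ) 1 u U) {b : ℝ} {v : TangentSpace (𝓡 N) x} {r : ℝ}
    (hv : ‖v‖ < r) (hb : b < diff u x v) :
    ∃ s ∈ 𝓝 x, ∃ X : ∀ x : M, TangentSpace (𝓡 N) x,
      ContMDiffOn (𝓡 N) (𝓡 N).tangent ∞ (fun x => (⟨x, X x⟩ : TangentBundle (𝓡 N) M)) s ∧
      ∀ z ∈ s, ‖X z‖ < r ∧ b < diff u z (X z) := by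
  obtain ⟨s, hs, X, rfl, hX⟩ := exists_local_field v
  obtain ⟨s', hs's, hs'o, hxs'⟩ := mem_nhds_iff.1 (inter_mem hs (hU.mem_nhds hx))
  have hXs' := hX.mono (hs's.trans inter_subset_left)
  have h1 := (continuousOn_norm_field hXs').continuousAt (hs'o.mem_nhds hxs')
  have h2 := (continuousOn_diff_apply hs'o (hu.mono (hs's.trans inter_subset_right))
    hXs'.continuousOn).continuousAt (hs'o.mem_nhds hxs')
  refine ⟨s' ∩ {z | ‖X z‖ < r ∧ b < diff u z (X z)}, ?_, X, hXs'.mono inter_subset_left,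
    fun z hz => hz.2⟩
  filter_upwards [hs'o.mem_nhds hxs', h1.eventually_lt_const hv, h2.eventually_const_lt hb]
    with z hz hz1 hz2 using ⟨hz, hz1, hz2⟩

/-- A vector of norm below one which almost attains the norm of the differential extends to a local
field, and both strict inequalities persist nearby. -/
theorem eventually_lt_gradNorm {u : M → ℝ} {x : M} {U : Set M} (hU : IsOpen U) (hx : x ∈ U)
    (hu : ContMDiffOn (𝓡 N) 𝓘(ℝ, ℝ) 1 u U) {b : ℝ} (hb0 : 0 ≤ b)
    (hb : b < gradNorm (N := N) u x) : ∀ᶠ z in 𝓝 x, b < gradNorm (N := N) u z := by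
  obtain ⟨v, hv, hbv⟩ := exists_lt_diff hb0 hb
  obtain ⟨s, hs, X, -, hX⟩ := exists_field_lt_diff hU hx hu hv hbv
  filter_upwards [hs] with z hz
  obtain ⟨h1, h2⟩ := hX z hz
  have h3 := (le_abs_self _).trans (abs_diff_le u z (X z))
  nlinarith [gradNorm_nonneg (N := N) u z]

end GradientLower

/-! ### Proportionality of defining functions. -/

section Proportional

variable {N : ℕ} {M : Type*} [TopologicalSpace M] [ChartedSpace (Model N) M]
  [IsManifold (𝓡 N) ∞ M]

theorem hasDerivAt_chart_line {u : M → ℝ} {x : M} (hu : ContMDiffAt (𝓡 N) 𝓘(ℝ, ℝ) 1 u x)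
    (v : TangentSpace (𝓡 N) x) :
    HasDerivAt (fun t : ℝ => u ((extChartAt (𝓡 N) x).symm (extChartAt (𝓡 N) x x + t • coords x x v)))
      (diff u x v) 0 := by
  have hx := mem_extChartAt_source (I := 𝓡 N) x
  rw [diff_eq_fderiv hx (hu.mdifferentiableAt (by simp))]
  exact ((contDiffAt_comp_chart_symm (n := 1) hx hu).differentiableAt
    (by simp)).hasFDerivAt.hasLineDerivAt _

/-- Along the coordinate line with velocity `v`, `f` becomes negative at once, hence so does `g`,
and its right difference quotients are nonpositive. -/
theorem diff_nonpos_of_sign {f g : M → ℝ} {x : M} (hf : ContMDiffAt (𝓡 N) 𝓘(ℝ, ℝ) 1 f x)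
    (hg : ContMDiffAt (𝓡 N) 𝓘(ℝ, ℝ) 1 g x) (hfx : f x = 0) (hgx : g x = 0)
    (h : ∀ᶠ z in 𝓝 x, f z < 0 → g z < 0) {v : TangentSpace (𝓡 N) x} (hv : diff f x v < 0) :
    diff g x v ≤ 0 := by
  have hx := mem_extChartAt_source (I := 𝓡 N) x
  set γ : ℝ → M := fun t => (extChartAt (𝓡 N) x).symm (extChartAt (𝓡 N) x x + t • coords x x v)
    with hγ
  have hγ0 : γ 0 = x := by simp [hγ]
  have hcont : Tendsto γ (𝓝[>] 0) (𝓝 x) := by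
    have h1 : Tendsto (fun t : ℝ => extChartAt (𝓡 N) x x + t • coords x x v) (𝓝[>] 0)
        (𝓝 (extChartAt (𝓡 N) x x)) := by
      have : Continuous fun t : ℝ => extChartAt (𝓡 N) x x + t • coords x x v := by fun_prop
      simpa using (this.tendsto 0).mono_left nhdsWithin_le_nhds
    have h2 := (continuousAt_extChartAt_symm (I := 𝓡 N) x).tendsto.comp h1
    rwa [(extChartAt (𝓡 N) x).left_inv hx] at h2
  have hsf := (hasDerivAt_chart_line hf v).tendsto_slope_zero_right
  have hsg := (hasDerivAt_chart_line hg v).tendsto_slope_zero_right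
  refine le_of_tendsto hsg ?_
  filter_upwards [hsf.eventually_lt_const hv, hcont.eventually h, self_mem_nhdsWithin]
    with t ht1 ht2 ht0
  have ht0 : 0 < t := ht0
  change t⁻¹ • (f (γ (0 + t)) - f (γ 0)) < 0 at ht1
  change t⁻¹ • (g (γ (0 + t)) - g (γ 0)) ≤ 0
  rw [zero_add, hγ0, smul_eq_mul] at *
  rw [hfx, sub_zero] at ht1
  rw [hgx, sub_zero]
  have h3 := ht2 (by
    by_contra! h
    exact ht1.not_ge (by positivity))
  exact mul_nonpos_of_nonneg_of_nonpos (by positivity) h3.le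

/-- If `df(v) = 0`, then `r • v - u` decreases `f` for every real `r`, so `r * dg(v) ≤ dg(u)` for
all `r` and `dg(v) = 0`. Thus the kernel of `df` lies in that of `dg`, and the sign of the factor is
read off at `-u`. -/
theorem exists_diff_eq_mul {f g : M → ℝ} {x : M} (hf : ContMDiffAt (𝓡 N) 𝓘(ℝ, ℝ) 1 f x)
    (hg : ContMDiffAt (𝓡 N) 𝓘(ℝ, ℝ) 1 g x) (hfx : f x = 0) (hgx : g x = 0)
    (h : ∀ᶠ z in 𝓝 x, f z < 0 → g z < 0) {u : TangentSpace (𝓡 N) x} (hu : 0 < diff f x u) :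
    ∃ c : ℝ, 0 ≤ c ∧ ∀ v : TangentSpace (𝓡 N) x, diff g x v = c * diff f x v := by
  have key := fun (v : TangentSpace (𝓡 N) x) hv => diff_nonpos_of_sign hf hg hfx hgx h (v := v) hv
  have hker : ∀ v : TangentSpace (𝓡 N) x, diff f x v = 0 → diff g x v = 0 := by
    intro v hv
    have h1 : ∀ r : ℝ, r * diff g x v ≤ diff g x u := by
      intro r
      have := key (r • v - u) (by simp [hv, hu])
      simpa using this
    by_contra hne
    have := h1 ((diff g x u + 1) / diff g x v)
    rw [div_mul_cancel₀ _ hne] at this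
    linarith
  refine ⟨diff g x u / diff f x u, div_nonneg ?_ hu.le, fun v => ?_⟩
  · simpa using key (-u) (by simpa using hu)
  · have := hker (v - (diff f x v / diff f x u) • u) (by simp [hu.ne'])
    rw [map_sub, map_smul, smul_eq_mul, sub_eq_zero] at this
    rw [this]
    ring

end Proportional

/-! ### Global defining functions and transverse fields. -/

section Defining

variable {N : ℕ} {M : Type*} [TopologicalSpace M] [T2Space M] [SigmaCompactSpace M]
  [ChartedSpace (Model N) M]
  [IsManifold (𝓡 N) ∞ M] [RiemannianBundle (fun x : M => TangentSpace (𝓡 N) x)]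
  [IsContMDiffRiemannianBundle (𝓡 N) ∞ (Model N) (fun x : M => TangentSpace (𝓡 N) x)]

variable (N) in
/-- `G` is near each point of its boundary a sublevel set of a smooth function without critical
points. -/
def HasSides (G : Set M) : Prop :=
  ∀ p ∈ frontier G, ∃ U : Set M, IsOpen U ∧ p ∈ U ∧ ∃ f : M → ℝ,
    ContMDiffOn (𝓡 N) 𝓘(ℝ, ℝ) ∞ f U ∧ (∃ v, diff (N := N) f p v ≠ 0) ∧
      ∀ x ∈ U, (x ∈ G ↔ f x < 0) ∧ (x ∈ frontier G ↔ f x = 0)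

/-- At a boundary point the local function is scaled to unit gradient there and restricted to a
neighbourhood inside `K`. Elsewhere the locally constant function `-1` on `G`, `1` off `G` serves,
which gives `|g| = 1` off `K`. -/
theorem exists_local_defining {G K : Set M} (hG : IsOpen G) (hsides : HasSides N G)
    (hK : frontier G ⊆ interior K) {η : ℝ} (hη0 : 0 < η) (hη1 : η < 1) (p : M) :
    ∃ (V : Set M) (g : M → ℝ), IsOpen V ∧ p ∈ V ∧ ContMDiffOn (𝓡 N) 𝓘(ℝ, ℝ) ∞ g V ∧
      ∀ z ∈ V, (z ∈ G ↔ g z < 0) ∧ (z ∈ frontier G ↔ g z = 0) ∧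
        (z ∈ frontier G → 1 - η < gradNorm (N := N) g z ∧ gradNorm (N := N) g z < 1 + η) ∧
        (z ∉ K → |g z| = 1) := by
  classical
  by_cases hp : p ∈ frontier G
  · obtain ⟨U, hU, hpU, f, hf, ⟨v, hv⟩, hfU⟩ := hsides p hp
    have hfp : ContMDiffAt (𝓡 N) 𝓘(ℝ, ℝ) 1 f p :=
      (hf.contMDiffAt (hU.mem_nhds hpU)).of_le (by exact_mod_cast le_top)
    have ha : 0 < gradNorm (N := N) f p := by
      have h1 := abs_diff_le f p v
      have h2 := abs_pos.2 hv
      refine (gradNorm_nonneg f p).lt_of_ne fun h => ?_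
      rw [← h, zero_mul] at h1
      linarith
    set a := (gradNorm (N := N) f p)⁻¹ with haa
    have ha0 : 0 < a := inv_pos.2 ha
    set g : M → ℝ := fun z => a * f z with hg
    have hgs : ContMDiffOn (𝓡 N) 𝓘(ℝ, ℝ) ∞ g U := contMDiffOn_const.mul hf
    have hgs1 : ContMDiffOn (𝓡 N) 𝓘(ℝ, ℝ) 1 g U := hgs.of_le (by exact_mod_cast le_top)
    have hg1 : gradNorm (N := N) g p = 1 := by
      rw [hg, gradNorm_const_mul (hfp.mdifferentiableAt (by simp)) ha0, haa,
        inv_mul_cancel₀ ha.ne']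
    have e1 := eventually_lt_gradNorm hU hpU hgs1 (b := 1 - η) (by linarith) (by linarith)
    have e2 := eventually_gradNorm_lt (hgs1.contMDiffAt (hU.mem_nhds hpU)) (b := 1 + η)
      (by linarith)
    obtain ⟨V, hV, hVo, hpV⟩ := mem_nhds_iff.1 (inter_mem (inter_mem e1 e2)
      (inter_mem (hU.mem_nhds hpU) (isOpen_interior.mem_nhds (hK hp))))
    refine ⟨V, g, hVo, hpV, hgs.mono fun z hz => (hV hz).2.1, fun z hz => ?_⟩
    obtain ⟨⟨h1, h2⟩, h3, h4⟩ := hV hz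
    refine ⟨?_, ?_, fun _ => ⟨h1, h2⟩, fun h => (h (interior_subset h4)).elim⟩
    · rw [(hfU z h3).1, hg]
      simp [mul_neg_iff, ha0, ha0.not_gt]
    · rw [(hfU z h3).2, hg]
      simp [ha0.ne']
  · refine ⟨(frontier G)ᶜ, fun z => if z ∈ G then -1 else 1, isClosed_frontier.isOpen_compl, hp,
      ?_, fun z hz => ⟨?_, ?_, fun h => (hz h).elim, fun _ => ?_⟩⟩
    · refine contMDiffOn_of_locally_contMDiffOn fun z hz => ?_
      by_cases hzG : z ∈ G
      · exact ⟨G, hG, hzG, (contMDiffOn_const (c := (-1 : ℝ))).congr fun y hy => by simp [hy.2]⟩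
      · refine ⟨(closure G)ᶜ, isClosed_closure.isOpen_compl, fun h => hz ⟨h, ?_⟩,
          (contMDiffOn_const (c := (1 : ℝ))).congr fun y hy => ?_⟩
        · rwa [hG.interior_eq]
        · have : y ∉ G := fun h => hy.2 (subset_closure h)
          simp [this]
    · by_cases hzG : z ∈ G <;> simp [hzG]
    · by_cases hzG : z ∈ G <;> simp [hzG] <;> simpa using hz
    · by_cases hzG : z ∈ G <;> simp [hzG]

/-- A set with sides has a global smooth defining function whose gradient has norm close to one
on the boundary. -/
theorem exists_defining {G K : Set M} (hG : IsOpen G) (hsides : HasSides N G)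
    (hK : frontier G ⊆ interior K) {η : ℝ} (hη0 : 0 < η) (hη1 : η < 1) :
    ∃ d : M → ℝ, ContMDiff (𝓡 N) 𝓘(ℝ, ℝ) ∞ d ∧ (∀ z, z ∈ G ↔ d z < 0) ∧
      (∀ z, z ∈ frontier G ↔ d z = 0) ∧ (∀ z, z ∉ K → |d z| = 1) ∧
      ∀ z ∈ frontier G, gradNorm (N := N) d z ≤ 1 + η ∧
        ∃ v : TangentSpace (𝓡 N) z, ‖v‖ < 1 ∧ 1 - 2 * η ≤ diff d z v := by
  choose V g hVo hpV hgs hgV using exists_local_defining hG hsides hK hη0 hη1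
  obtain ⟨ρ, hρ⟩ := SmoothPartitionOfUnity.exists_isSubordinate (𝓡 N) isClosed_univ V hVo
    fun x _ => mem_iUnion.2 ⟨x, hpV x⟩
  have hρV : ∀ i z, ρ i z ≠ 0 → z ∈ V i := fun i z hz => hρ i (subset_closure hz)
  set d : M → ℝ := fun x => ∑ᶠ i, ρ i x • g i x with hd
  -- `d z` is a convex combination of the values of the local functions, so any convex constraint
  -- they share passes to `d`.
  have hmem : ∀ (t : Set ℝ), Convex ℝ t → ∀ z, (∀ i, z ∈ V i → g i z ∈ t) → d z ∈ t :=
    fun t ht z h => ρ.finsum_smul_mem_convex (mem_univ z) (fun i hi => h i (hρV i z hi)) ht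
  have hneg : ∀ z, z ∈ G → d z < 0 := fun z hz =>
    hmem (Iio 0) (convex_Iio 0) z fun i hi => ((hgV i z hi).1.1 hz)
  have hzero : ∀ z, z ∈ frontier G → d z = 0 := fun z hz =>
    hmem {0} (convex_singleton 0) z fun i hi => ((hgV i z hi).2.1.1 hz)
  have hpos : ∀ z, z ∉ G → z ∉ frontier G → 0 < d z := fun z hz hz' =>
    hmem (Ioi 0) (convex_Ioi 0) z fun i hi => by
      obtain ⟨h1, h2, -⟩ := hgV i z hi
      exact lt_of_le_of_ne (not_lt.1 fun h => hz (h1.2 h)) fun h => hz' (h2.2 h.symm)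
  have hGF : ∀ z ∈ frontier G, z ∉ G := fun z hz => by
    rw [hG.frontier_eq] at hz
    exact hz.2
  refine ⟨d, hρ.contMDiff_finsum_smul hVo hgs, fun z => ⟨hneg z, fun h => ?_⟩,
    fun z => ⟨hzero z, fun h => ?_⟩, fun z hz => ?_, fun z hz => ?_⟩
  · by_contra hz
    by_cases hz' : z ∈ frontier G
    · exact h.ne (hzero z hz')
    · exact (hpos z hz hz').not_gt h
  · by_contra hz'
    by_cases hz : z ∈ G
    · exact (hneg z hz).ne h
    · exact (hpos z hz hz').ne' h
  · by_cases hzG : z ∈ G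
    · have : d z ∈ ({-1} : Set ℝ) := hmem _ (convex_singleton _) z fun i hi => by
        obtain ⟨h1, -, -, h4⟩ := hgV i z hi
        rcases eq_or_eq_neg_of_abs_eq (h4 hz) with h | h
        · linarith [h1.1 hzG]
        · exact h
      rw [mem_singleton_iff.1 this]
      simp
    · have : d z ∈ ({1} : Set ℝ) := hmem _ (convex_singleton _) z fun i hi => by
        obtain ⟨h1, -, -, h4⟩ := hgV i z hi
        rcases eq_or_eq_neg_of_abs_eq (h4 hz) with h | h
        · exact h
        · exact (hzG (h1.2 (by linarith))).elim
      rw [mem_singleton_iff.1 this]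
      simp
  · have hgz : ∀ i, z ∈ V i → ContMDiffAt (𝓡 N) 𝓘(ℝ, ℝ) 1 (g i) z := fun i hi =>
      ((hgs i).contMDiffAt ((hVo i).mem_nhds hi)).of_le (by exact_mod_cast le_top)
    have hVt : ∀ i ∈ ρ.fintsupport z, z ∈ V i := fun i hi =>
      hρ i ((ρ.mem_fintsupport_iff z i).1 hi)
    -- On the boundary all the `g i` vanish, so the derivatives of the partition of unity drop out.
    have hdiff : ∀ v : TangentSpace (𝓡 N) z,
        diff d z v = ∑ i ∈ ρ.fintsupport z, ρ i z * diff (g i) z v := by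
      intro v
      have h1 : d =ᶠ[𝓝 z] fun x => ∑ i ∈ ρ.fintsupport z, ρ i x * g i x := by
        filter_upwards [ρ.eventually_finsupport_subset z] with x hx
        rw [hd]
        refine (ρ.sum_finsupport_smul_eq_finsum x g).symm.trans ?_
        refine Finset.sum_subset hx fun i _ hi => ?_
        have : ρ i x = 0 := by simpa using hi
        simp [this]
      have hm : ∀ i ∈ ρ.fintsupport z, MDifferentiableAt (𝓡 N) 𝓘(ℝ, ℝ) (g i) z :=
        fun i hi => (hgz i (hVt i hi)).mdifferentiableAt (by simp)
      have hmρ : ∀ i, MDifferentiableAt (𝓡 N) 𝓘(ℝ, ℝ) (ρ i) z := fun i =>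
        (ρ i).contMDiff.contMDiffAt.mdifferentiableAt (by simp)
      rw [diff_congr h1, diff_sum _ (u := fun i x => ρ i x * g i x)
        fun i hi => (hmρ i).mul (hm i hi)]
      refine Finset.sum_congr rfl fun i hi => ?_
      rw [diff_mul (hmρ i) (hm i hi), (hgV i z (hVt i hi)).2.1.1 hz]
      ring
    have hsum : ∑ i ∈ ρ.fintsupport z, ρ i z = 1 :=
      ρ.sum_finsupport' z (mem_univ z) (ρ.finsupport_subset_fintsupport z)
    constructor
    · refine (gradNorm_le_iff (by linarith)).2 fun v => ?_
      rw [hdiff]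
      calc |∑ i ∈ ρ.fintsupport z, ρ i z * diff (g i) z v|
          ≤ ∑ i ∈ ρ.fintsupport z, |ρ i z * diff (g i) z v| := Finset.abs_sum_le_sum_abs _ _
        _ ≤ ∑ i ∈ ρ.fintsupport z, ρ i z * ((1 + η) * ‖v‖) := by
            refine Finset.sum_le_sum fun i hi => ?_
            rw [abs_mul, abs_of_nonneg (ρ.nonneg i z)]
            refine mul_le_mul_of_nonneg_left ((abs_diff_le (g i) z v).trans ?_) (ρ.nonneg i z)
            exact mul_le_mul_of_nonneg_right ((hgV i z (hVt i hi)).2.2.1 hz).2.le (norm_nonneg v)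
        _ = _ := by rw [← Finset.sum_mul, hsum, one_mul]
    · have hlo : ∀ i, z ∈ V i → 1 - η < gradNorm (N := N) (g i) z := fun i hi =>
        ((hgV i z hi).2.2.1 hz).1
      have hz0 : 0 < gradNorm (N := N) (g z) z := by linarith [hlo z (hpV z)]
      -- A vector almost optimal for the single function `g z` serves for every `g i`: if `dg_i = c
      -- dg_z`, then `dg_i(v) ≥ c (1 - η) |dg_z| ≥ (1 - η) |dg_i| ≥ (1 - η)² ≥ 1 - 2 η`.
      obtain ⟨v, hv, hbv⟩ := exists_lt_diff (u := g z) (x := z)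
        (b := (1 - η) * gradNorm (N := N) (g z) z)
        (mul_nonneg (by linarith) hz0.le) (by nlinarith)
      refine ⟨v, hv, ?_⟩
      have hi : ∀ i ∈ ρ.fintsupport z, 1 - 2 * η ≤ diff (g i) z v := by
        intro i hi
        have hiV := hVt i hi
        obtain ⟨c, hc, hcd⟩ := exists_diff_eq_mul (hgz z (hpV z)) (hgz i hiV)
          ((hgV z z (hpV z)).2.1.1 hz) ((hgV i z hiV).2.1.1 hz)
          (by
            filter_upwards [(hVo z).mem_nhds (hpV z), (hVo i).mem_nhds hiV] with y hy1 hy2 h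
            exact (hgV i y hy2).1.1 ((hgV z y hy1).1.2 h)) (u := v)
          (lt_of_le_of_lt (mul_nonneg (by linarith) hz0.le) hbv)
        have hle : gradNorm (N := N) (g i) z ≤ c * gradNorm (N := N) (g z) z := by
          refine (gradNorm_le_iff (mul_nonneg hc hz0.le)).2 fun w => ?_
          rw [hcd, abs_mul, abs_of_nonneg hc, mul_assoc]
          exact mul_le_mul_of_nonneg_left (abs_diff_le _ _ w) hc
        rw [hcd]
        have h1 := hlo i hiV
        have h2 := mul_le_mul_of_nonneg_left hbv.le hc
        nlinarith
      rw [hdiff]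
      calc 1 - 2 * η = ∑ i ∈ ρ.fintsupport z, ρ i z * (1 - 2 * η) := by
            rw [← Finset.sum_mul, hsum, one_mul]
        _ ≤ _ := Finset.sum_le_sum fun i hi' =>
            mul_le_mul_of_nonneg_left (hi i hi') (ρ.nonneg i z)

/-- A smooth field of norm at most one along which `d` increases at almost unit speed near a
closed set. -/
theorem exists_transverse_field {d : M → ℝ} (hd : ContMDiff (𝓡 N) 𝓘(ℝ, ℝ) ∞ d) {F : Set M}
    (hF : IsClosed F) {b : ℝ}
    (h : ∀ z ∈ F, ∃ v : TangentSpace (𝓡 N) z, ‖v‖ < 1 ∧ b < diff d z v) :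
    ∃ Y : ∀ x : M, TangentSpace (𝓡 N) x,
      ContMDiff (𝓡 N) (𝓡 N).tangent ∞ (fun x => (⟨x, Y x⟩ : TangentBundle (𝓡 N) M)) ∧
      (∀ x, ‖Y x‖ ≤ 1) ∧ ∀ x ∈ F, b ≤ diff d x (Y x) := by
  have hd1 : ContMDiff (𝓡 N) 𝓘(ℝ, ℝ) 1 d := hd.of_le (by exact_mod_cast le_top)
  have h1 : IsManifold (𝓡 N) 1 M := .of_le (n := ∞) (by simp)
  -- Both constraints are convex in each fibre, so local fields satisfying them can be glued; off
  -- `F` a field which vanishes at the point will do.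
  set t : ∀ x : M, Set (TangentSpace (𝓡 N) x) := fun x => {v | ‖v‖ ≤ 1 ∧ (x ∈ F → b ≤ diff d x v)}
    with ht
  have hconv : ∀ x, Convex ℝ (t x) := by
    intro x v hv w hw r s hr hs hrs
    refine ⟨?_, fun hx => ?_⟩
    · refine (norm_add_le _ _).trans ?_
      rw [norm_smul, norm_smul, Real.norm_of_nonneg hr, Real.norm_of_nonneg hs]
      nlinarith [hv.1, hw.1]
    · rw [map_add, map_smul, map_smul, smul_eq_mul, smul_eq_mul]
      have e : b = r * b + s * b := by rw [← add_mul, hrs, one_mul]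
      rw [e]
      exact add_le_add (mul_le_mul_of_nonneg_left (hv.2 hx) hr)
        (mul_le_mul_of_nonneg_left (hw.2 hx) hs)
  have hloc : ∀ x : M, ∃ U ∈ 𝓝 x, ∃ X : ∀ x : M, TangentSpace (𝓡 N) x,
      ContMDiffOn (𝓡 N) (𝓡 N).tangent ∞ (fun x => (⟨x, X x⟩ : TangentBundle (𝓡 N) M)) U ∧
      ∀ y ∈ U, X y ∈ t y := by
    intro x
    by_cases hx : x ∈ F
    · obtain ⟨v, hv, hbv⟩ := h x hx
      obtain ⟨s, hs, X, hX, hXs⟩ := exists_field_lt_diff isOpen_univ (mem_univ x)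
        hd1.contMDiffOn hv hbv
      exact ⟨s, hs, X, hX, fun z hz => ⟨(hXs z hz).1.le, fun _ => (hXs z hz).2.le⟩⟩
    · obtain ⟨s, hs, X, hX0, hX⟩ := exists_local_field (0 : TangentSpace (𝓡 N) x)
      obtain ⟨s', hs's, hs'o, hxs'⟩ := mem_nhds_iff.1 hs
      have hn := (continuousOn_norm_field (hX.mono hs's)).continuousAt (hs'o.mem_nhds hxs')
      have hev : ∀ᶠ z in 𝓝 x, ‖X z‖ < 1 := hn.eventually_lt_const (by simp [hX0])
      refine ⟨s' ∩ ({z | ‖X z‖ < 1} ∩ Fᶜ), inter_mem (hs'o.mem_nhds hxs')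
        (inter_mem hev (hF.isOpen_compl.mem_nhds hx)), X,
        hX.mono (inter_subset_left.trans hs's), fun z hz => ⟨hz.2.1.le, fun hzF => (hz.2.2 hzF).elim⟩⟩
  obtain ⟨Y, hY⟩ := exists_contMDiffSection_forall_mem_convex_of_local (n := (⊤ : ℕ∞)) (𝓡 N)
    (F_fiber := Model N) (fun x : M => TangentSpace (𝓡 N) x)
    t hconv hloc
  exact ⟨Y, Y.contMDiff, fun x => (hY x).1, fun x => (hY x).2⟩

end Defining


/-! ### Null boundaries and layers near compact sets. -/

section NullBoundary

variable {N : ℕ} {M : Type*} [EMetricSpace M] [SigmaCompactSpace M] [ChartedSpace (Model N) M]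
  [IsManifold (𝓡 N) ∞ M] [RiemannianBundle (fun x : M => TangentSpace (𝓡 N) x)]
  [IsContMDiffRiemannianBundle (𝓡 N) ∞ (Model N) (fun x : M => TangentSpace (𝓡 N) x)]
  [IsRiemannianManifold (𝓡 N) M] [MeasurableSpace M] [BorelSpace M]

/-- This is the layer estimate with `k` the indicator of `{0}`, whose integral vanishes. -/
theorem vol_hypersurface_eq_zero {S : Set M} (hSc : IsCompact S) (hS : IsSmoothHypersurface N S) :
    vol N M S = 0 := by
  refine hSc.measure_zero_of_nhdsWithin fun p hp => ?_
  obtain ⟨U₀, hU₀, hpU₀, f, hf, hfp, hfU⟩ := hS p hp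
  obtain ⟨v, hv⟩ : ∃ v, diff (N := N) f p v ≠ 0 := by
    by_contra! h
    exact hfp (ContinuousLinearMap.ext h)
  obtain ⟨U, hUU₀, hU, hpU, ⟨C, hC⟩, -⟩ := exists_layer_estimate hU₀ hpU₀
    (hf.of_le (by exact_mod_cast le_top)) hv
  refine ⟨S ∩ U, inter_mem self_mem_nhdsWithin (mem_nhdsWithin_of_mem_nhds (hU.mem_nhds hpU)), ?_⟩
  have h1 := hC (indicator {0} 1) (measurable_one.indicator (measurableSet_singleton 0))
  have h2 : ∫⁻ s : ℝ, indicator {0} 1 s = 0 := by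
    rw [lintegral_indicator_one (measurableSet_singleton 0)]
    simp
  rw [h2, mul_zero] at h1
  refine le_antisymm (le_trans ?_ h1) zero_le
  have hm : MeasurableSet (S ∩ U) := hSc.isClosed.measurableSet.inter hU.measurableSet
  calc vol N M (S ∩ U) = ∫⁻ x in S ∩ U, 1 ∂(vol N M) := by simp
    _ ≤ ∫⁻ x in S ∩ U, indicator {0} 1 (f x) ∂(vol N M) := by
        refine setLIntegral_mono' hm fun x hx => ?_
        have : f x = 0 := by
          have hx' : x ∈ S ∩ U₀ := ⟨hx.1, hUU₀ hx.2⟩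
          rw [hfU] at hx'
          exact hx'.2
        simp [this]
    _ ≤ _ := lintegral_mono_set inter_subset_right

theorem ae_eq_interior_closure {A : Set M} (hA : IsOpen A) (hc : IsCompact (frontier A))
    (hS : IsSmoothHypersurface N (frontier A)) :
    A =ᵐ[vol N M] (interior (closure A) : Set M) := by
  refine EventuallyLE.antisymm
    (Eventually.of_forall fun x hx => interior_maximal subset_closure hA hx) ?_
  have h0 : ∀ᵐ x ∂(vol N M), x ∉ frontier A :=
    measure_eq_zero_iff_ae_notMem.1 (vol_hypersurface_eq_zero hc hS)
  filter_upwards [h0] with x hx hx'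
  by_contra hxA
  rw [hA.frontier_eq] at hx
  exact hx ⟨interior_subset hx', hxA⟩

/-- Compactness: under finite unions the constants `C` add up, and the small constant `η` is shared
in halves. -/
theorem exists_layer_nhd {d : M → ℝ} (hd : ContMDiff (𝓡 N) 𝓘(ℝ, ℝ) 1 d) {F : Set M}
    (hF : IsCompact F) (h : ∀ p ∈ F, ∃ v, diff (N := N) d p v ≠ 0) :
    ∃ U : Set M, IsOpen U ∧ F ⊆ U ∧ (∃ C : ℝ≥0, ∀ k : ℝ → ℝ≥0∞, Measurable k →
        ∫⁻ x in U, k (d x) ∂(vol N M) ≤ C * ∫⁻ s, k s) ∧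
      ∀ S : Set M, μH[(N : ℝ) - 1] S = 0 → ∀ η : ℝ≥0, η ≠ 0 → ∃ O : Set M, IsOpen O ∧ S ∩ U ⊆ O ∧
        ∀ k : ℝ → ℝ≥0∞, Measurable k → ∫⁻ x in O, k (d x) ∂(vol N M) ≤ η * ∫⁻ s, k s := by
  refine hF.induction_on (p := fun F => ∃ U : Set M, IsOpen U ∧ F ⊆ U ∧
      (∃ C : ℝ≥0, ∀ k : ℝ → ℝ≥0∞, Measurable k →
        ∫⁻ x in U, k (d x) ∂(vol N M) ≤ C * ∫⁻ s, k s) ∧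
      ∀ S : Set M, μH[(N : ℝ) - 1] S = 0 → ∀ η : ℝ≥0, η ≠ 0 → ∃ O : Set M, IsOpen O ∧ S ∩ U ⊆ O ∧
        ∀ k : ℝ → ℝ≥0∞, Measurable k → ∫⁻ x in O, k (d x) ∂(vol N M) ≤ η * ∫⁻ s, k s) ?_ ?_ ?_ ?_
  · exact ⟨∅, isOpen_empty, subset_rfl, ⟨0, by simp⟩, fun S _ η _ => ⟨∅, isOpen_empty, by simp, by simp⟩⟩
  · rintro s t hst ⟨U, hU, htU, h⟩
    exact ⟨U, hU, hst.trans htU, h⟩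
  · rintro s t ⟨U, hU, hsU, ⟨C, hC⟩, h⟩ ⟨U', hU', htU', ⟨C', hC'⟩, h'⟩
    refine ⟨U ∪ U', hU.union hU', union_subset_union hsU htU', ⟨C + C', fun k hk => ?_⟩,
      fun S hS η hη => ?_⟩
    · rw [ENNReal.coe_add, add_mul]
      exact (lintegral_union_le _ _ _).trans (add_le_add (hC k hk) (hC' k hk))
    · obtain ⟨O, hO, hSO, hOk⟩ := h S hS (η / 2) (by simpa using hη)
      obtain ⟨O', hO', hSO', hOk'⟩ := h' S hS (η / 2) (by simpa using hη)
      refine ⟨O ∪ O', hO.union hO', ?_, fun k hk => ?_⟩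
      · rw [inter_union_distrib_left]
        exact union_subset_union hSO hSO'
      · refine (lintegral_union_le _ _ _).trans ((add_le_add (hOk k hk) (hOk' k hk)).trans ?_)
        rw [← add_mul, ← ENNReal.coe_add, add_halves]
  · intro p hp
    obtain ⟨v, hv⟩ := h p hp
    obtain ⟨U, -, hU, hpU, h⟩ := exists_layer_estimate isOpen_univ (mem_univ p) hd.contMDiffOn hv
    exact ⟨U, mem_nhdsWithin_of_mem_nhds (hU.mem_nhds hpU), U, hU, subset_rfl, h⟩

end NullBoundary

/-- `|d|` has a positive minimum on the compact set `K \ U` and equals one off `K`. -/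
theorem exists_tube {X : Type*} [TopologicalSpace X] {d : X → ℝ} (hd : Continuous d) {K U : Set X}
    (hK : IsCompact K) (hdK : ∀ z, z ∉ K → |d z| = 1) (hU : IsOpen U)
    (h0 : ∀ z, d z = 0 → z ∈ U) : ∃ τ : ℝ, 0 < τ ∧ τ < 1 ∧ ∀ z, |d z| ≤ τ → z ∈ U := by
  obtain ⟨m, hm, hmK⟩ : ∃ m : ℝ, 0 < m ∧ ∀ z ∈ K \ U, m ≤ |d z| := by
    rcases (K \ U).eq_empty_or_nonempty with h | h
    · exact ⟨1, one_pos, by simp [h]⟩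
    · obtain ⟨z₀, hz₀, hmin⟩ := (hK.diff hU).exists_isMinOn h hd.abs.continuousOn
      exact ⟨|d z₀|, abs_pos.2 fun h => hz₀.2 (h0 _ h), fun z hz => hmin hz⟩
  refine ⟨min (m / 2) (1 / 2), by positivity, (min_le_right _ _).trans_lt (by norm_num),
    fun z hz => ?_⟩
  by_contra hzU
  by_cases hzK : z ∈ K
  · linarith [hmK z ⟨hzK, hzU⟩, min_le_left (m / 2) (1 / 2)]
  · linarith [hdK z hzK, min_le_right (m / 2) (1 / 2)]

/-! ### Tails of a density supported in `[-τ, τ]`. -/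

section Tail

variable {k : ℝ → ℝ} {τ : ℝ}

theorem hasDerivAt_tail (hk : Continuous k) (t : ℝ) :
    HasDerivAt (fun t => ∫ s in t..τ, k s) (-k t) t :=
  intervalIntegral.integral_hasDerivAt_left (hk.intervalIntegrable _ _)
    hk.aestronglyMeasurable.stronglyMeasurableAtFilter hk.continuousAt

theorem contDiff_tail (hk : Continuous k) : ContDiff ℝ 1 fun t => ∫ s in t..τ, k s := by
  rw [contDiff_one_iff_deriv]
  refine ⟨fun t => (hasDerivAt_tail hk t).differentiableAt, ?_⟩
  have : deriv (fun t => ∫ s in t..τ, k s) = fun t => -k t :=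
    funext fun t => (hasDerivAt_tail hk t).deriv
  rw [this]
  exact hk.neg

theorem tail_eq_zero (hkτ : ∀ t, τ < |t| → k t = 0) {t : ℝ} (ht0 : 0 ≤ τ) (ht : τ ≤ t) :
    ∫ s in t..τ, k s = 0 := by
  rw [intervalIntegral.integral_symm, intervalIntegral.integral_of_le ht, neg_eq_zero]
  refine setIntegral_eq_zero_of_forall_eq_zero fun s hs => hkτ s ?_
  rw [abs_of_nonneg (ht0.trans hs.1.le)]
  exact hs.1

theorem tail_eq_total (hk : Continuous k) (hkτ : ∀ t, τ < |t| → k t = 0) (hτ : 0 ≤ τ) {t : ℝ}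
    (ht : t ≤ -τ) : ∫ s in t..τ, k s = ∫ s in (-τ)..τ, k s := by
  rw [← intervalIntegral.integral_add_adjacent_intervals (hk.intervalIntegrable t (-τ))
    (hk.intervalIntegrable (-τ) τ), add_eq_right, intervalIntegral.integral_of_le ht,
    ← integral_Ico_eq_integral_Ioc]
  refine setIntegral_eq_zero_of_forall_eq_zero fun s hs => hkτ s ?_
  have : s < 0 := by linarith [hs.2]
  rw [abs_of_neg this]
  linarith [hs.2]

theorem tail_mem_Icc (hk : Continuous k) (hk0 : ∀ t, 0 ≤ k t) (hkτ : ∀ t, τ < |t| → k t = 0)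
    (hτ : 0 ≤ τ) (t : ℝ) : ∫ s in t..τ, k s ∈ Icc 0 (∫ s in (-τ)..τ, k s) := by
  have hm : 0 ≤ ∫ s in (-τ)..τ, k s :=
    intervalIntegral.integral_nonneg (by linarith) fun s _ => hk0 s
  rcases le_total t τ with ht | ht
  · refine ⟨intervalIntegral.integral_nonneg ht fun s _ => hk0 s, ?_⟩
    rcases le_total t (-τ) with ht' | ht'
    · exact (tail_eq_total hk hkτ hτ ht').le
    · exact intervalIntegral.integral_mono_interval ht' ht le_rfl
        (Eventually.of_forall hk0) (hk.intervalIntegrable _ _)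
  · rw [tail_eq_zero hkτ hτ ht]
    exact ⟨le_rfl, hm⟩

theorem lintegral_eq_ofReal_intervalIntegral (hk : Continuous k) (hk0 : ∀ t, 0 ≤ k t)
    (hkτ : ∀ t, τ < |t| → k t = 0) (hτ : 0 ≤ τ) :
    ∫⁻ s, ENNReal.ofReal (k s) = ENNReal.ofReal (∫ s in (-τ)..τ, k s) := by
  rw [intervalIntegral.integral_of_le (by linarith), ← integral_Icc_eq_integral_Ioc,
    ofReal_integral_eq_lintegral_ofReal (hk.continuousOn.integrableOn_compact isCompact_Icc)
    (Eventually.of_forall hk0), ← lintegral_indicator measurableSet_Icc]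
  refine lintegral_congr fun s => ?_
  by_cases hs : s ∈ Icc (-τ) τ
  · rw [indicator_of_mem hs]
  · rw [indicator_of_notMem hs, hkτ s, ENNReal.ofReal_zero]
    rw [mem_Icc, ← abs_le] at hs
    exact not_le.1 hs

end Tail

/-! ### Integration by parts across a layer. -/

section LayerByParts

variable {N : ℕ} {M : Type*} [TopologicalSpace M] [T2Space M] [SigmaCompactSpace M]
  [ChartedSpace (Model N) M]
  [IsManifold (𝓡 N) ∞ M] [RiemannianBundle (fun x : M => TangentSpace (𝓡 N) x)]
  [IsContMDiffRiemannianBundle (𝓡 N) ∞ (Model N) (fun x : M => TangentSpace (𝓡 N) x)]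
  [MeasurableSpace M] [BorelSpace M]

theorem continuous_layer_integrand {d : M → ℝ} (hd : ContMDiff (𝓡 N) 𝓘(ℝ, ℝ) 1 d) {k : ℝ → ℝ}
    (hk : Continuous k) {X : ∀ x : M, TangentSpace (𝓡 N) x}
    (hX : ContMDiff (𝓡 N) (𝓡 N).tangent ∞ (fun x => (⟨x, X x⟩ : TangentBundle (𝓡 N) M))) :
    Continuous fun x => k (d x) * diff d x (X x) :=
  (hk.comp hd.continuous).mul (continuous_diff_apply hd hX.continuous)

theorem integrable_layer_integrand {d : M → ℝ} (hd : ContMDiff (𝓡 N) 𝓘(ℝ, ℝ) 1 d) {k : ℝ → ℝ}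
    (hk : Continuous k) {X : ∀ x : M, TangentSpace (𝓡 N) x}
    (hX : ContMDiff (𝓡 N) (𝓡 N).tangent ∞ (fun x => (⟨x, X x⟩ : TangentBundle (𝓡 N) M)))
    (hXc : IsCompact (closure {x | X x ≠ 0})) :
    Integrable (fun x => k (d x) * diff d x (X x)) (vol N M) := by
  refine (continuous_layer_integrand hd hk hX).integrable_of_hasCompactSupport
    (HasCompactSupport.of_support_subset_isCompact hXc fun x hx => subset_closure fun h => hx ?_)
  change k (d x) * diff d x (X x) = 0
  rw [show X x = 0 from h, map_zero, mul_zero]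

theorem integrable_divergence {X : ∀ x : M, TangentSpace (𝓡 N) x}
    (hX : ContMDiff (𝓡 N) (𝓡 N).tangent ∞ (fun x => (⟨x, X x⟩ : TangentBundle (𝓡 N) M)))
    (hXc : IsCompact (closure {x | X x ≠ 0})) : Integrable (divergence X) (vol N M) := by
  refine (continuous_divergence hX).integrable_of_hasCompactSupport
    (HasCompactSupport.of_support_subset_isCompact hXc fun x hx => ?_)
  by_contra h
  exact hx (divergence_eq_zero h)

/-- Integration by parts of `k(d) d d(X)`, the primitive of `k` being close to a multiple of the
indicator of `{d < 0}`. -/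
theorem integral_layer_le {d : M → ℝ} (hd : ContMDiff (𝓡 N) 𝓘(ℝ, ℝ) 1 d) {k : ℝ → ℝ} {τ : ℝ}
    (hk : Continuous k) (hk0 : ∀ t, 0 ≤ k t) (hkτ : ∀ t, τ < |t| → k t = 0) (hτ : 0 < τ)
    {X : ∀ x : M, TangentSpace (𝓡 N) x}
    (hX : ContMDiff (𝓡 N) (𝓡 N).tangent ∞ (fun x => (⟨x, X x⟩ : TangentBundle (𝓡 N) M)))
    (hXc : IsCompact (closure {x | X x ≠ 0})) {B : ℝ} (hB0 : 0 ≤ B)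
    (hB : ∀ x, |divergence X x| ≤ B) (hT : vol N M {x | |d x| ≤ τ} ≠ ⊤) :
    ∫ x, k (d x) * diff d x (X x) ∂(vol N M) ≤
      (∫ s in (-τ)..τ, k s) *
        (∫ x in {x | d x < 0}, divergence X x ∂(vol N M) +
          B * (vol N M).real {x | |d x| ≤ τ}) := by
  set m := ∫ s in (-τ)..τ, k s with hm
  set ψ : M → ℝ := fun x => ∫ s in (d x)..τ, k s with hψ
  have hm0 : 0 ≤ m := intervalIntegral.integral_nonneg (by linarith) fun s _ => hk0 s
  have hψs : ContMDiff (𝓡 N) 𝓘(ℝ, ℝ) 1 ψ := (contDiff_tail hk).contMDiff.comp hd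
  -- The tail has derivative `-k`, so this converts the layer integral into the integral of `ψ div
  -- X`.
  have hibp := integral_mul_divergence hX hXc hψs
  have hdψ : ∀ x, diff ψ x (X x) = -(k (d x) * diff d x (X x)) := fun x => by
    rw [hψ, diff_comp (hasDerivAt_tail hk (d x)) (hd.mdifferentiableAt (by simp))]
    ring
  simp_rw [hdψ, integral_neg, neg_neg] at hibp
  rw [← hibp]
  have hdivi := integrable_divergence hX hXc
  have hTm : MeasurableSet {x | |d x| ≤ τ} :=
    (isClosed_le hd.continuous.abs continuous_const).measurableSet
  have hGm : MeasurableSet {x | d x < 0} :=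
    (isOpen_lt hd.continuous continuous_const).measurableSet
  have hψi : Integrable (fun x => ψ x * divergence X x) (vol N M) := by
    refine (hψs.continuous.mul (continuous_divergence hX)).integrable_of_hasCompactSupport
      (HasCompactSupport.of_support_subset_isCompact hXc fun x hx => ?_)
    by_contra h
    refine hx ?_
    change ψ x * divergence X x = 0
    rw [divergence_eq_zero h, mul_zero]
  rw [mul_add, ← integral_const_mul, ← sub_le_iff_le_add', ← integral_indicator hGm,
    ← integral_sub hψi ((hdivi.const_mul m).indicator hGm)]
  -- `ψ` and `m` times the indicator of `{d < 0}` agree off the layer, and on the layer both lie in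
  -- `[0, m]`.
  calc ∫ x, (ψ x * divergence X x - {x | d x < 0}.indicator (fun x => m * divergence X x) x)
        ∂(vol N M)
      ≤ ∫ x, {x | |d x| ≤ τ}.indicator (fun _ => m * B) x ∂(vol N M) := by
        refine integral_mono (hψi.sub ((hdivi.const_mul m).indicator hGm))
          ((integrableOn_const hT).integrable_indicator hTm) fun x => ?_
        have hmem : ψ x ∈ Icc 0 m := tail_mem_Icc hk hk0 hkτ hτ.le (d x)
        have hdx := abs_le.1 (hB x)
        by_cases hxT : |d x| ≤ τ
        · rw [indicator_of_mem (show x ∈ {x | |d x| ≤ τ} from hxT)]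
          by_cases hxG : d x < 0
          · rw [indicator_of_mem (show x ∈ {x | d x < 0} from hxG)]
            nlinarith [mul_nonneg (sub_nonneg.2 hmem.2) (by linarith : 0 ≤ B + divergence X x),
              mul_nonneg hmem.1 hB0]
          · rw [indicator_of_notMem (show x ∉ {x | d x < 0} from hxG)]
            nlinarith [mul_nonneg hmem.1 (by linarith : 0 ≤ B - divergence X x),
              mul_nonneg (sub_nonneg.2 hmem.2) hB0]
        · rw [indicator_of_notMem (show x ∉ {x | |d x| ≤ τ} from hxT)]
          rcases lt_abs.1 (not_le.1 hxT) with h | h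
          · have h0 : ψ x = 0 := tail_eq_zero hkτ hτ.le h.le
            rw [indicator_of_notMem (show x ∉ {x | d x < 0} from fun h' => by
              have : d x < 0 := h'
              linarith), h0]
            simp
          · have h0 : ψ x = m := tail_eq_total hk hkτ hτ.le (by linarith)
            rw [indicator_of_mem (show x ∈ {x | d x < 0} from by
              change d x < 0
              linarith), h0]
            simp
    _ = m * (B * (vol N M).real {x | |d x| ≤ τ}) := by
        rw [integral_indicator hTm, setIntegral_const, smul_eq_mul]
        ring

end LayerByParts


/-! ### Layers and the perimeter. -/

section LayerData

variable {N : ℕ} {M : Type*} [EMetricSpace M] [SigmaCompactSpace M] [ChartedSpace (Model N) M]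
  [IsManifold (𝓡 N) ∞ M] [RiemannianBundle (fun x : M => TangentSpace (𝓡 N) x)]
  [IsContMDiffRiemannianBundle (𝓡 N) ∞ (Model N) (fun x : M => TangentSpace (𝓡 N) x)]
  [IsRiemannianManifold (𝓡 N) M] [MeasurableSpace M] [BorelSpace M]

theorem ofReal_setIntegral_divergence_le_perimeter {A G Ω : Set M} (hA : IsOpen A)
    (hAG : G =ᵐ[vol N M] A) {X : ∀ x : M, TangentSpace (𝓡 N) x} (hX : IsTestField Ω X) :
    ENNReal.ofReal (∫ x in G, divergence X x ∂(vol N M)) ≤ perimeter N A Ω := by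
  have h1 : ∫ x in G, divergence X x ∂(vol N M) =
      ∫ x in Ω, A.indicator (fun x => divergence X x) x ∂(vol N M) := by
    rw [setIntegral_indicator hA.measurableSet, setIntegral_congr_set hAG]
    refine setIntegral_eq_of_subset_of_forall_sdiff_eq_zero hA.measurableSet inter_subset_right
      fun x hx => divergence_eq_zero fun h => hx.2 ⟨hX.support_subset h, hx.1⟩
  rw [h1, perimeter]
  exact le_iSup₂_of_le X hX le_rfl

/-- The layers of `d` have bounded measure density on `Ω`, with a constant controlled by the
flux of a test field along which `d` increases. -/
theorem setLIntegral_layer_le_of_field {d : M → ℝ} (hd : ContMDiff (𝓡 N) 𝓘(ℝ, ℝ) 1 d)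
    {A Ω O : Set M} (hA : IsOpen A) (hΩ : IsOpen Ω)
    (hdA : {x | d x < 0} =ᵐ[vol N M] A) (hO : IsOpen O) {τ b η B : ℝ} (hτ : 0 < τ) (hb : 0 < b)
    (hη : 0 ≤ η)
    (hOk : ∀ k : ℝ → ℝ≥0∞, Measurable k →
      ∫⁻ x in O, k (d x) ∂(vol N M) ≤ ENNReal.ofReal η * ∫⁻ s, k s)
    {X : ∀ x : M, TangentSpace (𝓡 N) x} (hX : IsTestField Ω X) (hB0 : 0 ≤ B)
    (hB : ∀ x, |divergence X x| ≤ B) (hT : vol N M {x | |d x| ≤ τ} ≠ ⊤)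
    (hBτ : B * (vol N M).real {x | |d x| ≤ τ} ≤ η)
    (hXd0 : ∀ x, |d x| ≤ τ → 0 ≤ diff d x (X x))
    (hXd : ∀ x ∈ Ω \ O, |d x| ≤ τ → b ≤ diff d x (X x)) (hP : perimeter N A Ω ≠ ⊤)
    {k : ℝ → ℝ} (hk : Continuous k) (hk0 : ∀ t, 0 ≤ k t) (hkτ : ∀ t, τ < |t| → k t = 0) :
    ∫⁻ x in Ω, ENNReal.ofReal (k (d x)) ∂(vol N M) ≤
      ENNReal.ofReal (η + ((perimeter N A Ω).toReal + η) / b) * ∫⁻ s, ENNReal.ofReal (k s) := by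
  set P := (perimeter N A Ω).toReal with hPdef
  have hP0 : 0 ≤ P := ENNReal.toReal_nonneg
  rw [lintegral_eq_ofReal_intervalIntegral hk hk0 hkτ hτ.le]
  set m := ∫ s in (-τ)..τ, k s with hm
  have hm0 : 0 ≤ m := intervalIntegral.integral_nonneg (by linarith) fun s _ => hk0 s
  have hflux : ∫ x in {x | d x < 0}, divergence X x ∂(vol N M) ≤ P :=
    (ENNReal.ofReal_le_iff_le_toReal hP).1 (ofReal_setIntegral_divergence_le_perimeter hA hdA hX)
  have hI : ∫ x, k (d x) * diff d x (X x) ∂(vol N M) ≤ m * (P + η) :=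
    (integral_layer_le hd hk hk0 hkτ hτ hX.smooth hX.compact_support hB0 hB hT).trans
      (mul_le_mul_of_nonneg_left (by linarith) hm0)
  have hnn : ∀ x, 0 ≤ k (d x) * diff d x (X x) := fun x => by
    by_cases hx : |d x| ≤ τ
    · exact mul_nonneg (hk0 _) (hXd0 x hx)
    · rw [hkτ _ (not_le.1 hx), zero_mul]
  have h1 : ∫⁻ x in O, ENNReal.ofReal (k (d x)) ∂(vol N M) ≤
      ENNReal.ofReal η * ENNReal.ofReal m := by
    rw [← lintegral_eq_ofReal_intervalIntegral hk hk0 hkτ hτ.le]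
    exact hOk (fun s => ENNReal.ofReal (k s)) hk.measurable.ennreal_ofReal
  -- Off `O` the field has speed at least `b`, so `k(d) ≤ b⁻¹ k(d) dd(X)`. The right side is
  -- nonnegative everywhere, so its integral may be extended to `M`, where the flux bound holds.
  have h2 : ∫⁻ x in Ω \ O, ENNReal.ofReal (k (d x)) ∂(vol N M) ≤
      ENNReal.ofReal (b⁻¹ * (m * (P + η))) := by
    calc ∫⁻ x in Ω \ O, ENNReal.ofReal (k (d x)) ∂(vol N M)
        ≤ ∫⁻ x in Ω \ O, ENNReal.ofReal (b⁻¹ * (k (d x) * diff d x (X x))) ∂(vol N M) := by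
          refine setLIntegral_mono' (hΩ.measurableSet.diff hO.measurableSet) fun x hx => ?_
          refine ENNReal.ofReal_le_ofReal ?_
          by_cases hxτ : |d x| ≤ τ
          · rw [inv_mul_eq_div, le_div_iff₀ hb]
            exact mul_le_mul_of_nonneg_left (hXd x hx hxτ) (hk0 _)
          · rw [hkτ _ (not_le.1 hxτ)]
            simp
      _ ≤ ∫⁻ x, ENNReal.ofReal (b⁻¹ * (k (d x) * diff d x (X x))) ∂(vol N M) :=
          lintegral_mono' Measure.restrict_le_self le_rfl
      _ = ENNReal.ofReal (∫ x, b⁻¹ * (k (d x) * diff d x (X x)) ∂(vol N M)) := by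
          rw [ofReal_integral_eq_lintegral_ofReal]
          · exact (integrable_layer_integrand hd hk hX.smooth hX.compact_support).const_mul _
          · exact Eventually.of_forall fun x => mul_nonneg (by positivity) (hnn x)
      _ ≤ _ := by
          rw [integral_const_mul]
          gcongr
  calc ∫⁻ x in Ω, ENNReal.ofReal (k (d x)) ∂(vol N M)
      ≤ ∫⁻ x in O ∪ Ω \ O, ENNReal.ofReal (k (d x)) ∂(vol N M) :=
        lintegral_mono_set (by rw [union_sdiff_self]; exact subset_union_right)
    _ ≤ ENNReal.ofReal η * ENNReal.ofReal m + ENNReal.ofReal (b⁻¹ * (m * (P + η))) :=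
        (lintegral_union_le _ _ _).trans (add_le_add h1 h2)
    _ = _ := by
        rw [← ENNReal.ofReal_mul hη, ← ENNReal.ofReal_add (by positivity) (by positivity),
          ← ENNReal.ofReal_mul (by positivity)]
        congr 1
        field_simp

/-- A smooth function whose sublevel set is `A` up to a null set, with gradient bounded by almost
one on its thin layers, the measure of which is controlled by the perimeter of `A`. -/
theorem exists_layer_data {A Ω : Set M} (hA : IsOpen A) (hΩ : IsOpen Ω)
    (hAc : IsCompact (frontier A)) (hAs : IsSmoothHypersurface N (frontier A))
    (hAΩ : μH[(N : ℝ) - 1] (frontier A ∩ frontier Ω) = 0)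
    {η : ℝ} (hη : 0 < η) (hη1 : 8 * η < 1) :
    ∃ (d : M → ℝ) (K : Set M) (τ : ℝ) (C D : ℝ≥0), ContMDiff (𝓡 N) 𝓘(ℝ, ℝ) ∞ d ∧ IsCompact K ∧
      (∀ z, z ∉ K → |d z| = 1) ∧ {x | d x < 0} =ᵐ[vol N M] A ∧ 0 < τ ∧ τ < 1 ∧
      (∀ z, |d z| ≤ τ → gradNorm (N := N) d z ≤ 1 + 2 * η) ∧
      (∀ k : ℝ → ℝ≥0∞, Measurable k → (∀ t, τ < |t| → k t = 0) →
        ∫⁻ x, k (d x) ∂(vol N M) ≤ C * ∫⁻ s, k s) ∧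
      (perimeter N A Ω ≠ ⊤ →
        (D : ℝ) ≤ η + ((perimeter N A Ω).toReal + η) / (1 - 4 * η)) ∧
      ∀ k : ℝ → ℝ, Continuous k → (∀ t, 0 ≤ k t) → (∀ t, τ < |t| → k t = 0) →
        ∫⁻ x in Ω, ENNReal.ofReal (k (d x)) ∂(vol N M) ≤ D * ∫⁻ s, ENNReal.ofReal (k s) := by
  have : LocallyCompactSpace M := ChartedSpace.locallyCompactSpace (Model N) M
  set G := interior (closure A) with hG
  set F := frontier G with hF
  have hFA : F ⊆ frontier A := frontier_interior_closure_subset hA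
  have hFc : IsCompact F := hAc.of_isClosed_subset isClosed_frontier hFA
  have hsides : HasSides N G := fun p hp => exists_sides hA hAs hp
  obtain ⟨K, hK, hFK⟩ := exists_compact_superset hFc
  obtain ⟨d, hd, hdG, hdF, hdK, hdgrad⟩ := exists_defining isOpen_interior hsides hFK hη
    (by linarith : η < 1)
  have hd1 : ContMDiff (𝓡 N) 𝓘(ℝ, ℝ) 1 d := hd.of_le (by exact_mod_cast le_top)
  obtain ⟨U, hU, hFU, ⟨C, hC⟩, hnull⟩ := exists_layer_nhd hd1 hFc fun p hp => by
    obtain ⟨-, v, -, hv⟩ := hdgrad p hp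
    exact ⟨v, by linarith⟩
  obtain ⟨Y, hY, hY1, hYd⟩ := exists_transverse_field hd hFc.isClosed (b := 1 - 3 * η)
    fun z hz => by
      obtain ⟨-, v, hv, hvd⟩ := hdgrad z hz
      exact ⟨v, hv, by linarith⟩
  -- `O` absorbs the common part of the two boundaries at the price of a layer density `η`; what
  -- remains of `F` in the closure of `Ω` is a compact subset of `Ω`, so there is space for a
  -- cut-off.
  obtain ⟨O, hO, hSO, hOk⟩ := hnull _ hAΩ η.toNNReal (by simpa using hη)
  set K₁ := (F ∩ closure Ω) \ O with hK₁
  have hK₁c : IsCompact K₁ := (hFc.inter_right isClosed_closure).diff hO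
  have hK₁Ω : K₁ ⊆ Ω := by
    rintro x ⟨⟨hxF, hxΩ⟩, hxO⟩
    by_contra h
    refine hxO (hSO ⟨⟨hFA hxF, ?_⟩, hFU hxF⟩)
    rw [hΩ.frontier_eq]
    exact ⟨hxΩ, h⟩
  obtain ⟨K₂, hK₂, hK₁₂, hK₂Ω⟩ := exists_compact_between hK₁c hΩ hK₁Ω
  obtain ⟨χ, hχ1, hχ0, hχ⟩ := exists_contMDiffMap_one_nhds_of_subset_interior (n := (⊤ : ℕ∞))
    (𝓡 N) hK₁c.isClosed hK₁₂
  set X : ∀ x : M, TangentSpace (𝓡 N) x := fun x => χ x • Y x with hXdef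
  have hXsupp : closure {x | X x ≠ 0} ⊆ K₂ := closure_minimal (fun x hx => by
    by_contra h
    refine hx ?_
    simp [hXdef, hχ0 x h]) hK₂.isClosed
  have hXt : IsTestField Ω X := {
    smooth := χ.contMDiff.smul_section hY
    compact_support := hK₂.of_isClosed_subset isClosed_closure hXsupp
    support_subset := hXsupp.trans hK₂Ω
    norm_le_one := fun x => by
      rw [hXdef, norm_smul, Real.norm_of_nonneg (hχ x).1]
      nlinarith [(hχ x).1, (hχ x).2, hY1 x, norm_nonneg (Y x)] }
  obtain ⟨B, hB⟩ := (continuous_divergence hXt.smooth).bounded_above_of_compact_support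
    (HasCompactSupport.of_support_subset_isCompact hXt.compact_support fun x hx => by
      by_contra h
      exact hx (divergence_eq_zero h))
  have hYdc : Continuous fun x => diff d x (Y x) := continuous_diff_apply hd1 hY.continuous
  -- All open conditions wanted on the thin layer. The last one says that the cut-off equals one,
  -- unless the point lies in `O` or away from `Ω`.
  set V : Set M := U ∩ interior {z | gradNorm (N := N) d z < 1 + 2 * η} ∩
    {z | 1 - 4 * η < diff d z (Y z)} ∩ (interior {z | χ z = 1} ∪ O ∪ (closure Ω)ᶜ) with hV
  have hVo : IsOpen V := ((hU.inter isOpen_interior).inter (isOpen_lt continuous_const hYdc)).inter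
    ((isOpen_interior.union hO).union isClosed_closure.isOpen_compl)
  have hFV : F ⊆ V := by
    intro x hx
    refine ⟨⟨⟨hFU hx, ?_⟩, ?_⟩, ?_⟩
    · rw [mem_interior_iff_mem_nhds]
      exact eventually_gradNorm_lt hd1.contMDiffAt (by linarith [(hdgrad x hx).1])
    · change 1 - 4 * η < _
      linarith [hYd x hx]
    · by_cases hxO : x ∈ O
      · exact Or.inl (Or.inr hxO)
      by_cases hxΩ : x ∈ closure Ω
      · refine Or.inl (Or.inl ?_)
        rw [mem_interior_iff_mem_nhds]
        have hxK₁ : x ∈ K₁ := ⟨⟨hx, hxΩ⟩, hxO⟩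
        exact hχ1.filter_mono (nhds_le_nhdsSet hxK₁)
      · exact Or.inr hxΩ
  obtain ⟨τ₀, hτ₀, hτ₀1, htube⟩ := exists_tube hd.continuous hK hdK hVo
    fun z hz => hFV ((hdF z).2 hz)
  set B' := max B 0 with hB'
  -- The layer has volume at most `2 C τ`, so the second bound makes `B'` times that volume at most
  -- `η`; the summand `1` keeps the quotient defined when `C` or `B'` is zero.
  set τ := min τ₀ (η / (2 * C * B' + 1)) with hτ
  have hB'0 : 0 ≤ B' := le_max_right _ _
  have hτ0 : 0 < τ := by positivity
  have hττ₀ : τ ≤ τ₀ := min_le_left _ _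
  have htubeτ : ∀ z, |d z| ≤ τ → z ∈ V := fun z hz => htube z (hz.trans hττ₀)
  have hCk : ∀ k : ℝ → ℝ≥0∞, Measurable k → (∀ t, τ < |t| → k t = 0) →
      ∫⁻ x, k (d x) ∂(vol N M) ≤ C * ∫⁻ s, k s := by
    intro k hk hkτ
    refine le_trans (le_of_eq ?_) (hC k hk)
    rw [← lintegral_indicator hU.measurableSet]
    refine lintegral_congr fun x => ?_
    by_cases hx : x ∈ U
    · rw [indicator_of_mem hx]
    · rw [indicator_of_notMem hx, hkτ]
      by_contra h
      exact hx (htubeτ x (not_lt.1 h)).1.1.1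
  have hdA : {x | d x < 0} =ᵐ[vol N M] A := by
    have : {x | d x < 0} = G := Set.ext fun x => (hdG x).symm
    rw [this]
    exact (ae_eq_interior_closure hA hAc hAs).symm
  have hvol : vol N M {x | |d x| ≤ τ} ≤ ENNReal.ofReal (2 * C * τ) := by
    have h1 := hCk (indicator (Icc (-τ) τ) 1) (measurable_one.indicator measurableSet_Icc)
      fun t ht => indicator_of_notMem
        (fun h : t ∈ Icc (-τ) τ => ht.not_ge (abs_le.2 ⟨h.1, h.2⟩)) _
    rw [lintegral_indicator_one measurableSet_Icc, Real.volume_Icc] at h1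
    have h2 : ∫⁻ x, indicator (Icc (-τ) τ) 1 (d x) ∂(vol N M) = vol N M {x | |d x| ≤ τ} := by
      rw [← lintegral_indicator_one
        (isClosed_le hd.continuous.abs continuous_const).measurableSet]
      refine lintegral_congr fun x => ?_
      simp [indicator, abs_le]
    rw [h2] at h1
    refine h1.trans (le_of_eq ?_)
    rw [← ENNReal.ofReal_coe_nnreal, ← ENNReal.ofReal_mul (NNReal.coe_nonneg C)]
    congr 1
    ring
  have hT : vol N M {x | |d x| ≤ τ} ≠ ⊤ := ne_top_of_le_ne_top ENNReal.ofReal_ne_top hvol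
  have hBτ : B' * (vol N M).real {x | |d x| ≤ τ} ≤ η := by
    have h1 : (vol N M).real {x | |d x| ≤ τ} ≤ 2 * C * τ :=
      ENNReal.toReal_le_of_le_ofReal (by positivity) hvol
    have h2 : τ * (2 * C * B' + 1) ≤ η := by
      rw [← le_div_iff₀ (by positivity)]
      exact min_le_right _ _
    nlinarith [mul_le_mul_of_nonneg_left h1 hB'0]
  have hgrad : ∀ z, |d z| ≤ τ → gradNorm (N := N) d z ≤ 1 + 2 * η := fun z hz => by
    have h : z ∈ {z | gradNorm (N := N) d z < 1 + 2 * η} := interior_subset (htubeτ z hz).1.1.2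
    exact le_of_lt h
  have hYτ : ∀ z, |d z| ≤ τ → 1 - 4 * η < diff d z (Y z) := fun z hz => (htubeτ z hz).1.2
  have hXdiff : ∀ z, diff d z (X z) = χ z * diff d z (Y z) := fun z => by
    rw [hXdef, map_smul, smul_eq_mul]
  by_cases hP : perimeter N A Ω = ⊤
  -- With infinite perimeter any finite density will do, and the crude constant `C` is available.
  · refine ⟨d, K, τ, C, C, hd, hK, hdK, hdA, hτ0, hττ₀.trans_lt hτ₀1, hgrad, hCk,
      fun h => (h hP).elim, fun k hk _ hkτ => ?_⟩
    exact (lintegral_mono' Measure.restrict_le_self le_rfl).trans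
      (hCk (fun s => ENNReal.ofReal (k s)) hk.measurable.ennreal_ofReal
        fun t ht => by simp [hkτ t ht])
  · have hD0 : 0 ≤ η + ((perimeter N A Ω).toReal + η) / (1 - 4 * η) := by
      have : 0 < 1 - 4 * η := by linarith
      positivity
    refine ⟨d, K, τ, C, (η + ((perimeter N A Ω).toReal + η) / (1 - 4 * η)).toNNReal, hd, hK, hdK,
      hdA, hτ0, hττ₀.trans_lt hτ₀1, hgrad, hCk, fun _ => ?_, fun k hk hk0 hkτ => ?_⟩
    · rw [Real.coe_toNNReal _ hD0]
    · refine setLIntegral_layer_le_of_field hd1 hA hΩ hdA hO hτ0 (by linarith) hη.le hOk hXt hB'0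
        (fun x => (hB x).trans (le_max_left _ _)) hT hBτ (fun x hx => ?_) (fun x hx hxτ => ?_) hP
        hk hk0 hkτ
      · rw [hXdiff]
        exact mul_nonneg (hχ x).1 (by linarith [hYτ x hx])
      · have h1 : χ x = 1 := by
          rcases (htubeτ x hxτ).2 with (h | h) | h
          · have h' : x ∈ {z | χ z = 1} := interior_subset h
            exact h'
          · exact (hx.2 h).elim
          · exact (h (subset_closure hx.1)).elim
        rw [hXdiff, h1, one_mul]
        exact (hYτ x hxτ).le

end LayerData


/-! ### The one-dimensional profile. -/

section Profile

variable {p : ℝ → ℝ}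

/-- The solution of `Q' = p(Q)`, `Q(0) = a`, for a positive, bounded, continuous `p`. -/
theorem exists_autonomous_solution (hp : Continuous p) (hp0 : ∀ s, 0 < p s) {B : ℝ}
    (hB : ∀ s, p s ≤ B) (a : ℝ) :
    ∃ Q : ℝ → ℝ, Q 0 = a ∧ StrictMono Q ∧ Function.Surjective Q ∧
      ∀ t, HasDerivAt Q (p (Q t)) t := by
  have hi : Continuous fun s => (p s)⁻¹ := hp.inv₀ fun s => (hp0 s).ne'
  -- Separation of variables: `Q` is the inverse of `Φ`, which is onto because its slope is at least
  -- `B⁻¹`.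
  set Φ : ℝ → ℝ := fun s => ∫ r in a..s, (p r)⁻¹ with hΦ
  have hΦd : ∀ s, HasDerivAt Φ (p s)⁻¹ s := fun s =>
    intervalIntegral.integral_hasDerivAt_right (hi.intervalIntegrable _ _)
      hi.aestronglyMeasurable.stronglyMeasurableAtFilter hi.continuousAt
  have hmono : StrictMono Φ := strictMono_of_deriv_pos fun s => by
    rw [(hΦd s).deriv]
    exact inv_pos.2 (hp0 s)
  have hB0 : 0 < B := (hp0 0).trans_le (hB 0)
  have hgrow : ∀ x y, x ≤ y → B⁻¹ * (y - x) ≤ Φ y - Φ x := fun x y hxy =>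
    mul_sub_le_image_sub_of_le_deriv (fun s => (hΦd s).differentiableAt) (fun s => by
      rw [(hΦd s).deriv]
      exact inv_anti₀ (hp0 s) (hB s)) hxy
  have hcont : Continuous Φ := continuous_iff_continuousAt.2 fun s => (hΦd s).continuousAt
  have hΦa : Φ a = 0 := intervalIntegral.integral_same
  have hsurj : Function.Surjective Φ := by
    refine hcont.surjective ?_ ?_
    · refine tendsto_atTop_mono' _ (f₁ := fun s => B⁻¹ * (s - a)) ?_ ?_
      · filter_upwards [eventually_ge_atTop a] with s hs
        simpa [hΦa] using hgrow a s hs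
      · exact (tendsto_atTop_add_const_right _ (-a) tendsto_id).const_mul_atTop (by positivity)
    · refine tendsto_atBot_mono' _ (f₁ := fun s => B⁻¹ * (s - a)) ?_ ?_
      · filter_upwards [eventually_le_atBot a] with s hs
        have := hgrow s a hs
        rw [hΦa] at this
        linarith
      · exact (tendsto_atBot_add_const_right _ (-a) tendsto_id).const_mul_atBot (by positivity)
  set e := hmono.orderIsoOfSurjective Φ hsurj with he
  have heΦ : ∀ t, Φ (e.symm t) = t := fun t => e.apply_symm_apply t
  refine ⟨e.symm, ?_, e.symm.strictMono, e.symm.surjective, fun t => ?_⟩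
  · exact hmono.injective ((heΦ 0).trans hΦa.symm)
  · have := HasDerivAt.of_local_left_inverse (f := Φ) (g := e.symm) (a := t)
      e.symm.continuous.continuousAt (hΦd _) (inv_pos.2 (hp0 _)).ne' (Eventually.of_forall heΦ)
    simpa using this

/-- A Lipschitz transition from `α` to `β` in finite time, almost optimal for the energy
`∫ Q'² / 2 + W(Q)`. -/
theorem exists_profile {W : ℝ → ℝ} (hW : Continuous W) (hW0 : ∀ s, 0 ≤ W s) {α β : ℝ}
    (hαβ : α < β) (hα : W α = 0) (hβ : W β = 0) {δ : ℝ} (hδ : 0 < δ) :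
    ∃ (Q k : ℝ → ℝ) (T : ℝ) (L : ℝ≥0), 0 < T ∧ LipschitzWith L Q ∧ (∀ t, Q t ∈ Icc α β) ∧
      (∀ t ≤ 0, Q t = α) ∧ (∀ t, T ≤ t → Q t = β) ∧ Continuous k ∧ (∀ t, 0 ≤ k t) ∧
      (∀ t, T + 1 < |t| → k t = 0) ∧
      (∀ t, t ≠ 0 → t ≠ T → ∃ q, HasDerivAt Q q t ∧ q ^ 2 / 2 + W (Q t) ≤ k t ∧
        (t < 0 ∨ T < t → q = 0)) ∧
      ∫⁻ s, ENNReal.ofReal (k s) ≤ ENNReal.ofReal ((∫ s in α..β, √(2 * W s)) + δ) := by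
  have hαβ' : 0 < β - α := sub_pos.2 hαβ
  -- The total excess will be `(β - α) e + 2 e²`, which is at most `δ` since `e ≤ 1`.
  set e := min 1 (δ / (β - α + 2)) with he
  have he0 : 0 < e := by positivity
  have he1 : e ≤ 1 := min_le_left _ _
  have heδ : e * (β - α + 2) ≤ δ := by
    rw [← le_div_iff₀ (by positivity)]
    exact min_le_right _ _
  -- Freezing `W` outside `[α, β]` makes the speed `p` bounded, and equal to `e` there.
  set V : ℝ → ℝ := fun s => W (max α (min β s)) with hV
  have hVc : Continuous V := hW.comp (by fun_prop)
  have hVW : ∀ s ∈ Icc α β, V s = W s := fun s hs => by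
    simp only [hV]
    rw [min_eq_right hs.2, max_eq_right hs.1]
  have hVα : ∀ s ≤ α, V s = 0 := fun s hs => by
    simp only [hV]
    rw [min_eq_right (hs.trans hαβ.le), max_eq_left hs, hα]
  have hVβ : ∀ s, β ≤ s → V s = 0 := fun s hs => by
    simp only [hV]
    rw [min_eq_left hs, max_eq_right hαβ.le, hβ]
  have hV0 : ∀ s, 0 ≤ V s := fun s => hW0 _
  obtain ⟨m, hm⟩ := isCompact_Icc.exists_bound_of_continuousOn (s := Icc α β) hW.continuousOn
  have hVm : ∀ s, V s ≤ m := fun s => (le_abs_self _).trans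
    (hm _ ⟨le_max_left _ _, max_le hαβ.le (min_le_left _ _)⟩)
  -- The optimal speed `√(2 W)` vanishes at the wells; the term `e ^ 2` makes the transition time
  -- finite.
  set p : ℝ → ℝ := fun s => √(e ^ 2 + 2 * V s) with hp
  have hpsq : ∀ s, p s ^ 2 = e ^ 2 + 2 * V s := fun s =>
    Real.sq_sqrt (by have := hV0 s; positivity)
  have hp0 : ∀ s, 0 < p s := fun s => Real.sqrt_pos.2 (by have := hV0 s; positivity)
  have hpc : Continuous p := by fun_prop
  obtain ⟨Q₀, hQ₀0, hQ₀m, hQ₀s, hQ₀d⟩ := exists_autonomous_solution hpc hp0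
    (B := √(e ^ 2 + 2 * m)) (fun s => Real.sqrt_le_sqrt (by linarith [hVm s])) α
  have hQ₀c : Continuous Q₀ := continuous_iff_continuousAt.2 fun t => (hQ₀d t).continuousAt
  obtain ⟨T, hT⟩ := hQ₀s β
  have hT0 : 0 < T := hQ₀m.lt_iff_lt.1 (by rwa [hQ₀0, hT])
  set Q : ℝ → ℝ := fun t => max α (min β (Q₀ t)) with hQ
  have hQ0 : ∀ t ≤ 0, Q t = α := fun t ht => by
    have : Q₀ t ≤ α := hQ₀0 ▸ hQ₀m.monotone ht
    simp only [hQ]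
    rw [min_eq_right (this.trans hαβ.le), max_eq_left this]
  have hQT : ∀ t, T ≤ t → Q t = β := fun t ht => by
    have : β ≤ Q₀ t := hT ▸ hQ₀m.monotone ht
    simp only [hQ]
    rw [min_eq_left this, max_eq_right hαβ.le]
  -- A trapezoid equal to one on `[0, T]`, which keeps `k` continuous; each unit ramp costs at most
  -- `e ^ 2`.
  set χ : ℝ → ℝ := fun t => max 0 (min 1 (min (1 + t) (T + 1 - t))) with hχ
  have hχ0 : ∀ t, 0 ≤ χ t := fun t => le_max_left _ _
  have hχ1 : ∀ t, χ t ≤ 1 := fun t => max_le zero_le_one (min_le_left _ _)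
  set k : ℝ → ℝ := fun t => p (Q₀ t) ^ 2 * χ t with hk
  have hk0 : ∀ t, 0 ≤ k t := fun t => mul_nonneg (sq_nonneg _) (hχ0 t)
  have hkp : ∀ t, k t ≤ p (Q₀ t) ^ 2 := fun t => mul_le_of_le_one_right (sq_nonneg _) (hχ1 t)
  have hkc : Continuous k := by fun_prop
  have hksupp : ∀ t, t ∉ Icc (-1) (T + 1) → k t = 0 := fun t ht => by
    have : χ t = 0 := by
      rw [mem_Icc, not_and_or, not_le, not_le] at ht
      refine max_eq_left ?_
      rcases ht with h | h
      · exact (min_le_right _ _).trans ((min_le_left _ _).trans (by linarith))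
      · exact (min_le_right _ _).trans ((min_le_right _ _).trans (by linarith))
    simp only [hk, this, mul_zero]
  have hLip : LipschitzWith (Real.toNNReal (√(e ^ 2 + 2 * m))) Q := by
    have h1 : LipschitzWith (Real.toNNReal (√(e ^ 2 + 2 * m))) Q₀ := by
      refine lipschitzWith_of_nnnorm_deriv_le (fun t => (hQ₀d t).differentiableAt) fun t => ?_
      rw [(hQ₀d t).deriv, ← NNReal.coe_le_coe, coe_nnnorm, Real.norm_of_nonneg (hp0 _).le,
        Real.coe_toNNReal _ (Real.sqrt_nonneg _)]
      exact Real.sqrt_le_sqrt (by linarith [hVm (Q₀ t)])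
    exact (h1.const_min β).const_max α
  refine ⟨Q, k, T, _, hT0, hLip, fun t => ⟨le_max_left _ _, max_le hαβ.le (min_le_left _ _)⟩,
    hQ0, hQT, hkc, hk0, fun t ht => hksupp t fun h => ?_, fun t ht0 htT => ?_, ?_⟩
  · refine ht.not_ge (abs_le.2 ⟨?_, h.2⟩)
    linarith [h.1]
  · rcases ht0.lt_or_gt with h0 | h0
    · refine ⟨0, ?_, ?_, fun _ => rfl⟩
      · refine (hasDerivAt_const t α).congr_of_eventuallyEq ?_
        filter_upwards [Iio_mem_nhds h0] with r hr using hQ0 r hr.le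
      · rw [hQ0 t h0.le, hα]
        simpa using hk0 t
    rcases htT.lt_or_gt with h1 | h1
    · refine ⟨p (Q₀ t), ?_, ?_, fun h => ?_⟩
      · refine (hQ₀d t).congr_of_eventuallyEq ?_
        filter_upwards [Ioo_mem_nhds h0 h1] with r hr
        have h2 : α ≤ Q₀ r := hQ₀0 ▸ hQ₀m.monotone hr.1.le
        have h3 : Q₀ r ≤ β := hT ▸ hQ₀m.monotone hr.2.le
        simp only [hQ]
        rw [min_eq_right h3, max_eq_right h2]
      · have h2 : α ≤ Q₀ t := hQ₀0 ▸ hQ₀m.monotone h0.le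
        have h3 : Q₀ t ≤ β := hT ▸ hQ₀m.monotone h1.le
        have hQt : Q t = Q₀ t := by
          simp only [hQ]
          rw [min_eq_right h3, max_eq_right h2]
        have hχt : χ t = 1 := by
          simp only [hχ]
          rw [min_eq_left (le_min (by linarith) (by linarith)), max_eq_right zero_le_one]
        rw [hQt, ← hVW _ ⟨h2, h3⟩]
        simp only [hk]
        rw [hχt, mul_one, hpsq]
        nlinarith [sq_nonneg e]
      · rcases h with h | h <;> linarith
    · refine ⟨0, ?_, ?_, fun _ => rfl⟩
      · refine (hasDerivAt_const t β).congr_of_eventuallyEq ?_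
        filter_upwards [Ioi_mem_nhds h1] with r hr using hQT r hr.le
      · rw [hQT t h1.le, hβ]
        simpa using hk0 t
  · set g : ℝ → ℝ := fun t => p (Q₀ t) ^ 2 with hg
    have hgc : Continuous g := by fun_prop
    have hgi : ∀ a b, IntervalIntegrable g volume a b := fun a b => hgc.intervalIntegrable a b
    have h1 : ∫ t in (-1)..0, g t = e ^ 2 := by
      rw [intervalIntegral.integral_congr (g := fun _ => e ^ 2)]
      · simp
      · intro t ht
        rw [uIcc_of_le (by norm_num)] at ht
        simp only [hg]
        rw [hpsq, hVα _ (hQ₀0 ▸ hQ₀m.monotone ht.2), mul_zero, add_zero]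
    have h2 : ∫ t in T..(T + 1), g t = e ^ 2 := by
      rw [intervalIntegral.integral_congr (g := fun _ => e ^ 2)]
      · simp
      · intro t ht
        rw [uIcc_of_le (by linarith)] at ht
        simp only [hg]
        rw [hpsq, hVβ _ (hT ▸ hQ₀m.monotone ht.1), mul_zero, add_zero]
    -- Since `Q₀' = p (Q₀)`, one factor of `p (Q₀) ^ 2` is the Jacobian of the substitution `s = Q₀
    -- t`.
    have h3 : ∫ t in 0..T, g t = ∫ s in α..β, p s := by
      have := intervalIntegral.integral_comp_mul_deriv (a := 0) (b := T) (f := Q₀)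
        (f' := fun t => p (Q₀ t)) (g := p) (fun t _ => hQ₀d t)
        (hpc.comp hQ₀c).continuousOn hpc
      rw [hQ₀0, hT] at this
      rw [← this]
      refine intervalIntegral.integral_congr fun t _ => ?_
      simp only [hg, Function.comp]
      ring
    have h4 : ∫ s in α..β, p s ≤ (∫ s in α..β, √(2 * W s)) + (β - α) * e := by
      have : (β - α) * e = ∫ s in α..β, e := by simp
      rw [this, ← intervalIntegral.integral_add
        ((by fun_prop : Continuous fun s => √(2 * W s)).intervalIntegrable _ _) (by simp)]
      refine intervalIntegral.integral_mono_on hαβ.le (hpc.intervalIntegrable _ _)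
        ((by fun_prop : Continuous fun s => √(2 * W s) + e).intervalIntegrable _ _) fun s hs => ?_
      have := Real.sqrt_nonneg (2 * W s)
      refine Real.sqrt_le_iff.2 ⟨by positivity, ?_⟩
      rw [hVW s hs]
      have h5 := Real.sq_sqrt (mul_nonneg zero_le_two (hW0 s))
      nlinarith
    calc ∫⁻ s, ENNReal.ofReal (k s)
        ≤ ∫⁻ s in Icc (-1) (T + 1), ENNReal.ofReal (g s) := by
          rw [← lintegral_indicator measurableSet_Icc]
          refine lintegral_mono fun s => ?_
          by_cases hs : s ∈ Icc (-1) (T + 1)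
          · rw [indicator_of_mem hs]
            exact ENNReal.ofReal_le_ofReal (hkp s)
          · rw [hksupp s hs]
            simp
      _ = ENNReal.ofReal (∫ s in (-1)..(T + 1), g s) := by
          rw [intervalIntegral.integral_of_le (by linarith), ← integral_Icc_eq_integral_Ioc,
            ofReal_integral_eq_lintegral_ofReal
              (hgc.continuousOn.integrableOn_compact isCompact_Icc)
              (Eventually.of_forall fun s => sq_nonneg _)]
      _ ≤ _ := by
          refine ENNReal.ofReal_le_ofReal ?_
          rw [← intervalIntegral.integral_add_adjacent_intervals (hgi (-1) 0) (hgi 0 (T + 1)),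
            ← intervalIntegral.integral_add_adjacent_intervals (hgi 0 T) (hgi T (T + 1)),
            h1, h2, h3]
          nlinarith

end Profile


/-! ### Rescaling on the line. -/

section Rescaling

theorem lipschitzWith_add_div {ε : ℝ} (hε : 0 < ε) (s : ℝ) :
    LipschitzWith (Real.toNNReal ε⁻¹) fun t : ℝ => (t + s) / ε := by
  refine LipschitzWith.of_dist_le_mul fun a b => ?_
  rw [Real.dist_eq, Real.dist_eq, Real.coe_toNNReal _ (by positivity), ← sub_div,
    add_sub_add_right_eq_sub, abs_div, abs_of_pos hε, div_eq_inv_mul]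

theorem lintegral_comp_add_div {g : ℝ → ℝ≥0∞} (hg : Measurable g) {ε : ℝ} (hε : 0 < ε) (s : ℝ) :
    ∫⁻ r, g ((r + s) / ε) = ENNReal.ofReal ε * ∫⁻ r, g r := by
  have h2 := Real.map_volume_mul_left (inv_pos.2 hε).ne'
  rw [inv_inv, abs_of_pos hε] at h2
  rw [lintegral_add_right_eq_self (fun r => g (r / ε)) s, ← smul_eq_mul,
    ← lintegral_smul_measure, ← h2, lintegral_map hg (by fun_prop)]
  simp_rw [div_eq_inv_mul]

/-- `|r| ≤ (T + 1) ε + s`, and the shift is at most `T ε`: hence the factor `2 T + 1`. -/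
theorem abs_le_of_rescaled {T τ ε s r : ℝ} (hε : 0 < ε) (hs : s ∈ Icc 0 (T * ε))
    (hετ : (2 * T + 1) * ε ≤ τ) (hr : |(r + s) / ε| ≤ T + 1) : |r| ≤ τ := by
  rw [abs_div, abs_of_pos hε, div_le_iff₀ hε, abs_le] at hr
  rw [abs_le]
  constructor <;> nlinarith [hs.1, hs.2]

end Rescaling

/-! ### Energy, `L¹` distance and mass of the transitions. -/

section Transition

variable {N : ℕ} {M : Type*} [EMetricSpace M] [SigmaCompactSpace M] [ChartedSpace (Model N) M]
  [IsManifold (𝓡 N) ∞ M] [RiemannianBundle (fun x : M => TangentSpace (𝓡 N) x)]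
  [IsContMDiffRiemannianBundle (𝓡 N) ∞ (Model N) (fun x : M => TangentSpace (𝓡 N) x)]
  [IsRiemannianManifold (𝓡 N) M]

/-- By continuity `d` is locally constant off `K`, so its gradient is bounded on the whole of `M`.
-/
theorem exists_lipschitz_of_abs_eq_one {d : M → ℝ} (hd : ContMDiff (𝓡 N) 𝓘(ℝ, ℝ) ∞ d) {K : Set M}
    (hK : IsCompact K) (hdK : ∀ z, z ∉ K → |d z| = 1) : ∃ C : ℝ≥0, LipschitzWith C d := by
  have hd1 : ContMDiff (𝓡 N) 𝓘(ℝ, ℝ) 1 d := hd.of_le (by exact_mod_cast le_top)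
  obtain ⟨C, hC0, hC⟩ := exists_gradNorm_le_of_const_off hd1 hK fun x hx => by
    have hev := hK.isClosed.isOpen_compl.mem_nhds hx
    have hc := hd.continuous.continuousAt (x := x)
    rcases eq_or_eq_neg_of_abs_eq (hdK x hx) with h | h
    · refine ⟨1, ?_⟩
      filter_upwards [hev, hc.eventually_const_lt (h ▸ one_pos : 0 < d x)] with z hz hz0
      rw [← hdK z hz, abs_of_pos hz0]
    · refine ⟨-1, ?_⟩
      filter_upwards [hev, hc.eventually_lt_const (by linarith : d x < 0)] with z hz hz0
      rw [← hdK z hz, abs_of_neg hz0, neg_neg]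
  exact ⟨C, lipschitzWith_of_gradNorm_le hd1 hC0 hC⟩

theorem gradNorm_comp_le {d : M → ℝ} {x : M} (hd : MDifferentiableAt (𝓡 N) 𝓘(ℝ, ℝ) d x) {h : ℝ → ℝ}
    {q : ℝ} (hh : HasDerivAt h q (d x)) :
    gradNorm (N := N) (fun z => h (d z)) x ≤ |q| * gradNorm (N := N) d x := by
  refine (gradNorm_le_iff (mul_nonneg (abs_nonneg q) (gradNorm_nonneg d x))).2 fun v => ?_
  rw [diff_comp hh hd, abs_mul, mul_assoc]
  exact mul_le_mul_of_nonneg_left (abs_diff_le d x v) (abs_nonneg q)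

variable [MeasurableSpace M] [BorelSpace M]

theorem vol_level_eq_zero {d : M → ℝ} (hd : Continuous d) {τ : ℝ} {C : ℝ≥0}
    (hC : ∀ k : ℝ → ℝ≥0∞, Measurable k → (∀ t, τ < |t| → k t = 0) →
      ∫⁻ x, k (d x) ∂(vol N M) ≤ C * ∫⁻ s, k s) {r : ℝ} (hr : |r| ≤ τ) :
    vol N M {x | d x = r} = 0 := by
  have h1 := hC (indicator {r} 1) (measurable_one.indicator (measurableSet_singleton r))
    fun t ht => indicator_of_notMem (fun h => ht.not_ge (by rwa [mem_singleton_iff.1 h])) _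
  rw [lintegral_indicator_one (measurableSet_singleton r), Real.volume_singleton, mul_zero] at h1
  refine le_antisymm (le_trans (le_of_eq ?_) h1) zero_le
  rw [← lintegral_indicator_one (isClosed_eq hd continuous_const).measurableSet]
  refine lintegral_congr fun x => ?_
  simp [indicator]

/-- The energy of a rescaled profile composed with `d`. -/
theorem energy_transition_le {W : ℝ → ℝ} (hW : Continuous W) (hW0 : ∀ s, 0 ≤ W s) {d : M → ℝ}
    (hd : ContMDiff (𝓡 N) 𝓘(ℝ, ℝ) ∞ d) {Ω : Set M} {τ c : ℝ} {C D : ℝ≥0}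
    (hc : 1 ≤ c)
    (hgrad : ∀ z, |d z| ≤ τ → gradNorm (N := N) d z ≤ c)
    (hC : ∀ k : ℝ → ℝ≥0∞, Measurable k → (∀ t, τ < |t| → k t = 0) →
      ∫⁻ x, k (d x) ∂(vol N M) ≤ C * ∫⁻ s, k s)
    (hD : ∀ k : ℝ → ℝ, Continuous k → (∀ t, 0 ≤ k t) → (∀ t, τ < |t| → k t = 0) →
      ∫⁻ x in Ω, ENNReal.ofReal (k (d x)) ∂(vol N M) ≤ D * ∫⁻ s, ENNReal.ofReal (k s))
    {Q k : ℝ → ℝ} {T : ℝ} (hT : 0 < T) (hQ : Continuous Q) (hk : Continuous k)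
    (hk0 : ∀ t, 0 ≤ k t) (hkT : ∀ t, T + 1 < |t| → k t = 0)
    (hQk : ∀ t, t ≠ 0 → t ≠ T → ∃ q, HasDerivAt Q q t ∧ q ^ 2 / 2 + W (Q t) ≤ k t ∧
        (t < 0 ∨ T < t → q = 0)) {ε s : ℝ} (hε : 0 < ε) (hετ : (2 * T + 1) * ε ≤ τ)
    (hs : s ∈ Icc 0 (T * ε)) :
    energy N W Ω ε (fun x => Q ((d x + s) / ε)) ≤
      ENNReal.ofReal (c ^ 2) * (D * ∫⁻ s, ENNReal.ofReal (k s)) := by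
  have hsupp : ∀ r, τ < |r| → T + 1 < |(r + s) / ε| := fun r hr => by
    by_contra! h
    exact hr.not_ge (abs_le_of_rescaled hε hs hετ h)
  -- The points where `Q` may fail to be differentiable correspond to two level sets of `d`, which
  -- are null.
  have hnull : ∀ t ∈ Icc 0 T, ∀ᵐ x ∂(vol N M), (d x + s) / ε ≠ t := by
    intro t ht
    have hr : |t * ε - s| ≤ τ := by
      refine abs_le_of_rescaled hε hs hετ ?_
      rw [sub_add_cancel, mul_div_cancel_right₀ _ hε.ne', abs_of_nonneg ht.1]
      linarith [ht.2]
    filter_upwards [measure_eq_zero_iff_ae_notMem.1 (vol_level_eq_zero hd.continuous hC hr)]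
      with x hx hx'
    refine hx ?_
    rw [← hx', div_mul_cancel₀ _ hε.ne']
    ring
  have hWm : Measurable fun x => ENNReal.ofReal (W (Q ((d x + s) / ε))) := by
    have := hd.continuous
    exact (by fun_prop : Continuous fun x => W (Q ((d x + s) / ε))).measurable.ennreal_ofReal
  have hpt : ∀ᵐ x ∂(vol N M),
      ENNReal.ofReal (ε / 2) *
          ENNReal.ofReal (gradNorm (N := N) (fun x => Q ((d x + s) / ε)) x ^ 2) +
        ENNReal.ofReal (1 / ε) * ENNReal.ofReal (W (Q ((d x + s) / ε))) ≤
      ENNReal.ofReal (c ^ 2 * ε⁻¹) * ENNReal.ofReal (k ((d x + s) / ε)) := by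
    filter_upwards [hnull 0 ⟨le_rfl, hT.le⟩, hnull T ⟨hT.le, le_rfl⟩] with x h0 hTx
    set t := (d x + s) / ε with ht
    obtain ⟨q, hq, hqk, hq0⟩ := hQk t h0 hTx
    have hder : HasDerivAt (fun r => Q ((r + s) / ε)) (q * ε⁻¹) (d x) := by
      have h1 : HasDerivAt (fun r => (r + s) / ε) ε⁻¹ (d x) := by
        simpa using ((hasDerivAt_id (d x)).add_const s).div_const ε
      exact hq.comp (d x) h1
    have hg := gradNorm_comp_le (hd.mdifferentiable (by simp) x) hder
    set G := gradNorm (N := N) (fun x => Q ((d x + s) / ε)) x with hG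
    have hG0 : 0 ≤ G := gradNorm_nonneg _ _
    -- The gradient of `d` is controlled only on the layer, but outside it the profile is constant.
    have hGc : G ≤ |q * ε⁻¹| * c := by
      by_cases hx : |d x| ≤ τ
      · exact hg.trans (mul_le_mul_of_nonneg_left (hgrad x hx) (abs_nonneg _))
      · have h2 := hsupp _ (not_le.1 hx)
        have : q = 0 := by
          refine hq0 ?_
          rcases lt_abs.1 h2 with h | h
          · right
            linarith
          · left
            linarith
        rw [this] at hg ⊢
        simpa using hg
    have hG2 : G ^ 2 ≤ q ^ 2 * (ε⁻¹) ^ 2 * c ^ 2 := by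
      calc G ^ 2 ≤ (|q * ε⁻¹| * c) ^ 2 := by gcongr
        _ = _ := by rw [mul_pow, sq_abs, mul_pow]
    rw [← ENNReal.ofReal_mul (by positivity), ← ENNReal.ofReal_mul (by positivity),
      ← ENNReal.ofReal_mul (by positivity),
      ← ENNReal.ofReal_add (by positivity) (mul_nonneg (by positivity) (hW0 _))]
    refine ENNReal.ofReal_le_ofReal ?_
    -- Both terms scale like `ε⁻¹`; the potential term is enlarged by `c ^ 2 ≥ 1` to share the
    -- factor.
    calc ε / 2 * G ^ 2 + 1 / ε * W (Q t)
        ≤ ε / 2 * (q ^ 2 * (ε⁻¹) ^ 2 * c ^ 2) + 1 / ε * (c ^ 2 * W (Q t)) := by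
          gcongr
          exact le_mul_of_one_le_left (hW0 _) (one_le_pow₀ hc)
      _ = c ^ 2 * ε⁻¹ * (q ^ 2 / 2 + W (Q t)) := by
          field_simp
      _ ≤ c ^ 2 * ε⁻¹ * k t := by gcongr
  have hkε : Continuous fun r => k ((r + s) / ε) := by fun_prop
  rw [energy, ← lintegral_const_mul' _ _ ENNReal.ofReal_ne_top,
    ← lintegral_const_mul' _ _ ENNReal.ofReal_ne_top,
    ← lintegral_add_right _ (hWm.const_mul _)]
  calc _ ≤ ∫⁻ x in Ω, ENNReal.ofReal (c ^ 2 * ε⁻¹) * ENNReal.ofReal (k ((d x + s) / ε))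
          ∂(vol N M) := lintegral_mono_ae (ae_restrict_of_ae hpt)
    _ = ENNReal.ofReal (c ^ 2 * ε⁻¹) * ∫⁻ x in Ω, ENNReal.ofReal (k ((d x + s) / ε))
          ∂(vol N M) := lintegral_const_mul' _ _ ENNReal.ofReal_ne_top
    _ ≤ ENNReal.ofReal (c ^ 2 * ε⁻¹) * (D * ∫⁻ r, ENNReal.ofReal (k ((r + s) / ε))) := by
        gcongr
        exact hD (fun r => k ((r + s) / ε)) hkε (fun _ => hk0 _) fun r hr => hkT _ (hsupp r hr)
    _ = _ := by
        rw [lintegral_comp_add_div (g := fun r => ENNReal.ofReal (k r))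
          hk.measurable.ennreal_ofReal hε, ENNReal.ofReal_mul (by positivity)]
        have : ENNReal.ofReal ε⁻¹ * ENNReal.ofReal ε = 1 := by
          rw [← ENNReal.ofReal_mul (by positivity), inv_mul_cancel₀ hε.ne', ENNReal.ofReal_one]
        calc _ = ENNReal.ofReal (c ^ 2) * (D * ((ENNReal.ofReal ε⁻¹ * ENNReal.ofReal ε) *
              ∫⁻ r, ENNReal.ofReal (k r))) := by ring
          _ = _ := by rw [this, one_mul]

/-- The two functions differ only where `|d| ≤ T ε`, and there by at most `β - α`, so the layer
estimate applies to a multiple of the indicator of that interval. -/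
theorem lintegral_transition_sub_le {A : Set M} {α β : ℝ} (hαβ : α < β) {d : M → ℝ}
    (hdA : {x | d x < 0} =ᵐ[vol N M] A) {τ : ℝ} {C : ℝ≥0}
    (hC : ∀ k : ℝ → ℝ≥0∞, Measurable k → (∀ t, τ < |t| → k t = 0) →
      ∫⁻ x, k (d x) ∂(vol N M) ≤ C * ∫⁻ s, k s)
    {Q : ℝ → ℝ} {T : ℝ} (hT : 0 < T) (hQmem : ∀ t, Q t ∈ Icc α β)
    (hQ0 : ∀ t ≤ 0, Q t = α) (hQT : ∀ t, T ≤ t → Q t = β) {ε s : ℝ} (hε : 0 < ε)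
    (hετ : (2 * T + 1) * ε ≤ τ) (hs : s ∈ Icc 0 (T * ε)) :
    ∫⁻ x, ENNReal.ofReal |Q ((d x + s) / ε) - twoValued A α β x| ∂(vol N M) ≤
      C * ENNReal.ofReal ((β - α) * (2 * T) * ε) := by
  set I := Icc (-(T * ε)) (T * ε) with hI
  have h1 := hC (I.indicator fun _ => ENNReal.ofReal (β - α))
    (measurable_const.indicator measurableSet_Icc) fun t ht =>
      indicator_of_notMem (fun h => ht.not_ge ((abs_le.2 ⟨h.1, h.2⟩).trans (by nlinarith))) _
  rw [lintegral_indicator_const measurableSet_Icc, Real.volume_Icc,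
    ← ENNReal.ofReal_mul (by linarith)] at h1
  refine le_trans (lintegral_mono_ae ?_) (h1.trans (le_of_eq ?_))
  · filter_upwards [hdA.mem_iff] with x hx
    have hQm := hQmem ((d x + s) / ε)
    by_cases hxI : d x ∈ I
    · rw [indicator_of_mem hxI]
      refine ENNReal.ofReal_le_ofReal ?_
      unfold twoValued
      split_ifs <;> rw [abs_le] <;> constructor <;> linarith [hQm.1, hQm.2]
    · refine le_of_eq_of_le ?_ zero_le
      rw [ENNReal.ofReal_eq_zero]
      refine le_of_eq (abs_eq_zero.2 (sub_eq_zero.2 ?_))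
      have hcase : d x < -(T * ε) ∨ T * ε < d x := by
        by_contra! h
        exact hxI ⟨h.1, h.2⟩
      have hTε : 0 < T * ε := by positivity
      rcases hcase with h | h
      · have hxA : x ∈ A := hx.1 (by linarith)
        rw [hQ0 _ (div_nonpos_of_nonpos_of_nonneg (by linarith [hs.2]) hε.le), twoValued,
          if_pos hxA]
      · have hxA : x ∉ A := fun hxA => by
          have : d x < 0 := hx.2 hxA
          linarith
        rw [hQT _ ((le_div_iff₀ hε).2 (by linarith [hs.1])), twoValued, if_neg hxA]
  · congr 2
    ring

theorem integrableOn_of_mem_Icc {Ω : Set M} (hΩc : IsCompact (closure Ω)) {α β : ℝ} {f : M → ℝ}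
    (hfm : Measurable f) (hf : ∀ x, f x ∈ Icc α β) : IntegrableOn f Ω (vol N M) := by
  have hfin : vol N M Ω ≠ ⊤ := ((measure_mono subset_closure).trans_lt hΩc.measure_lt_top).ne
  refine Measure.integrableOn_of_bounded (M := max |α| |β|) hfin hfm.aestronglyMeasurable
    (Eventually.of_forall fun x => ?_)
  exact abs_le_max_abs_abs (hf x).1 (hf x).2

theorem measurable_twoValued {A : Set M} (hA : IsOpen A) (α β : ℝ) :
    Measurable (twoValued A α β) := by
  classical
  unfold twoValued
  exact Measurable.ite hA.measurableSet measurable_const measurable_const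

theorem twoValued_mem_Icc {X : Type*} (A : Set X) {α β : ℝ} (hαβ : α < β) (x : X) :
    twoValued A α β x ∈ Icc α β := by
  unfold twoValued
  split_ifs
  · exact ⟨le_rfl, hαβ.le⟩
  · exact ⟨hαβ.le, le_rfl⟩

/-- A suitable shift of the transition has the mass of the sharp interface. -/
theorem exists_shift {A Ω : Set M} (hA : IsOpen A) (hΩc : IsCompact (closure Ω)) {α β : ℝ}
    (hαβ : α < β) {d : M → ℝ} (hd : Continuous d) (hdA : {x | d x < 0} =ᵐ[vol N M] A)
    {Q : ℝ → ℝ} {T : ℝ} (hT : 0 < T) (hQ : Continuous Q) (hQmem : ∀ t, Q t ∈ Icc α β)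
    (hQ0 : ∀ t ≤ 0, Q t = α) (hQT : ∀ t, T ≤ t → Q t = β) {ε : ℝ} (hε : 0 < ε) :
    ∃ s ∈ Icc 0 (T * ε), ∫ x in Ω, Q ((d x + s) / ε) ∂(vol N M) =
      ∫ x in Ω, twoValued A α β x ∂(vol N M) := by
  have hint : ∀ s, IntegrableOn (fun x => Q ((d x + s) / ε)) Ω (vol N M) := fun s =>
    integrableOn_of_mem_Icc hΩc (by fun_prop : Continuous _).measurable fun x => hQmem _
  have hint0 : IntegrableOn (twoValued A α β) Ω (vol N M) :=
    integrableOn_of_mem_Icc hΩc (measurable_twoValued hA α β) (twoValued_mem_Icc A hαβ)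
  have hfin : vol N M Ω ≠ ⊤ := ((measure_mono subset_closure).trans_lt hΩc.measure_lt_top).ne
  have hcont : Continuous fun s => ∫ x in Ω, Q ((d x + s) / ε) ∂(vol N M) := by
    refine continuous_of_dominated (bound := fun _ => max |α| |β|)
      (fun s => (hint s).aestronglyMeasurable)
      (fun s => Eventually.of_forall fun x => abs_le_max_abs_abs (hQmem _).1 (hQmem _).2)
      (integrableOn_const hfin) (Eventually.of_forall fun x => by fun_prop)
  have hmem := ae_restrict_of_ae (s := Ω) hdA.mem_iff
  -- Unshifted, the transition takes place entirely in `{d ≥ 0}` and lies below the sharp interface;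
  -- shifted by `T ε` it takes place in `{d ≤ 0}` and lies above.
  have h0 : ∫ x in Ω, Q ((d x + 0) / ε) ∂(vol N M) ≤ ∫ x in Ω, twoValued A α β x ∂(vol N M) := by
    refine integral_mono_ae (hint 0) hint0 ?_
    filter_upwards [hmem] with x hx
    unfold twoValued
    split_ifs with hxA
    · have : d x < 0 := hx.2 hxA
      exact (hQ0 _ (div_nonpos_of_nonpos_of_nonneg (by linarith) hε.le)).le
    · exact (hQmem _).2
  have h1 : ∫ x in Ω, twoValued A α β x ∂(vol N M) ≤
      ∫ x in Ω, Q ((d x + T * ε) / ε) ∂(vol N M) := by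
    refine integral_mono_ae hint0 (hint _) ?_
    filter_upwards [hmem] with x hx
    unfold twoValued
    split_ifs with hxA
    · exact (hQmem _).1
    · have : 0 ≤ d x := not_lt.1 fun h => hxA (hx.1 h)
      exact (hQT _ ((le_div_iff₀ hε).2 (by linarith))).ge
  exact intermediate_value_Icc (by positivity) hcont.continuousOn ⟨h0, h1⟩

theorem setIntegral_twoValued {A Ω : Set M} (hA : IsOpen A) (hΩ : IsOpen Ω)
    (hΩc : IsCompact (closure Ω)) {α β : ℝ} (hαβ : α < β) :
    ∫ x in Ω, twoValued A α β x ∂(vol N M) =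
      α * (vol N M).real (A ∩ Ω) + β * (vol N M).real (Ω \ A) := by
  have hint0 : IntegrableOn (twoValued A α β) Ω (vol N M) :=
    integrableOn_of_mem_Icc hΩc (measurable_twoValued hA α β) (twoValued_mem_Icc A hαβ)
  rw [← integral_inter_add_sdiff hA.measurableSet hint0]
  congr 1
  · rw [setIntegral_congr_fun (f := twoValued A α β) (g := fun _ => α) (hΩ.measurableSet.inter hA.measurableSet)
      fun x hx => if_pos hx.2, setIntegral_const, smul_eq_mul, inter_comm, mul_comm]
  · rw [setIntegral_congr_fun (f := twoValued A α β) (g := fun _ => β) (hΩ.measurableSet.diff hA.measurableSet)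
      fun x hx => if_neg hx.2, setIntegral_const, smul_eq_mul, mul_comm]

end Transition

/-! ### Diagonal choice. -/

section Diagonal

/-- A choice of almost minimizers of a family of functionals whose infima tend to zero. -/
theorem exists_diagonal {X : Type*} {s : Set X} (hs : s.Nonempty) {b : ℝ → X → ℝ≥0∞}
    (h : ∀ ζ : ℝ≥0, ζ ≠ 0 → ∀ᶠ ε in 𝓝[>] (0 : ℝ), ∃ x ∈ s, b ε x ≤ ζ) :
    ∃ f : ℝ → X, (∀ ε, f ε ∈ s) ∧ Tendsto (fun ε => b ε (f ε)) (𝓝[>] 0) (𝓝 0) := by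
  -- No extraction of sequences: for each `ε` some element is within `ε` of the infimum. Any element
  -- serves if the infimum is infinite or `ε ≤ 0`.
  have hex : ∀ ε : ℝ, ∃ x ∈ s, 0 < ε → ∀ y ∈ s, b ε x ≤ b ε y + ENNReal.ofReal ε := by
    intro ε
    by_cases hε : 0 < ε
    · by_cases htop : ⨅ y ∈ s, b ε y = ⊤
      · obtain ⟨x, hx⟩ := hs
        refine ⟨x, hx, fun _ y hy => ?_⟩
        have : b ε y = ⊤ := top_le_iff.1 (htop ▸ iInf₂_le y hy)
        rw [this, top_add]
        exact le_top
      · have hlt := ENNReal.lt_add_right htop (ENNReal.ofReal_pos.2 hε).ne'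
        simp only [iInf_lt_iff] at hlt
        obtain ⟨x, hx, hlt⟩ := hlt
        exact ⟨x, hx, fun _ y hy => hlt.le.trans (by gcongr; exact iInf₂_le y hy)⟩
    · obtain ⟨x, hx⟩ := hs
      exact ⟨x, hx, fun h => (hε h).elim⟩
  choose f hfs hf using hex
  refine ⟨f, hfs, ?_⟩
  rw [ENNReal.tendsto_nhds_zero]
  intro ζ hζ
  obtain ⟨ζ', hζ'0, hζ'⟩ := ENNReal.lt_iff_exists_nnreal_btwn.1 hζ
  have hζ'ne : ζ' ≠ 0 := by simpa [pos_iff_ne_zero] using hζ'0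
  have hpos : (0 : ℝ) < ζ' / 2 := by positivity
  filter_upwards [h (ζ' / 2) (by simpa using hζ'ne), self_mem_nhdsWithin,
    mem_nhdsWithin_of_mem_nhds (Iio_mem_nhds hpos)] with ε ⟨x, hx, hbx⟩ hε hεζ
  refine ((hf ε hε x hx).trans ?_).trans hζ'.le
  calc b ε x + ENNReal.ofReal ε ≤ (ζ' / 2 : ℝ≥0) + (ζ' / 2 : ℝ≥0) := by
        gcongr
        rw [← ENNReal.ofReal_coe_nnreal]
        refine ENNReal.ofReal_le_ofReal ?_
        push_cast
        exact le_of_lt hεζ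
    _ = ζ' := by rw [← ENNReal.coe_add, add_halves]

end Diagonal


/-! ### Recovery functions. -/

section Recovery

variable {N : ℕ} {M : Type*} [EMetricSpace M] [SigmaCompactSpace M] [ChartedSpace (Model N) M]
  [IsManifold (𝓡 N) ∞ M] [RiemannianBundle (fun x : M => TangentSpace (𝓡 N) x)]
  [IsContMDiffRiemannianBundle (𝓡 N) ∞ (Model N) (fun x : M => TangentSpace (𝓡 N) x)]
  [IsRiemannianManifold (𝓡 N) M] [MeasurableSpace M] [BorelSpace M]

variable (N) in
/-- The Lipschitz functions with values in `[α, β]` and the mass of the sharp interface. -/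
def competitors (A Ω : Set M) (α β : ℝ) : Set (M → ℝ) :=
  {v | (∃ K : ℝ≥0, LipschitzWith K v) ∧ (∀ x, α ≤ v x ∧ v x ≤ β) ∧
    ∫ x in Ω, v x ∂(vol N M) = ∫ x in Ω, twoValued A α β x ∂(vol N M)}

/-- The left side is continuous in `η` at zero, where it equals `P * σ`. -/
theorem exists_pos_perimeter_bound {P σ ζ : ℝ} (hζ : 0 < ζ) :
    ∃ η : ℝ, 0 < η ∧ 8 * η < 1 ∧
      (1 + 2 * η) ^ 2 * (η + (P + η) / (1 - 4 * η)) * σ ≤ P * σ + ζ := by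
  have hc : ContinuousAt (fun η : ℝ => (1 + 2 * η) ^ 2 * (η + (P + η) / (1 - 4 * η)) * σ) 0 := by
    have h0 : (1 : ℝ) - 4 * 0 ≠ 0 := by norm_num
    fun_prop (disch := exact h0)
  have h1 := hc.eventually_lt_const (u := P * σ + ζ) (by simpa using hζ)
  have h2 : ∀ᶠ η : ℝ in 𝓝 0, η < 1 / 8 := Iio_mem_nhds (by norm_num)
  obtain ⟨η, ⟨hη1, hη2⟩, hη0⟩ :=
    (((h1.and h2).filter_mono nhdsWithin_le_nhds).and
      (self_mem_nhdsWithin : Ioi (0 : ℝ) ∈ 𝓝[>] 0)).exists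
  exact ⟨η, hη0, by linarith, hη1.le⟩

/-- The parameters are chosen in turn: `η` from the tolerance, then `d` with its constant `D`, then
the profile with an excess `δ` adapted to `D`, and finally `ε` small enough for the transition to
fit into the layer. -/
theorem exists_recovery {W : ℝ → ℝ} (hW : Continuous W) (hW0 : ∀ s, 0 ≤ W s) {α β : ℝ}
    (hαβ : α < β) (hα : W α = 0) (hβ : W β = 0) {A Ω : Set M} (hA : IsOpen A) (hΩ : IsOpen Ω)
    (hAc : IsCompact (frontier A)) (hAs : IsSmoothHypersurface N (frontier A))
    (hAΩ : μH[(N : ℝ) - 1] (frontier A ∩ frontier Ω) = 0) (hΩc : IsCompact (closure Ω))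
    {ζ : ℝ≥0} (hζ : ζ ≠ 0) :
    ∀ᶠ ε in 𝓝[>] (0 : ℝ), ∃ v ∈ competitors N A Ω α β,
      ∫⁻ x, ENNReal.ofReal |v x - twoValued A α β x| ∂(vol N M) ≤ ζ ∧
      energy N W Ω ε v ≤
        perimeter N A Ω * ENNReal.ofReal (∫ s in α..β, √(2 * W s)) + ζ := by
  set σ := ∫ s in α..β, √(2 * W s) with hσ
  have hσ0 : 0 ≤ σ := intervalIntegral.integral_nonneg hαβ.le fun s _ => Real.sqrt_nonneg _
  have hζ0 : (0 : ℝ) < ζ := by positivity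
  obtain ⟨η, hη, hη8, hηP⟩ := exists_pos_perimeter_bound (P := (perimeter N A Ω).toReal) (σ := σ)
    (half_pos hζ0)
  obtain ⟨d, K, τ, C, D, hd, hK, hdK, hdA, hτ0, hτ1, hgrad, hC, hDP, hD⟩ :=
    exists_layer_data hA hΩ hAc hAs hAΩ hη hη8
  set c := 1 + 2 * η with hc
  -- The profile may cost `ζ / 2` after multiplication by `c ^ 2 * D`; the other half of `ζ` was
  -- spent on `η`.
  set δ := ζ / 2 / (c ^ 2 * D + 1) with hδ
  have hδ0 : 0 < δ := by positivity
  have hδζ : c ^ 2 * D * δ ≤ ζ / 2 := by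
    have h1 : δ * (c ^ 2 * D + 1) = ζ / 2 := div_mul_cancel₀ _ (by positivity)
    nlinarith
  obtain ⟨Q, k, T, L, hT, hQL, hQmem, hQ0, hQT, hk, hk0, hkT, hQk, hkint⟩ :=
    exists_profile hW hW0 hαβ hα hβ hδ0
  obtain ⟨Ld, hLd⟩ := exists_lipschitz_of_abs_eq_one hd hK hdK
  have hev1 : ∀ᶠ ε in 𝓝[>] (0 : ℝ), (2 * T + 1) * ε < τ := by
    have : Tendsto (fun ε : ℝ => (2 * T + 1) * ε) (𝓝[>] 0) (𝓝 0) := by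
      simpa using ((continuous_const_mul (2 * T + 1)).tendsto (0 : ℝ)).mono_left
        nhdsWithin_le_nhds
    exact this.eventually_lt_const hτ0
  have hev2 : ∀ᶠ ε in 𝓝[>] (0 : ℝ), C * ((β - α) * (2 * T) * ε) < ζ := by
    have : Tendsto (fun ε : ℝ => C * ((β - α) * (2 * T) * ε)) (𝓝[>] 0) (𝓝 0) := by
      have hcont : Continuous fun ε : ℝ => C * ((β - α) * (2 * T) * ε) := by fun_prop
      simpa using (hcont.tendsto 0).mono_left nhdsWithin_le_nhds
    exact this.eventually_lt_const hζ0
  filter_upwards [hev1, hev2, self_mem_nhdsWithin] with ε hετ hεζ hε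
  have hε : 0 < ε := hε
  obtain ⟨s, hs, hmass⟩ := exists_shift hA hΩc hαβ hd.continuous hdA hT hQL.continuous hQmem hQ0
    hQT hε
  refine ⟨fun x => Q ((d x + s) / ε), ⟨⟨_, hQL.comp ((lipschitzWith_add_div hε s).comp hLd)⟩,
    fun x => hQmem _, hmass⟩, ?_, ?_⟩
  · refine (lintegral_transition_sub_le hαβ hdA hC hT hQmem hQ0 hQT hε hετ.le hs).trans ?_
    rw [← ENNReal.ofReal_coe_nnreal, ← ENNReal.ofReal_mul C.coe_nonneg,
      ← ENNReal.ofReal_coe_nnreal (p := ζ)]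
    exact ENNReal.ofReal_le_ofReal hεζ.le
  · have hE := energy_transition_le hW hW0 hd (by linarith : 1 ≤ c) hgrad hC hD hT hQL.continuous
      hk hk0 hkT hQk hε hετ.le hs
    have hE' : energy N W Ω ε (fun x => Q ((d x + s) / ε)) ≤
        ENNReal.ofReal (c ^ 2 * D * (σ + δ)) := by
      refine hE.trans ?_
      rw [mul_assoc, ENNReal.ofReal_mul (sq_nonneg c), ENNReal.ofReal_mul D.coe_nonneg,
        ENNReal.ofReal_coe_nnreal]
      gcongr
    refine hE'.trans ?_
    rw [← ENNReal.ofReal_coe_nnreal (p := ζ)]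
    by_cases hP : perimeter N A Ω = ⊤
    -- Infinite perimeter makes the bound trivial unless `σ = 0`. In that case the product is zero,
    -- and the finite `D` leaves only the term `c ^ 2 * D * δ ≤ ζ / 2`.
    · rcases hσ0.eq_or_lt with h | h
      · refine le_add_left (ENNReal.ofReal_le_ofReal ?_)
        rw [← h, zero_add]
        linarith
      · rw [hP, ENNReal.top_mul (ENNReal.ofReal_pos.2 h).ne', top_add]
        exact le_top
    · rw [← ENNReal.ofReal_toReal hP, ← ENNReal.ofReal_mul ENNReal.toReal_nonneg,
        ← ENNReal.ofReal_add (mul_nonneg ENNReal.toReal_nonneg hσ0) hζ0.le]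
      refine ENNReal.ofReal_le_ofReal ?_
      have h1 : c ^ 2 * D * σ ≤
          c ^ 2 * (η + ((perimeter N A Ω).toReal + η) / (1 - 4 * η)) * σ := by
        gcongr
        exact hDP hP
      linarith

end Recovery

end
end RiemannianModica

theorem proposition3p3 {N : ℕ} {M : Type*} [EMetricSpace M] [SigmaCompactSpace M]
    [ChartedSpace (EuclideanSpace ℝ (Fin N)) M] [IsManifold (𝓡 N) ∞ M]
    [RiemannianBundle (fun x : M => TangentSpace (𝓡 N) x)]
    [IsContMDiffRiemannianBundle (𝓡 N) ∞ (EuclideanSpace ℝ (Fin N))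
      (fun x : M => TangentSpace (𝓡 N) x)]
    [IsRiemannianManifold (𝓡 N) M] [CompleteSpace M]
    [MeasurableSpace M] [BorelSpace M]
    (W : ℝ → ℝ) (hWcont : Continuous W) (hWnonneg : ∀ s, 0 ≤ W s)
    (α β : ℝ) (hαβ : α < β) (hWα : W α = 0) (hWβ : W β = 0)
    (A Ω : Set M) (hA : IsOpen A) (hΩ : IsOpen Ω)
    (hAne : (frontier A).Nonempty) (hAcompact : IsCompact (frontier A))
    (hAsmooth : RiemannianModica.IsSmoothHypersurface N (frontier A))
    (hAΩ : μH[(N : ℝ) - 1] (frontier A ∩ frontier Ω) = 0)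
    (hΩcompact : IsCompact (closure Ω))
    (hΩsmooth : RiemannianModica.IsSmoothHypersurface N (frontier (closure Ω))) :
    ∃ v : ℝ → M → ℝ,
      (∀ ε, 0 < ε → ∃ K : ℝ≥0, LipschitzWith K (v ε)) ∧
      (∀ ε, 0 < ε → ∀ x, α ≤ v ε x ∧ v ε x ≤ β) ∧
      Tendsto
        (fun ε => ∫⁻ x, ENNReal.ofReal |v ε x - RiemannianModica.twoValued A α β x|
          ∂(RiemannianModica.vol N M))
        (𝓝[>] 0) (𝓝 0) ∧
      (∀ ε, 0 < ε →
        ∫ x in Ω, v ε x ∂(RiemannianModica.vol N M) =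
            ∫ x in Ω, RiemannianModica.twoValued A α β x ∂(RiemannianModica.vol N M) ∧
          ∫ x in Ω, RiemannianModica.twoValued A α β x ∂(RiemannianModica.vol N M) =
            α * (RiemannianModica.vol N M).real (A ∩ Ω) +
              β * (RiemannianModica.vol N M).real (Ω \ A)) ∧
      limsup (fun ε => RiemannianModica.energy N W Ω ε (v ε)) (𝓝[>] 0) ≤
        RiemannianModica.perimeter N A Ω * ENNReal.ofReal (∫ s in α..β, √(2 * W s)) := by
  classical
  set c := RiemannianModica.perimeter N A Ω * ENNReal.ofReal (∫ s in α..β, √(2 * W s)) with hc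
  have hrec := fun (ζ : ℝ≥0) (hζ : ζ ≠ 0) => RiemannianModica.exists_recovery hWcont hWnonneg hαβ
    hWα hWβ hA hΩ hAcompact hAsmooth hAΩ hΩcompact hζ
  obtain ⟨-, v₀, hv₀, -⟩ := (hrec 1 one_ne_zero).exists
  obtain ⟨v, hv, hlim⟩ := RiemannianModica.exists_diagonal (s := RiemannianModica.competitors N A Ω α β)
    -- The functional adds the `L¹` distance and the truncated excess of the energy over the limit
    -- `c`, so that one choice controls both.
    (b := fun ε v => ∫⁻ x, ENNReal.ofReal |v x - RiemannianModica.twoValued A α β x|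
      ∂(RiemannianModica.vol N M) + (RiemannianModica.energy N W Ω ε v - c)) ⟨v₀, hv₀⟩
    fun ζ hζ => by
      filter_upwards [hrec (ζ / 2) (by simpa using hζ)] with ε ⟨w, hw, hw1, hw2⟩
      refine ⟨w, hw, (add_le_add hw1 (tsub_le_iff_left.2 hw2)).trans (le_of_eq ?_)⟩
      rw [← ENNReal.coe_add, add_halves]
  refine ⟨v, fun ε _ => (hv ε).1, fun ε _ => (hv ε).2.1, ?_, fun ε _ => ⟨(hv ε).2.2,
    RiemannianModica.setIntegral_twoValued hA hΩ hΩcompact hαβ⟩, ?_⟩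
  · exact tendsto_of_tendsto_of_tendsto_of_le_of_le tendsto_const_nhds hlim
      (fun _ => zero_le) fun _ => le_self_add
  · refine ENNReal.le_of_forall_pos_le_add fun ζ hζ _ => ?_
    refine limsup_le_of_le (by isBoundedDefault) ?_
    filter_upwards [ENNReal.tendsto_nhds_zero.1 hlim ζ (by simpa using hζ)] with ε hε
    exact le_add_tsub.trans (by gcongr; exact le_add_self.trans hε)
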